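/- Let $S$ be a discrete valuation ring with maximal ideal $M_S$ and residue field $\bar S=S/M_S$, let $G$ be a finite group acting faithfully on $S$ by ring automorphisms, let $R=S^G$, and assume that $\bar S$ is separable over $\bar R=R/(M_S\cap R)$. Let $f\in Z^2(G,S^*)$ and let $T=S^f*G=\bigoplus_{g\in G}SU_g$ be the crossed product, with multiplication $(sU_g)(tU_h)=s\,g(t)\,f(g,h)\,U_{gh}$. Assume that $T$ is hereditary. Let $\bar f\in Z^2(G,\bar S^*)$ be the image of $f$, let $G_I$ be the inertia group (the kernel of the action of $G$ on $\bar S$), and let $\Gamma_f$ be a maximal subgroup of $G_I$ such that the restriction of $\bar f$ to it is cohomologically trivial. Then: 1. Reduction of coefficients induces a ring isomorphism $T/M_ST\cong\bar S^{\bar f}*G$, and this ring is semisimple. 2. $|\mathrm{Hom}(\Gamma_f,\bar S^*)|=d:=|\Gamma_f|$. 3. $\Gamma_f$ is normal in $G$, and $\bar f$ is cohomologous to a cocycle $f'\in Z^2(G,\bar S^*)$ with $f'(1,1)=1$ and $f'(g_1,g_2)=f'(g_1,g_2a)$ for all $g_1,g_2\in G$, $a\in\Gamma_f$. 4. For every such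 $f'$, the rule $\pi_{\bar f}(g\Gamma_f)(a)=f'(a,g)$ is a well-defined group homomorphism $\pi_{\bar f}:G/\Gamma_f\to\mathrm{Hom}(\Gamma_f,\bar S^*)$; the number of simple components of $T/M_ST\cong\bar S^{\bar f}*G$ is equal to the index of $\pi_{\bar f}(G/\Gamma_f)$ in $\mathrm{Hom}(\Gamma_f,\bar S^*)$; and in particular $\bar S^{\bar f}*G$ is simple if and only if $|\pi_{\bar f}(G/\Gamma_f)|=|\mathrm{Hom}(\Gamma_f,\bar S^*)|=d$. -/

import Mathlib

open groupCohomology IsLocalRing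

/- The action of `G` on the unit group `Kˣ` induced by an action of `G` on `K` by automorphisms:
`((g • u : Kˣ) : K) = g • (u : K)`. -/
attribute [local instance] Units.mulDistribMulActionRight

/-- `Z²(G, Kˣ)`: the (not necessarily normalized) 2-cocycles of `G` with values in the units of a
commutative ring `K` on which `G` acts by ring automorphisms. -/
structure UnitCocycle (G K : Type*) [Group G] [CommRing K] [MulSemiringAction G K] where
  toFun : G × G → Kˣ
  isCocycle : IsMulCocycle₂ toFun

namespace UnitCocycle

variable {G K : Type*} [Group G] [CommRing K] [MulSemiringAction G K]

instance : CoeFun (UnitCocycle G K) (fun _ => G × G → Kˣ) := ⟨toFun⟩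

theorem val_isCocycle (f : UnitCocycle G K) (g h j : G) :
    (f (g * h, j) : K) * (f (g, h) : K) = (g • (f (h, j) : K)) * (f (g, h * j) : K) :=
  congrArg Units.val (f.isCocycle g h j)

/-- Two 2-cocycles are cohomologous: their quotient is a 2-coboundary. -/
def Cohomologous (f f' : UnitCocycle G K) : Prop :=
  IsMulCoboundary₂ (fun p : G × G => f' p / f p)

/-- The restriction of the 2-cocycle `f` to the subgroup `H` is cohomologically trivial. -/
def TrivialOn (f : UnitCocycle G K) (H : Subgroup G) : Prop :=
  IsMulCoboundary₂ (fun p : H × H => f ((p.1 : G), (p.2 : G)))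

/-- The normalization of 2-cocycles with respect to a subgroup `A` under which `π_f` is defined:
`f(1, 1) = 1` and `f(g₁, g₂) = f(g₁, g₂ a)` for `g₁, g₂ ∈ G`, `a ∈ A`. Equivalently, the basis of
the crossed product satisfies `U_{ga} = U_g U_a` for `g ∈ G`, `a ∈ A`. -/
def Adapted (f : UnitCocycle G K) (A : Subgroup G) : Prop :=
  f (1, 1) = 1 ∧ ∀ g₁ g₂ : G, ∀ a ∈ A, f (g₁, g₂) = f (g₁, g₂ * a)

end UnitCocycle

section CrossedMul

variable {G K : Type*} [Group G] [CommRing K] [MulSemiringAction G K] (f : UnitCocycle G K)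

/-- The biadditive multiplication with `(s U_g) (t U_h) = s g(t) f(g,h) U_{gh}`, where a finitely
supported function `x` stands for `∑ x(g) U_g`. -/
noncomputable def crossedMul (x y : G →₀ K) : G →₀ K :=
  x.sum fun g s => y.sum fun h t => Finsupp.single (g * h) (s * (g • t) * (f (g, h) : K))

theorem crossedMul_single (g h : G) (s t : K) :
    crossedMul f (Finsupp.single g s) (Finsupp.single h t) =
      Finsupp.single (g * h) (s * (g • t) * (f (g, h) : K)) := by
  rw [crossedMul, Finsupp.sum_single_index, Finsupp.sum_single_index]
  · simp
  · simp [Finsupp.sum]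

theorem crossedMul_add (x y z : G →₀ K) :
    crossedMul f x (y + z) = crossedMul f x y + crossedMul f x z := by
  simp only [crossedMul]
  rw [← Finsupp.sum_add]
  refine Finsupp.sum_congr fun g _ => ?_
  refine Finsupp.sum_add_index' (fun h => ?_) fun h t t' => ?_
  · simp
  · rw [smul_add, mul_add, add_mul, Finsupp.single_add]

theorem add_crossedMul (x y z : G →₀ K) :
    crossedMul f (x + y) z = crossedMul f x z + crossedMul f y z := by
  simp only [crossedMul]
  refine Finsupp.sum_add_index' (fun g => ?_) fun g s s' => ?_
  · simp [Finsupp.sum]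
  · rw [← Finsupp.sum_add]
    refine Finsupp.sum_congr fun h _ => ?_
    rw [add_mul, add_mul, Finsupp.single_add]

theorem crossedMul_zero (x : G →₀ K) : crossedMul f x 0 = 0 := by
  simp [crossedMul, Finsupp.sum]

theorem zero_crossedMul (x : G →₀ K) : crossedMul f 0 x = 0 := by
  simp [crossedMul]

theorem crossedMul_assoc (x y z : G →₀ K) :
    crossedMul f (crossedMul f x y) z = crossedMul f x (crossedMul f y z) := by
  induction x using Finsupp.induction_linear with
  | zero => simp only [zero_crossedMul]
  | add x x' hx hx' => simp only [add_crossedMul, hx, hx']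
  | single g s =>
    induction y using Finsupp.induction_linear with
    | zero => simp only [zero_crossedMul, crossedMul_zero]
    | add y y' hy hy' => simp only [add_crossedMul, crossedMul_add, hy, hy']
    | single h t =>
      induction z using Finsupp.induction_linear with
      | zero => simp only [crossedMul_zero]
      | add z z' hz hz' => simp only [crossedMul_add, hz, hz']
      | single j r =>
        simp only [crossedMul_single, mul_assoc, smul_mul', mul_smul]
        congr 1
        linear_combination (s * g • t * g • h • r) * f.val_isCocycle g h j

theorem one_crossedMul (x : G →₀ K) :
    crossedMul f (Finsupp.single 1 (((f (1, 1))⁻¹ : Kˣ) : K)) x = x := by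
  induction x using Finsupp.induction_linear with
  | zero => exact crossedMul_zero f _
  | add x x' hx hx' => rw [crossedMul_add, hx, hx']
  | single g s =>
    have h : f (1, g) = f (1, 1) := map_one_fst_of_isMulCocycle₂ f.isCocycle g
    rw [crossedMul_single, one_mul, one_smul, h, mul_right_comm, Units.inv_mul, one_mul]

theorem crossedMul_one (x : G →₀ K) :
    crossedMul f x (Finsupp.single 1 (((f (1, 1))⁻¹ : Kˣ) : K)) = x := by
  induction x using Finsupp.induction_linear with
  | zero => exact zero_crossedMul f _
  | add x x' hx hx' => rw [add_crossedMul, hx, hx']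
  | single g s =>
    have h : f (g, 1) = g • f (1, 1) := map_one_snd_of_isMulCocycle₂ f.isCocycle g
    rw [crossedMul_single, mul_one, h, mul_assoc, Units.coe_smul, ← smul_mul',
      Units.inv_mul, smul_one, mul_one]

theorem smul_crossedMul (t : K) (x y : G →₀ K) :
    crossedMul f (t • x) y = t • crossedMul f x y := by
  induction x using Finsupp.induction_linear with
  | zero => simp only [smul_zero, zero_crossedMul]
  | add x x' hx hx' => rw [smul_add, add_crossedMul, hx, hx', add_crossedMul, smul_add]
  | single g s =>
    induction y using Finsupp.induction_linear with
    | zero => simp only [smul_zero, crossedMul_zero]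
    | add y y' hy hy' => rw [crossedMul_add, hy, hy', crossedMul_add, smul_add]
    | single h r => simp only [Finsupp.smul_single, crossedMul_single, smul_eq_mul, mul_assoc]

theorem single_crossedMul_smul (g : G) (s t : K) (x : G →₀ K) :
    crossedMul f (Finsupp.single g s) (t • x) = (g • t) • crossedMul f (Finsupp.single g s) x := by
  induction x using Finsupp.induction_linear with
  | zero => simp only [smul_zero, crossedMul_zero]
  | add x x' hx hx' => rw [smul_add, crossedMul_add, hx, hx', crossedMul_add, smul_add]
  | single h r =>
    simp only [Finsupp.smul_single, crossedMul_single, smul_mul', smul_eq_mul]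
    congr 1; ring

end CrossedMul

/-- The crossed product `K^f * G = ⨁_{g ∈ G} K U_g`. The element `∑ s_g U_g` is the finitely
supported function `g ↦ s_g`. -/
def CrossedProduct {G K : Type*} [Group G] [CommRing K] [MulSemiringAction G K]
    (_f : UnitCocycle G K) : Type _ := G →₀ K

namespace CrossedProduct

variable {G K : Type*} [Group G] [CommRing K] [MulSemiringAction G K] {f : UnitCocycle G K}

noncomputable instance instAddCommGroup : AddCommGroup (CrossedProduct f) :=
  inferInstanceAs (AddCommGroup (G →₀ K))

/-- The ring structure: `(s U_g) (t U_h) = s g(t) f(g,h) U_{gh}`; associativity is the 2-cocycle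
condition, and the identity element is `f(1,1)⁻¹ U_1`. -/
noncomputable instance instRing : Ring (CrossedProduct f) where
  __ := instAddCommGroup
  mul := crossedMul f
  one := (Finsupp.single 1 (((f (1, 1))⁻¹ : Kˣ) : K) : G →₀ K)
  left_distrib := crossedMul_add f
  right_distrib := add_crossedMul f
  zero_mul := zero_crossedMul f
  mul_zero := crossedMul_zero f
  mul_assoc := crossedMul_assoc f
  one_mul := one_crossedMul f
  mul_one := crossedMul_one f

/-- Multiplication by scalars of `K` on the left: `t • (s U_g) = (t s) U_g`. -/
noncomputable instance instModule : Module K (CrossedProduct f) :=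
  inferInstanceAs (Module K (G →₀ K))

/-- The element `s U_g` of `K^f * G`. -/
noncomputable def single (f : UnitCocycle G K) (g : G) (s : K) : CrossedProduct f :=
  (Finsupp.single g s : G →₀ K)

theorem single_mul_single (g h : G) (s t : K) :
    single f g s * single f h t = single f (g * h) (s * (g • t) * (f (g, h) : K)) :=
  crossedMul_single f g h s t

theorem induction {P : CrossedProduct f → Prop} (x : CrossedProduct f) (h0 : P 0)
    (hs : ∀ g s, P (single f g s)) (ha : ∀ x y, P x → P y → P (x + y)) : P x :=
  Finsupp.induction_linear (motive := P) x h0 (fun x y => ha x y) hs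

theorem smul_mul (t : K) (x y : CrossedProduct f) : (t • x) * y = t • (x * y) :=
  smul_crossedMul f t x y

theorem single_mul_smul (g : G) (s t : K) (x : CrossedProduct f) :
    single f g s * (t • x) = (g • t) • (single f g s * x) :=
  single_crossedMul_smul f g s t x

end CrossedProduct

section Reduction

variable {G S : Type*} [Group G] [CommRing S] [IsLocalRing S] [MulSemiringAction G S]

/-- The image `f̄` of a 2-cocycle `f` under `Z²(G, Sˣ) → Z²(G, S̄ˣ)`, where `S̄` is the residue field
with the induced action of `G`. -/
noncomputable def UnitCocycle.reduction (f : UnitCocycle G S) :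
    UnitCocycle G (ResidueField S) where
  toFun p := Units.map (residue S).toMonoidHom (f p)
  isCocycle g h j := by
    refine Units.ext ?_
    change residue S (f (g * h, j)) * residue S (f (g, h)) =
      g • residue S (f (h, j)) * residue S (f (g, h * j))
    rw [← ResidueField.residue_smul, ← map_mul, ← map_mul, f.val_isCocycle]

theorem smul_mem_maximalIdeal (g : G) {m : S} (hm : m ∈ maximalIdeal S) :
    g • m ∈ maximalIdeal S := by
  rw [mem_maximalIdeal, mem_nonunits_iff] at hm ⊢
  intro h
  apply hm
  simpa using h.map (MulSemiringAction.toRingHom G S g⁻¹)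

/-- The two-sided ideal `M_S T` of `T = S^f * G`, where `M_S` is the maximal ideal of `S`. -/
noncomputable def CrossedProduct.maximalIdealMul (f : UnitCocycle G S) :
    TwoSidedIdeal (CrossedProduct f) :=
  TwoSidedIdeal.mk' ((maximalIdeal S • ⊤ : Submodule S (CrossedProduct f)) : Set _)
    (Submodule.zero_mem _) (Submodule.add_mem _) (Submodule.neg_mem _)
    (by
      intro x y hy
      induction x using CrossedProduct.induction with
      | h0 => simp
      | ha x x' hx hx' => rw [add_mul]; exact Submodule.add_mem _ hx hx'
      | hs g s =>
        refine Submodule.smul_induction_on hy (fun m hm n _ => ?_) fun n n' hn hn' => ?_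
        · rw [CrossedProduct.single_mul_smul]
          exact Submodule.smul_mem_smul (smul_mem_maximalIdeal g hm) Submodule.mem_top
        · rw [mul_add]; exact Submodule.add_mem _ hn hn')
    (by
      intro x y hx
      refine Submodule.smul_induction_on hx (fun m hm n _ => ?_) fun n n' hn hn' => ?_
      · rw [CrossedProduct.smul_mul]
        exact Submodule.smul_mem_smul hm Submodule.mem_top
      · rw [add_mul]; exact Submodule.add_mem _ hn hn')

end Reduction

/-- A ring is hereditary if all its left ideals and all its right ideals are projective. -/
def IsHereditaryRing (A : Type*) [Ring A] : Prop :=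
  (∀ I : Submodule A A, Module.Projective A I) ∧
    ∀ I : Submodule Aᵐᵒᵖ A, Module.Projective Aᵐᵒᵖ I

/-- The simple components of a (semisimple) ring: its minimal nonzero two-sided ideals. -/
def simpleComponents (A : Type*) [Ring A] : Set (TwoSidedIdeal A) := {I | IsAtom I}

/-- `S/R` is residually separable, where `R = S^G`: the residue field `S̄ = S / M_S` is separable
over `R̄ = R / (M_S ∩ R)`. -/
def ResiduallySeparable (G S : Type*) [Group G] [CommRing S] [IsLocalRing S]
    [MulSemiringAction G S] : Prop :=
  Algebra.IsSeparable
    (FixedPoints.subring S G ⧸ (maximalIdeal S).under (FixedPoints.subring S G))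
    (S ⧸ maximalIdeal S)

/-- `Γ` is maximal among the subgroups of the inertia group (the kernel of the action of `G` on the
residue field) on which the reduced cocycle `f̄` is cohomologically trivial. -/
def IsMaximalTrivial {G S : Type*} [Group G] [CommRing S] [IsLocalRing S]
    [MulSemiringAction G S] (f : UnitCocycle G S) (Γ : Subgroup G) : Prop :=
  Maximal (fun H : Subgroup G => H ≤ (maximalIdeal S).toAddSubgroup.inertia G ∧
    f.reduction.TrivialOn H) Γ

/-! Write K for the residue field, p for its exponential characteristic, I for the inertia group and
ϖ for a uniformizer. The residue of g(ϖ)/ϖ is a crossed homomorphism χ from G to Kˣ, and its kernel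
Q on I, the wild inertia group, is a p-group. Hereditariness enters only through Q:
`exists_injective_to_algebraicClosure` embeds K^f̄ * Q in a field, so that p-power maps are
injective on it. To see this, note that T_Q = S^f * Q is a bimodule summand of T, so its left ideals
are projective. Over the algebraic closure of K the cocycle f̄ splits on Q, which gives a map from
T_Q to a field; elements outside its kernel J are left invertible, and projectivity makes J
principal, J = T_Q z. Determinants of right multiplication are Q-invariant, and a Q-invariant
nonunit of S is divisible by ϖ^|Q|; comparing ϖ = w z with this bound shows that w is invertible, so
J = T_Q ϖ. Separability is used to represent all residues by Q-fixed elements.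

The rest follows from the data collected in `TameDatum`. The quotient I/Q embeds in Kˣ, hence is
cyclic, and conjugation by I fixes each U_q with q in Q because it fixes a p-power of it. So K^f̄ *
I is commutative, and it is also reduced. Every nonzero two-sided ideal of K^f̄ * G meets it, so the
Jacobson radical vanishes. A subgroup Γ of I on which f̄ is trivial meets Q trivially; thus χ embeds
it in Kˣ, Γ is cyclic of order prime to p, its characters are powers of χ, and it is normal.

A splitting on Γ yields orthogonal idempotents e_ψ with sum 1, indexed by the characters of Γ, and
U_g e_ψ = e_{ψ π(g)} U_g. Maximality of Γ makes a Kummer polynomial irreducible, whence an ideal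
containing some y in K^f̄ * I with e_ψ y ≠ 0 contains e_ψ (`idem_mem_of_mul_ne_zero`). The simple
components are therefore the ideals generated by the e_ψ, one for each coset of the image of π. -/

namespace UnitCocycle

variable {G K : Type*} [Group G] [CommRing K] [MulSemiringAction G K]

/-- The restriction of a 2-cocycle to a subgroup. -/
def restrict (f : UnitCocycle G K) (H : Subgroup G) : UnitCocycle H K where
  toFun p := f ((p.1 : G), (p.2 : G))
  isCocycle g h j := f.isCocycle g h j

end UnitCocycle

/-! ### Crossed products: coefficients, units and scalars. -/

namespace CrossedProduct

section Basic

variable {G K : Type*} [Group G] [CommRing K] [MulSemiringAction G K] {f : UnitCocycle G K}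

/-- The coefficient of `U_g`. -/
noncomputable def coeff (g : G) : CrossedProduct f →ₗ[K] K :=
  (Finsupp.lapply g : (G →₀ K) →ₗ[K] K)

theorem coeff_single [DecidableEq G] (g h : G) (s : K) :
    coeff h (single f g s) = if g = h then s else 0 :=
  Finsupp.single_apply

theorem coeff_single_self (g : G) (s : K) : coeff g (single f g s) = s :=
  Finsupp.single_eq_same

theorem coeff_single_of_ne {g h : G} (hgh : h ≠ g) (s : K) : coeff h (single f g s) = 0 :=
  Finsupp.single_eq_of_ne hgh

@[ext]
theorem ext {x y : CrossedProduct f} (h : ∀ g, coeff g x = coeff g y) : x = y :=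
  Finsupp.ext h

theorem single_add (g : G) (s t : K) : single f g (s + t) = single f g s + single f g t :=
  Finsupp.single_add g s t

theorem single_zero (g : G) : single f g 0 = 0 :=
  Finsupp.single_zero g

theorem single_eq_zero {g : G} {s : K} : single f g s = 0 ↔ s = 0 :=
  Finsupp.single_eq_zero

theorem single_injective (g : G) : Function.Injective (single f g) :=
  Finsupp.single_injective g

theorem smul_single (t : K) (g : G) (s : K) : t • single f g s = single f g (t * s) :=
  Finsupp.smul_single t g s

theorem one_def : (1 : CrossedProduct f) = single f 1 (((f (1, 1))⁻¹ : Kˣ) : K) := rfl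

theorem eq_of_single_eq {g h : G} {s t : K} (hs : s ≠ 0) (h1 : single f g s = single f h t) :
    g = h := by
  by_contra hne
  have := congrArg (coeff g) h1
  rw [coeff_single_self, coeff_single_of_ne hne] at this
  exact hs this

theorem sum_single [Fintype G] (x : CrossedProduct f) : ∑ g, single f g (coeff g x) = x := by
  classical
  ext h
  rw [map_sum]
  simp_rw [coeff_single]
  simp

theorem coeff_single_mul (h g : G) (s : K) (x : CrossedProduct f) :
    coeff (h * g) (single f h s * x) = s * (h • coeff g x) * (f (h, g) : K) := by
  classical
  induction x using CrossedProduct.induction with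
  | h0 => simp
  | ha x y hx hy => rw [mul_add, map_add, hx, hy, map_add, smul_add]; ring
  | hs j t =>
    rw [single_mul_single, coeff_single, coeff_single]
    by_cases hj : j = g
    · subst hj; simp
    · simp [hj]

theorem coeff_mul_single (h g : G) (s : K) (x : CrossedProduct f) :
    coeff (g * h) (x * single f h s) = coeff g x * (g • s) * (f (g, h) : K) := by
  classical
  induction x using CrossedProduct.induction with
  | h0 => simp
  | ha x y hx hy => rw [add_mul, map_add, hx, hy, map_add]; ring
  | hs j t =>
    rw [single_mul_single, coeff_single, coeff_single]
    by_cases hj : j = g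
    · subst hj; simp
    · simp [hj]

theorem isUnit_single (g : G) (s : Kˣ) : IsUnit (single f g (s : K)) := by
  have key : ∀ (g : G) (s : Kˣ), ∃ y, single f g (s : K) * y = 1 := fun g s => by
    refine ⟨single f g⁻¹ (g⁻¹ • ((s⁻¹ * (f (g, g⁻¹))⁻¹ * (f (1, 1))⁻¹ : Kˣ) : K)), ?_⟩
    rw [single_mul_single, one_def, mul_inv_cancel, smul_inv_smul]
    congr 1
    rw [← Units.val_mul, ← Units.val_mul]
    congr 1
    rw [mul_comm s, mul_assoc, mul_assoc, mul_assoc]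
    simp [mul_comm, mul_left_comm]
  have key' : ∀ (g : G) (s : Kˣ), ∃ y, y * single f g (s : K) = 1 := fun g s => by
    refine ⟨single f g⁻¹ ((((g⁻¹ • s)⁻¹ * (f (g⁻¹, g))⁻¹ * (f (1, 1))⁻¹ : Kˣ) : K)), ?_⟩
    rw [single_mul_single, one_def, inv_mul_cancel]
    congr 1
    rw [← Units.coe_smul, ← Units.val_mul, ← Units.val_mul]
    congr 1
    simp [mul_assoc, mul_comm]
  obtain ⟨y, hy⟩ := key g s
  obtain ⟨z, hz⟩ := key' g s
  exact ⟨⟨_, y, hy, by rwa [left_inv_eq_right_inv hz hy] at hz⟩, rfl⟩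

instance [Nontrivial K] : Nontrivial (CrossedProduct f) :=
  ⟨⟨1, 0, fun h => (((f (1, 1))⁻¹ : Kˣ)).ne_zero (single_eq_zero.1 h)⟩⟩

instance [Finite G] : Module.Finite K (CrossedProduct f) :=
  inferInstanceAs (Module.Finite K (G →₀ K))

/-- Coefficients in `K`, embedded as `K U_1`, up to the normalization of the unit. -/
noncomputable def scalar (f : UnitCocycle G K) : K →+* CrossedProduct f where
  toFun t := t • (1 : CrossedProduct f)
  map_one' := one_smul _ _
  map_zero' := zero_smul _ _
  map_add' a b := add_smul a b _
  map_mul' a b := by rw [smul_mul, one_mul, smul_smul]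

theorem scalar_mul (t : K) (x : CrossedProduct f) : scalar f t * x = t • x := by
  change (t • (1 : CrossedProduct f)) * x = _
  rw [smul_mul, one_mul]

theorem single_mul_scalar (g : G) (s t : K) :
    single f g s * scalar f t = single f g (s * g • t) := by
  change _ * (t • (1 : CrossedProduct f)) = _
  rw [single_mul_smul, mul_one, smul_single, mul_comm]

theorem scalar_mul_single (g : G) (s t : K) :
    scalar f t * single f g s = single f g (t * s) := by
  rw [scalar_mul, smul_single]

theorem coeff_mul_scalar (g : G) (t : K) (x : CrossedProduct f) :
    coeff g (x * scalar f t) = coeff g x * g • t := by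
  classical
  induction x using CrossedProduct.induction with
  | h0 => simp
  | ha x y hx hy => rw [add_mul, map_add, hx, hy, map_add, add_mul]
  | hs j s =>
    rw [single_mul_scalar, coeff_single, coeff_single]
    by_cases hj : j = g
    · subst hj; simp
    · simp [hj]

theorem coeff_scalar_mul (g : G) (t : K) (x : CrossedProduct f) :
    coeff g (scalar f t * x) = t * coeff g x := by
  rw [scalar_mul, map_smul, smul_eq_mul]

theorem scalar_eq_single (t : K) :
    scalar f t = single f 1 (t * ((f (1, 1))⁻¹ : Kˣ)) := by
  change t • single f 1 _ = _
  rw [smul_single]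

theorem scalar_injective : Function.Injective (scalar f) := fun s t h => by
  rw [scalar_eq_single, scalar_eq_single] at h
  exact (Units.mul_left_inj _).1 (single_injective _ h)

/-- Additive maps that agree with a multiplicative rule on the `s U_g` are ring homomorphisms. -/
noncomputable def liftHom {A : Type*} [Ring A] (φ : CrossedProduct f →+ A) (h1 : φ 1 = 1)
    (hmul : ∀ g h s t, φ (single f g s * single f h t) = φ (single f g s) * φ (single f h t)) :
    CrossedProduct f →+* A where
  __ := φ
  map_one' := h1
  map_mul' x y := by
    change φ (x * y) = φ x * φ y
    induction x using CrossedProduct.induction with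
    | h0 => simp
    | ha x x' hx hx' => rw [add_mul, map_add, hx, hx', map_add, add_mul]
    | hs g s =>
      induction y using CrossedProduct.induction with
      | h0 => simp
      | ha x x' hx hx' => rw [mul_add, map_add, hx, hx', map_add, mul_add]
      | hs h t => exact hmul g h s t

end Basic

/-! ### The crossed product of a subgroup as a bimodule summand. -/

section Restrict

variable {G K : Type*} [Group G] [CommRing K] [MulSemiringAction G K] (f : UnitCocycle G K)
  (H : Subgroup G)

/-- The inclusion of the crossed product of a subgroup. -/
noncomputable def ofSubgroup : CrossedProduct (f.restrict H) →+* CrossedProduct f :=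
  liftHom (Finsupp.mapDomain.addMonoidHom ((↑) : H → G) : (H →₀ K) →+ (G →₀ K))
    (Finsupp.mapDomain_single)
    (fun g h s t => by
      rw [single_mul_single]
      refine Finsupp.mapDomain_single.trans ?_
      refine (single_mul_single (f := f) (g : G) h s t).symm.trans ?_
      congr 1
      · exact Finsupp.mapDomain_single.symm
      · exact Finsupp.mapDomain_single.symm)

theorem ofSubgroup_single (g : H) (s : K) :
    ofSubgroup f H (single _ g s) = single f (g : G) s :=
  Finsupp.mapDomain_single

theorem coeff_ofSubgroup (g : H) (x : CrossedProduct (f.restrict H)) :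
    coeff (g : G) (ofSubgroup f H x) = coeff g x :=
  Finsupp.mapDomain_apply Subtype.val_injective x g

theorem coeff_ofSubgroup_of_notMem {g : G} (hg : g ∉ H) (x : CrossedProduct (f.restrict H)) :
    coeff g (ofSubgroup f H x) = 0 :=
  Finsupp.mapDomain_of_notMem_range x g (by simpa using hg)

theorem ofSubgroup_injective : Function.Injective (ofSubgroup f H) :=
  Finsupp.mapDomain_injective Subtype.val_injective

/-- The projection onto the crossed product of a subgroup. -/
noncomputable def toSubgroup : CrossedProduct f →+ CrossedProduct (f.restrict H) :=
  (Finsupp.comapDomain.addMonoidHom Subtype.val_injective : (G →₀ K) →+ (H →₀ K))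

variable {f H}

theorem coeff_toSubgroup (g : H) (x : CrossedProduct f) :
    coeff g (toSubgroup f H x) = coeff (g : G) x := rfl

theorem toSubgroup_ofSubgroup (x : CrossedProduct (f.restrict H)) :
    toSubgroup f H (ofSubgroup f H x) = x := by
  ext g
  rw [coeff_toSubgroup, coeff_ofSubgroup]

/-- Multiplication by U_h with h ∈ H preserves both H and its complement in G. With the right-hand
version below, this is the bimodule splitting needed to descend projectivity. -/
theorem toSubgroup_ofSubgroup_mul (x : CrossedProduct (f.restrict H)) (y : CrossedProduct f) :
    toSubgroup f H (ofSubgroup f H x * y) = x * toSubgroup f H y := by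
  induction x using CrossedProduct.induction with
  | h0 => simp
  | ha x x' hx hx' => rw [map_add, add_mul, map_add, hx, hx', add_mul]
  | hs g s =>
    ext h
    have h1 := coeff_single_mul (f := f) g ((g : G)⁻¹ * h) s y
    have h2 := coeff_single_mul (f := f.restrict H) g (g⁻¹ * h) s (toSubgroup f H y)
    rw [mul_inv_cancel_left] at h1 h2
    rw [coeff_toSubgroup, ofSubgroup_single, h1, h2, coeff_toSubgroup]
    rfl

theorem toSubgroup_mul_ofSubgroup (x : CrossedProduct f) (y : CrossedProduct (f.restrict H)) :
    toSubgroup f H (x * ofSubgroup f H y) = toSubgroup f H x * y := by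
  induction y using CrossedProduct.induction with
  | h0 => simp
  | ha y y' hy hy' => rw [map_add, mul_add, map_add, hy, hy', mul_add]
  | hs g s =>
    ext h
    have h1 := coeff_mul_single (f := f) g (h * (g : G)⁻¹) s x
    have h2 := coeff_mul_single (f := f.restrict H) g (h * g⁻¹) s (toSubgroup f H x)
    rw [inv_mul_cancel_right] at h1 h2
    rw [coeff_toSubgroup, ofSubgroup_single, h1, h2, coeff_toSubgroup]
    rfl

/-- Elements supported on `H` come from the crossed product of `H`. -/
theorem ofSubgroup_toSubgroup {x : CrossedProduct f} (hx : ∀ g ∉ H, coeff g x = 0) :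
    ofSubgroup f H (toSubgroup f H x) = x := by
  ext g
  by_cases hg : g ∈ H
  · exact (coeff_ofSubgroup f H ⟨g, hg⟩ _).trans rfl
  · rw [hx g hg, coeff_ofSubgroup_of_notMem f H hg]

end Restrict

/-! ### Reduction of coefficients. -/

section Reduction

variable {G S : Type*} [Group G] [CommRing S] [IsLocalRing S] [MulSemiringAction G S]
  (f : UnitCocycle G S)

theorem _root_.UnitCocycle.val_reduction (g h : G) :
    (f.reduction (g, h) : ResidueField S) = residue S (f (g, h)) := rfl

/-- Reduction of coefficients. -/
noncomputable def reduce : CrossedProduct f →+* CrossedProduct f.reduction :=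
  liftHom (Finsupp.mapRange.addMonoidHom (residue S).toAddMonoidHom :
      (G →₀ S) →+ (G →₀ ResidueField S))
    (by
      refine (Finsupp.mapRange_single (hf := map_zero (residue S))).trans ?_
      rw [one_def]
      exact congrArg (single f.reduction 1)
        (congrArg Units.val (map_inv (Units.map (residue S).toMonoidHom) (f (1, 1)))))
    (fun g h s t => by
      rw [single_mul_single]
      refine (Finsupp.mapRange_single (hf := map_zero (residue S))).trans ?_
      refine Eq.trans ?_ (congrArg₂ (· * ·)
        (Finsupp.mapRange_single (hf := map_zero (residue S))).symm
        (Finsupp.mapRange_single (hf := map_zero (residue S))).symm)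
      refine Eq.trans ?_ (single_mul_single (f := f.reduction) g h (residue S s)
        (residue S t)).symm
      rw [f.val_reduction, ← ResidueField.residue_smul, ← map_mul, ← map_mul]
      rfl)

theorem coeff_reduce (g : G) (x : CrossedProduct f) :
    coeff g (reduce f x) = residue S (coeff g x) := rfl

theorem reduce_single (g : G) (s : S) :
    reduce f (single f g s) = single f.reduction g (residue S s) :=
  Finsupp.mapRange_single (hf := map_zero (residue S))

theorem reduce_surjective : Function.Surjective (reduce f) :=
  Finsupp.mapRange_surjective _ (map_zero _) residue_surjective

end Reduction

end CrossedProduct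

/-! ### Descent of projectivity, and the quotient by `maximalIdealMul`. -/

/-- Projectivity of left ideals descends to a subring that is a direct summand as a bimodule. -/
theorem projective_of_split {T B : Type*} [Ring T] [Ring B] (ι : B →+* T) (E : T →+ B)
    (hmul : ∀ b x, E (ι b * x) = b * E x) (hmul' : ∀ x b, E (x * ι b) = E x * b)
    (hι : ∀ b, E (ι b) = b)
    (hT : ∀ I : Submodule T T, Module.Projective T I) (J : Submodule B B) :
    Module.Projective B J := by
  -- A section of the free cover of I = T·ι(J), restricted to J and pushed through E coordinatewise,
  -- is a section of the free cover of J.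
  let I : Submodule T T := Submodule.span T (ι '' (J : Set B))
  have hmem : ∀ j : J, ι (j : B) ∈ I := fun j => Submodule.subset_span ⟨j, j.2, rfl⟩
  let c : (J →₀ T) →ₗ[T] I := Finsupp.linearCombination T fun j => (⟨ι j, hmem j⟩ : I)
  have hc : ∀ v, ((c v : I) : T) = v.sum fun j t => t * ι j := fun v => by
    simp only [c, Finsupp.linearCombination_apply, Finsupp.sum, AddSubmonoidClass.coe_finsetSum]
    rfl
  have hsurj : Function.Surjective c := by
    rintro ⟨x, hx⟩
    induction hx using Submodule.span_induction with
    | mem x h =>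
      obtain ⟨j, hj, rfl⟩ := h
      refine ⟨Finsupp.single ⟨j, hj⟩ 1, ?_⟩
      simp [c]
    | zero => exact ⟨0, by rw [map_zero]; rfl⟩
    | add x y hx hy h1 h2 =>
      obtain ⟨a, ha⟩ := h1
      obtain ⟨b, hb⟩ := h2
      exact ⟨a + b, by rw [map_add, ha, hb]; rfl⟩
    | smul t x hx h1 =>
      obtain ⟨a, ha⟩ := h1
      exact ⟨t • a, by rw [map_smul, ha]; rfl⟩
  have := hT I
  obtain ⟨s, hs⟩ := Module.projective_lifting_property c LinearMap.id hsurj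
  rw [Module.projective_def]
  refine ⟨⟨⟨fun x => Finsupp.mapRange E (map_zero E) (s ⟨ι x, hmem x⟩), fun x y => ?_⟩,
    fun b x => ?_⟩, fun x => ?_⟩
  · have : (⟨ι (x + y : J), hmem (x + y)⟩ : I) = ⟨ι x, hmem x⟩ + ⟨ι y, hmem y⟩ :=
      Subtype.ext (by simp)
    rw [this, map_add, Finsupp.mapRange_add (map_add E)]
  · have : (⟨ι (b • x : J), hmem (b • x)⟩ : I) = ι b • ⟨ι x, hmem x⟩ :=
      Subtype.ext (by simp)
    change Finsupp.mapRange E (map_zero E) (s ⟨ι (b • x : J), _⟩) =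
      b • Finsupp.mapRange E (map_zero E) _
    rw [this, map_smul]
    ext j
    simp only [Finsupp.mapRange_apply, Finsupp.smul_apply, smul_eq_mul, hmul]
  · have h1 : ((c (s ⟨ι x, hmem x⟩) : I) : T) = ι x :=
      congrArg Subtype.val (DFunLike.congr_fun hs ⟨ι x, hmem x⟩)
    rw [hc] at h1
    refine Subtype.ext ?_
    have h2 := congrArg E h1
    rw [Finsupp.sum, map_sum, hι] at h2
    change ((Finsupp.linearCombination B id (Finsupp.mapRange E (map_zero E) _) : J) : B) = x
    rw [Finsupp.linearCombination_apply, Finsupp.sum_mapRange_index (by simp), Finsupp.sum,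
      AddSubmonoidClass.coe_finsetSum]
    refine Eq.trans ?_ h2
    exact Finset.sum_congr rfl fun j _ => (hmul' _ _).symm

namespace CrossedProduct

/-- The crossed product of a subgroup inherits projectivity of left ideals. -/
theorem projective_restrict {G K : Type*} [Group G] [CommRing K] [MulSemiringAction G K]
    (f : UnitCocycle G K) (H : Subgroup G)
    (hT : ∀ I : Submodule (CrossedProduct f) (CrossedProduct f),
      Module.Projective (CrossedProduct f) I)
    (J : Submodule (CrossedProduct (f.restrict H)) (CrossedProduct (f.restrict H))) :
    Module.Projective (CrossedProduct (f.restrict H)) J :=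
  projective_of_split (ofSubgroup f H) (toSubgroup f H) toSubgroup_ofSubgroup_mul
    toSubgroup_mul_ofSubgroup toSubgroup_ofSubgroup hT J

section

variable {G S : Type*} [Group G] [Finite G] [CommRing S] [IsLocalRing S] [MulSemiringAction G S]
  (f : UnitCocycle G S)

/-- Finiteness of G lets an element with all coefficients in the maximal ideal be written as a
finite sum of terms m U_g. -/
theorem mem_maximalIdealMul_iff (x : CrossedProduct f) :
    x ∈ maximalIdealMul f ↔ reduce f x = 0 := by
  have h0 : x ∈ maximalIdealMul f ↔
      x ∈ (maximalIdeal S • ⊤ : Submodule S (CrossedProduct f)) := by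
    rw [maximalIdealMul, TwoSidedIdeal.mem_mk']
    rfl
  rw [h0]
  constructor
  · intro hx
    refine Submodule.smul_induction_on hx (fun m hm n _ => ?_) fun a b ha hb => ?_
    · ext g
      rw [coeff_reduce, map_smul, smul_eq_mul, map_mul, (residue_eq_zero_iff m).2 hm, zero_mul,
        map_zero]
    · rw [map_add, ha, hb, add_zero]
  · intro hx
    cases nonempty_fintype G
    rw [← sum_single x]
    refine Submodule.sum_mem _ fun g _ => ?_
    have hg : coeff g x ∈ maximalIdeal S := by
      rw [← residue_eq_zero_iff, ← coeff_reduce, hx, map_zero]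
    have := Submodule.smul_mem_smul hg (Submodule.mem_top (x := single f g (1 : S)))
    rwa [smul_single, mul_one] at this

theorem exists_quotient_equiv :
    ∃ e : (maximalIdealMul f).ringCon.Quotient ≃+* CrossedProduct f.reduction,
      ∀ (g : G) (s : S), e (single f g s : CrossedProduct f) =
        single f.reduction g (residue S s) := by
  have hker : ∀ x y, (maximalIdealMul f).ringCon x y ↔ reduce f x = reduce f y := fun x y => by
    rw [TwoSidedIdeal.rel_iff, mem_maximalIdealMul_iff, map_sub, sub_eq_zero]
  let φ : (maximalIdealMul f).ringCon.Quotient →+* CrossedProduct f.reduction :=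
    (maximalIdealMul f).ringCon.lift (reduce f) fun x y h => (hker x y).1 h
  have hφ : ∀ x : CrossedProduct f, φ (x : CrossedProduct f) = reduce f x := fun x => rfl
  refine ⟨RingEquiv.ofBijective φ ⟨?_, ?_⟩, fun g s => (hφ _).trans (reduce_single f g s)⟩
  · intro a b
    induction a using Quotient.inductionOn'
    induction b using Quotient.inductionOn'
    intro h
    exact Quotient.sound' ((hker _ _).2 h)
  · intro y
    obtain ⟨x, rfl⟩ := reduce_surjective f y
    exact ⟨(x : CrossedProduct f), hφ x⟩

end

end CrossedProduct

/-! ### Fixed elements and wild automorphisms of a discrete valuation ring. -/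

/-- If all residues are represented by fixed elements and `r` is fixed of valuation `j > 0`, then
every element is approximated by polynomials of degree `< j` in the uniformizer with fixed
coefficients. -/
theorem exists_fixed_approx {S H : Type*} [CommRing S] [Group H]
    [MulSemiringAction H S] {ϖ : S}
    (hres : ∀ s : S, ∃ r : S, (∀ h : H, h • r = r) ∧ ϖ ∣ s - r)
    {j : ℕ} (hj : 0 < j) (u : Sˣ) (hr : ∀ h : H, h • ((u : S) * ϖ ^ j) = u * ϖ ^ j) (s : S)
    (N : ℕ) : ∃ a : ℕ → S, (∀ i, ∀ h : H, h • a i = a i) ∧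
      ϖ ^ N ∣ s - ∑ i ∈ Finset.range j, a i * ϖ ^ i := by
  induction N with
  | zero => exact ⟨0, fun i h => smul_zero h, by simp⟩
  | succ N ih =>
    obtain ⟨a, ha, t, ht⟩ := ih
    -- Since N = j (N / j) + N % j, the error t ϖ^N is cancelled modulo ϖ^(N+1) by adding ρ (u
    -- ϖ^j)^(N / j) to the coefficient of ϖ^(N % j). The inverse power of u compensates for the unit
    -- in this fixed element.
    obtain ⟨ρ, hρ, w, hw⟩ := hres (t * ((u⁻¹ : Sˣ) : S) ^ (N / j))
    refine ⟨Function.update a (N % j) (a (N % j) + ρ * ((u : S) * ϖ ^ j) ^ (N / j)), ?_, ?_⟩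
    · intro i h
      by_cases hi : i = N % j
      · subst hi
        rw [Function.update_self, smul_add, smul_mul', smul_pow', hr, ha, hρ]
      · rw [Function.update_of_ne hi, ha]
    · have hmem : N % j ∈ Finset.range j := Finset.mem_range.2 (Nat.mod_lt _ hj)
      have hsum : ∑ i ∈ Finset.range j, Function.update a (N % j)
          (a (N % j) + ρ * ((u : S) * ϖ ^ j) ^ (N / j)) i * ϖ ^ i =
          ∑ i ∈ Finset.range j, a i * ϖ ^ i + ρ * u ^ (N / j) * ϖ ^ N := by
        rw [← Finset.add_sum_erase _ _ hmem, ← Finset.add_sum_erase _ (fun i => a i * ϖ ^ i) hmem,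
          Function.update_self]
        have : ∑ i ∈ (Finset.range j).erase (N % j), Function.update a (N % j)
            (a (N % j) + ρ * ((u : S) * ϖ ^ j) ^ (N / j)) i * ϖ ^ i =
            ∑ i ∈ (Finset.range j).erase (N % j), a i * ϖ ^ i :=
          Finset.sum_congr rfl fun i hi => by
            rw [Function.update_of_ne (Finset.ne_of_mem_erase hi)]
        rw [this]
        have hN : ϖ ^ N = (ϖ ^ j) ^ (N / j) * ϖ ^ (N % j) := by
          rw [← pow_mul, ← pow_add, Nat.div_add_mod]
        rw [hN, mul_pow]
        ring
      refine ⟨w * u ^ (N / j), ?_⟩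
      rw [hsum, ← sub_sub, ht]
      have hu : t = t * ((u⁻¹ : Sˣ) : S) ^ (N / j) * u ^ (N / j) := by
        rw [mul_assoc, ← mul_pow, Units.inv_mul, one_pow, mul_one]
      rw [hu, pow_succ]
      linear_combination ϖ ^ N * u ^ (N / j) * hw

section DVR

variable {S : Type*} [CommRing S] [IsDomain S] [IsDiscreteValuationRing S]

theorem eq_zero_of_forall_pow_dvd {ϖ x : S} (hϖ : Irreducible ϖ) (h : ∀ n, ϖ ^ n ∣ x) : x = 0 := by
  by_contra hx
  obtain ⟨n, hn⟩ := FiniteMultiplicity.of_prime_left hϖ.prime hx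
  exact hn (h _)

theorem residue_eq_zero_iff_dvd {ϖ : S} (hϖ : Irreducible ϖ) (x : S) :
    residue S x = 0 ↔ ϖ ∣ x := by
  rw [residue_eq_zero_iff, hϖ.maximalIdeal_eq, Ideal.mem_span_singleton]

theorem residue_eq_iff_dvd {ϖ : S} (hϖ : Irreducible ϖ) (x y : S) :
    residue S x = residue S y ↔ ϖ ∣ x - y := by
  rw [← residue_eq_zero_iff_dvd hϖ, map_sub, sub_eq_zero]

section Fixed

variable {H : Type*} [Group H] [MulSemiringAction H S] [FaithfulSMul H S]

theorem eq_one_of_forall_pow_dvd {ϖ : S} (hϖ : Irreducible ϖ) (h : H)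
    (hh : ∀ s : S, ∀ n, ϖ ^ n ∣ h • s - s) : h = 1 :=
  FaithfulSMul.eq_of_smul_eq_smul (α := S) fun s => by
    rw [one_smul]
    exact sub_eq_zero.1 (eq_zero_of_forall_pow_dvd hϖ (hh s))

/-- This is total ramification. If r had valuation j < |H|, then to every ϖ-adic precision ϖ would
be a root of a monic polynomial of degree j with fixed coefficients, and so would its |H| distinct
conjugates. -/
theorem uniformizer_pow_card_dvd_of_fixed [Finite H] {ϖ : S} (hϖ : Irreducible ϖ)
    (hres : ∀ s : S, ∃ r : S, (∀ h : H, h • r = r) ∧ ϖ ∣ s - r)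
    {r : S} (hr : ∀ h : H, h • r = r) (hru : ¬ IsUnit r) : ϖ ^ Nat.card H ∣ r := by
  by_cases hr0 : r = 0
  · rw [hr0]; exact dvd_zero _
  obtain ⟨j, u, rfl⟩ := IsDiscreteValuationRing.eq_unit_mul_pow_irreducible hr0 hϖ
  rcases le_or_gt (Nat.card H) j with hle | hlt
  · exact (pow_dvd_pow ϖ hle).mul_left _
  exfalso
  have hj : 0 < j := by
    rcases Nat.eq_zero_or_pos j with rfl | h
    · simp at hru
    · exact h
  have happ := exists_fixed_approx hres hj u hr
  -- An element fixing ϖ fixes the polynomial approximations of any s, so it moves s by multiples of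
  -- every ϖ^N and is trivial.
  have hinj : Function.Injective fun h : H => h • ϖ := fun h h' heq => by
    have hfix : (h'⁻¹ * h) • ϖ = ϖ := by
      rw [mul_smul]
      change h • ϖ = h' • ϖ at heq
      rw [heq, inv_smul_smul]
    have : h'⁻¹ * h = 1 := eq_one_of_forall_pow_dvd hϖ _ fun s n => by
      obtain ⟨a, ha, t, ht⟩ := happ s n
      have h1 := congrArg ((h'⁻¹ * h) • ·) ht
      simp only [smul_sub, Finset.smul_sum, smul_mul', smul_pow', ha, hfix] at h1
      exact ⟨(h'⁻¹ * h) • t - t, by linear_combination h1 - ht⟩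
    rwa [inv_mul_eq_one, eq_comm] at this
  let e := (Finite.equivFin H).symm
  let v : Fin (Nat.card H) → S := fun i => e i • ϖ
  have hdet : (Matrix.vandermonde v).det ≠ 0 :=
    Matrix.det_vandermonde_ne_zero_iff.2 (hinj.comp e.injective)
  refine hdet (eq_zero_of_forall_pow_dvd hϖ fun N => ?_)
  obtain ⟨a, ha, t, ht⟩ := happ (ϖ ^ j) N
  -- The coefficients of X^j - ∑ a_i X^i. Its value at ϖ, and hence at each conjugate of ϖ, is
  -- divisible by ϖ^N. Applying the adjugate of the Vandermonde matrix and reading entry j, where c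
  -- is 1, shows that ϖ^N divides the determinant.
  let c : Fin (Nat.card H) → S := fun i => if (i : ℕ) = j then 1 else if (i : ℕ) < j then -a i else 0
  have hc : ∀ y : S, ∑ i : Fin (Nat.card H), y ^ (i : ℕ) * c i =
      y ^ j - ∑ i ∈ Finset.range j, a i * y ^ i := by
    intro y
    rw [Fin.sum_univ_eq_sum_range (fun i => y ^ i * if i = j then 1 else if i < j then -a i else 0)]
    rw [← Finset.sum_subset (Finset.range_subset_range.2 hlt), Finset.sum_range_succ]
    · rw [if_pos rfl, mul_one, add_comm, sub_eq_add_neg, ← Finset.sum_neg_distrib]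
      congr 1
      refine Finset.sum_congr rfl fun i hi => ?_
      have hi' := Finset.mem_range.1 hi
      rw [if_neg hi'.ne, if_pos hi']
      ring
    · intro i _ hi
      rw [Finset.mem_range, not_lt] at hi
      rw [if_neg (by omega), if_neg (by omega), mul_zero]
  have hAc : ∀ i, ϖ ^ N ∣ (Matrix.vandermonde v).mulVec c i := fun i => by
    have h1 : (Matrix.vandermonde v).mulVec c i =
        e i • (ϖ ^ j - ∑ i ∈ Finset.range j, a i * ϖ ^ i) := by
      simp only [smul_sub, Finset.smul_sum, smul_mul', smul_pow', ha]
      exact hc _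
    have h2 : ϖ ∣ e i • ϖ := by
      have : ¬ IsUnit (e i • ϖ) := fun h => hϖ.not_isUnit <| by
        simpa using h.map (MulSemiringAction.toRingHom H S (e i)⁻¹)
      rwa [← residue_eq_zero_iff_dvd hϖ, residue_eq_zero_iff, mem_maximalIdeal, mem_nonunits_iff]
    rw [h1, ht, smul_mul', smul_pow']
    exact (pow_dvd_pow_of_dvd h2 N).mul_right _
  have hfin : (Matrix.vandermonde v).det • c =
      (Matrix.vandermonde v).adjugate.mulVec ((Matrix.vandermonde v).mulVec c) := by
    rw [Matrix.mulVec_mulVec, Matrix.adjugate_mul, Matrix.smul_mulVec, Matrix.one_mulVec]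
  have := congrFun hfin ⟨j, hlt⟩
  simp only [Pi.smul_apply, smul_eq_mul, c, if_true, mul_one] at this
  rw [this, Matrix.mulVec_eq_sum, Finset.sum_apply]
  exact Finset.dvd_sum fun i _ => (hAc i).mul_left _

/-- An automorphism of finite order acting trivially on the associated graded ring is trivial if
its order is invertible in the residue field. -/
theorem eq_one_of_wild {ϖ : S} (hϖ : Irreducible ϖ) {g : H} (hg : ∀ s : S, ϖ ∣ g • s - s)
    (hgϖ : ϖ ^ 2 ∣ g • ϖ - ϖ) {n : ℕ} (hn : (n : ResidueField S) ≠ 0) (hgn : g ^ n = 1) :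
    g = 1 := by
  have hnu : IsUnit (n : S) := by
    rw [← map_natCast (residue S), Ne, residue_eq_zero_iff, mem_maximalIdeal, mem_nonunits_iff,
      not_not] at hn
    exact hn
  obtain ⟨w, hw⟩ := hgϖ
  have hϖ' : g • ϖ = ϖ * (1 + ϖ * w) := by linear_combination hw
  have step : ∀ N, ∀ x : S, ϖ ^ N ∣ x → ϖ ^ (N + 1) ∣ g • x - x := by
    rintro N x ⟨t, rfl⟩
    obtain ⟨y, hy⟩ := hg t
    obtain ⟨z, hz⟩ : ϖ ∣ (1 + ϖ * w) ^ N - 1 := by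
      have := sub_dvd_pow_sub_pow (1 + ϖ * w) 1 N
      rw [one_pow, add_sub_cancel_left] at this
      exact (dvd_mul_right _ _).trans this
    refine ⟨z * g • t + y, ?_⟩
    rw [smul_mul', smul_pow', hϖ', mul_pow, pow_succ]
    linear_combination ϖ ^ N * g • t * hz + ϖ ^ N * hy
  have main : ∀ N, ∀ s : S, ϖ ^ N ∣ g • s - s := by
    intro N
    induction N with
    | zero => simp
    | succ N ih =>
      intro s
      -- To first order g^m - 1 is m (g - 1); at m = n the left side vanishes and n is invertible,
      -- which improves the exponent N by one.
      have key : ∀ m : ℕ, ϖ ^ (N + 1) ∣ g ^ m • s - s - m * (g • s - s) := by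
        intro m
        induction m with
        | zero => simp
        | succ m ihm =>
          have h1 := (step _ _ ihm)
          have h2 := (step _ _ (ih s)).mul_left (m : S)
          rw [pow_succ' g, mul_smul]
          have h4 : g • (g ^ m • s - s - m * (g • s - s)) =
              g • g ^ m • s - g • s - m * (g • g • s - g • s) := by
            rw [smul_sub, smul_sub, smul_mul', smul_sub]
            congr 3
            exact map_natCast (MulSemiringAction.toRingHom H S g) m
          convert dvd_add (dvd_add ((pow_dvd_pow ϖ N.succ.le_succ).trans h1) ihm) h2 using 1
          rw [h4, smul_sub]
          push_cast
          ring
      have := key n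
      rw [hgn, one_smul, sub_self, zero_sub, dvd_neg] at this
      exact hnu.dvd_mul_left.1 this
  exact eq_one_of_forall_pow_dvd hϖ g fun s n => main n s

end Fixed

end DVR

/-! ### Group determinants of p-groups in characteristic p. -/

/-- A matrix `c (h⁻¹ j)` of a `p`-group in characteristic `p` is nonsingular if `∑ c ≠ 0`. -/
theorem det_groupMatrix_ne_zero {H L : Type*} [Group H] [Fintype H] [DecidableEq H] [Field L]
    (p a : ℕ) [ExpChar L p] (hH : Nat.card H = p ^ a) (c : H → L) (hc : ∑ h, c h ≠ 0) :
    (Matrix.of fun h j : H => c (h⁻¹ * j)).det ≠ 0 := by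
  intro hdet
  obtain ⟨v, hv0, hv⟩ := Matrix.exists_mulVec_eq_zero_iff.2 hdet
  have hv' : ∀ h, ∑ j, c j * v (h * j) = 0 := fun h => by
    refine Eq.trans ?_ (congrFun hv h)
    refine (Fintype.sum_equiv (Equiv.mulLeft h) _ _ fun j => ?_)
    simp
  -- It suffices to find a nonzero constant vector in the kernel. It will be a fixed vector of H
  -- acting on the translates of v.
  suffices ∃ w : L, w ≠ 0 ∧ ∑ j, c j * w = 0 by
    obtain ⟨w, hw, h⟩ := this
    rw [← Finset.sum_mul] at h
    exact (mul_ne_zero hc hw) h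
  rcases ‹ExpChar L p› with _ | hp
  · have : Subsingleton H := (Nat.card_eq_one_iff_unique.1 (by rw [hH, one_pow])).1
    obtain ⟨h, hh⟩ := Function.ne_iff.1 hv0
    refine ⟨v h, hh, ?_⟩
    rw [← hv' h]
    exact Finset.sum_congr rfl fun j _ => by rw [Subsingleton.elim (h * j) h]
  · have := Fact.mk hp
    -- The additive group generated by the translates of v, not their L-span: it is finitely
    -- generated of exponent p, hence finite, so the fixed-point theorem for p-groups applies.
    let A : AddSubgroup (H → L) := AddSubgroup.closure (Set.range fun g : H => fun j => v (g * j))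
    let _ : MulAction H A :=
      { smul := fun g x => ⟨fun j => (x : H → L) (g⁻¹ * j), by
          obtain ⟨x, hx⟩ := x
          induction hx using AddSubgroup.closure_induction with
          | mem x h =>
            obtain ⟨k, rfl⟩ := h
            exact AddSubgroup.subset_closure ⟨k * g⁻¹, by simp [mul_assoc]⟩
          | zero => exact A.zero_mem
          | add x y hx hy h1 h2 => exact A.add_mem h1 h2
          | neg x hx h1 => exact A.neg_mem h1⟩
        one_smul := fun x => Subtype.ext (funext fun j => by
          change (x : H → L) (1⁻¹ * j) = _
          simp)
        mul_smul := fun g h x => Subtype.ext (funext fun j => by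
          change (x : H → L) ((g * h)⁻¹ * j) = (x : H → L) (h⁻¹ * (g⁻¹ * j))
          rw [mul_inv_rev, mul_assoc]) }
    have hsmul : ∀ (g : H) (x : A) (j : H), ((g • x : A) : H → L) j = (x : H → L) (g⁻¹ * j) :=
      fun _ _ _ => rfl
    have hker : ∀ x : A, ∀ h, ∑ j, c j * (x : H → L) (h * j) = 0 := by
      rintro ⟨x, hx⟩
      induction hx using AddSubgroup.closure_induction with
      | mem x h =>
        obtain ⟨k, rfl⟩ := h
        intro h
        simpa [mul_assoc] using hv' (k * h)
      | zero => simp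
      | add x y hx hy h1 h2 =>
        intro h
        have := congrArg₂ (· + ·) (h1 h) (h2 h)
        simpa [mul_add, Finset.sum_add_distrib] using this
      | neg x hx h1 =>
        intro h
        simpa using h1 h
    have hexp : ∀ x : A, p • x = 0 := fun x => Subtype.ext (funext fun j => by
      change p • (x : H → L) j = 0
      rw [nsmul_eq_mul, CharP.cast_eq_zero, zero_mul])
    have : AddGroup.FG A := by
      rw [AddGroup.fg_iff_addSubgroup_fg]
      exact AddSubgroup.fg_iff _ |>.2 ⟨_, rfl, Set.finite_range _⟩
    have : Finite A := AddCommGroup.finite_of_fg_isAddTorsion A fun x =>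
      isOfFinAddOrder_iff_nsmul_eq_zero.2 ⟨p, hp.pos, hexp x⟩
    have hvA : v ∈ A := AddSubgroup.subset_closure ⟨1, by simp⟩
    have : Nontrivial A := ⟨⟨⟨v, hvA⟩, 0, fun h => hv0 (congrArg Subtype.val h)⟩⟩
    have hdvd : p ∣ Nat.card A := by
      have hx : addOrderOf (⟨v, hvA⟩ : A) = p :=
        addOrderOf_eq_prime (hexp _) fun h => hv0 (congrArg Subtype.val h)
      rw [← hx]
      exact addOrderOf_dvd_natCard _
    have h0 : (0 : A) ∈ MulAction.fixedPoints H A := fun g => Subtype.ext rfl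
    obtain ⟨w, hw, hw0⟩ := (IsPGroup.of_card hH).exists_fixed_point_of_prime_dvd_card_of_fixed_point
      A hdvd h0
    have hconst : ∀ j, (w : H → L) j = (w : H → L) 1 := fun j => by
      have := congrArg (fun x : A => (x : H → L) j) (hw j)
      simpa [hsmul] using this.symm
    refine ⟨(w : H → L) 1, fun h => hw0 (Subtype.ext (funext fun j => ?_)), ?_⟩
    · rw [hconst, h]; rfl
    · rw [← hker w 1]
      exact Finset.sum_congr rfl fun j _ => by rw [hconst (1 * j)]

/-! ### Residues of fixed elements, under residual separability. -/

section FixedResidues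

variable {G S : Type*} [Group G] [CommRing S] [IsLocalRing S] [MulSemiringAction G S]

/-- The field of residues of the elements fixed by a subgroup. -/
noncomputable def fixedResidues (S : Type*) [CommRing S] [IsLocalRing S] [MulSemiringAction G S]
    (H : Subgroup G) : Subfield (ResidueField S) where
  toSubring := (FixedPoints.subring S H).map (residue S)
  inv_mem' := by
    rintro _ ⟨r, hr, rfl⟩
    by_cases h0 : residue S r = 0
    · rw [h0, inv_zero]
      exact Subring.zero_mem _
    · rw [residue_eq_zero_iff, mem_maximalIdeal, mem_nonunits_iff, not_not] at h0
      obtain ⟨u, rfl⟩ := h0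
      refine ⟨((u⁻¹ : Sˣ) : S), fun h => ?_, map_units_inv (residue S) u⟩
      have h1 : h • (u : S) = u := hr h
      have h2 : h • ((u⁻¹ : Sˣ) : S) * u = 1 := by
        conv_lhs => rw [← h1]
        rw [← smul_mul', Units.inv_mul, smul_one]
      exact (Units.eq_inv_of_mul_eq_one_right h2)

theorem mem_fixedResidues {H : Subgroup G} {x : ResidueField S} :
    x ∈ fixedResidues S H ↔ ∃ r : S, (∀ h : H, h • r = r) ∧ residue S r = x := Iff.rfl

/-- If the residue field is separable over the residues of `S^G`, then a `p`-subgroup acting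
trivially on the residue field has enough fixed elements to represent all residues. -/
theorem exists_fixed_residue_eq [Finite G] (hsep : ResiduallySeparable G S) (H : Subgroup G)
    (htriv : ∀ h : H, ∀ s : S, residue S (h • s) = residue S s)
    (p a : ℕ) [ExpChar (ResidueField S) p] (hH : Nat.card H = p ^ a) (s : S) :
    ∃ r : S, (∀ h : H, h • r = r) ∧ residue S r = residue S s := by
  rw [← mem_fixedResidues]
  cases nonempty_fintype H
  set x := residue S s with hx
  -- The norm of s under H is fixed, and its residue is x^|H| because H acts trivially on residues.
  have hpow : x ^ p ^ a ∈ fixedResidues S H := by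
    refine ⟨∏ h : H, h • s, fun h => ?_, ?_⟩
    · rw [Finset.smul_prod']
      exact Fintype.prod_equiv (Equiv.mulLeft h) _ _ fun j => (mul_smul h j s).symm
    · rw [map_prod, Finset.prod_congr rfl fun h _ => htriv h s, Finset.prod_const,
        Finset.card_univ, ← Nat.card_eq_fintype_card, hH]
  let R := FixedPoints.subring S G
  let ψ₀ : R →+* fixedResidues S H :=
    ((residue S).comp R.subtype).codRestrict (fixedResidues S H) fun r =>
      ⟨r, fun h => r.2 h, rfl⟩
  let ψ : R ⧸ (maximalIdeal S).under R →+* fixedResidues S H :=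
    Ideal.Quotient.lift _ ψ₀ fun r hr => Subtype.ext ((residue_eq_zero_iff (r : S)).2 hr)
  obtain ⟨m, hm, h1⟩ : ∃ m : Polynomial (R ⧸ (maximalIdeal S).under R), m.Separable ∧
      m.eval₂ (algebraMap _ (S ⧸ maximalIdeal S)) (Ideal.Quotient.mk _ s) = 0 :=
    ⟨minpoly _ (Ideal.Quotient.mk _ s), hsep.isSeparable' _, by
      rw [← Polynomial.aeval_def]; exact minpoly.aeval _ _⟩
  have hψ : (fixedResidues S H).subtype.comp ψ = algebraMap _ (S ⧸ maximalIdeal S) :=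
    Ideal.Quotient.ringHom_ext (RingHom.ext fun r => rfl)
  have hsepx : IsSeparable (fixedResidues S H) x := by
    refine Polynomial.Separable.of_dvd (hm.map (f := ψ)) (minpoly.dvd _ _ ?_)
    rw [Polynomial.aeval_def, Polynomial.eval₂_map]
    exact (congrArg (fun φ => m.eval₂ φ (Ideal.Quotient.mk _ s)) hψ).trans h1
  -- For x separable over k = `fixedResidues S H` one has k(x) = k(x^(p^a)), and the right side is
  -- k.
  have key := IntermediateField.adjoin_simple_eq_adjoin_pow_expChar_pow_of_isSeparable
    (fixedResidues S H) (ResidueField S) hsepx p a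
  have hbot : x ^ p ^ a ∈ (⊥ : IntermediateField (fixedResidues S H) (ResidueField S)) :=
    IntermediateField.mem_bot.2 ⟨⟨_, hpow⟩, rfl⟩
  rw [IntermediateField.adjoin_simple_eq_bot_iff.2 hbot, IntermediateField.adjoin_simple_eq_bot_iff,
    IntermediateField.mem_bot] at key
  obtain ⟨y, hy⟩ := key
  rw [← hy]
  exact y.2

end FixedResidues

/-! ### The tame character and the wild inertia group. -/

section Tame

variable {G S : Type*} [Group G] [CommRing S] [IsDomain S] [IsDiscreteValuationRing S]
  [MulSemiringAction G S]

theorem Irreducible.smul_group {G S : Type*} [Group G] [CommRing S] [MulSemiringAction G S]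
    {ϖ : S} (hϖ : Irreducible ϖ) (g : G) : Irreducible (g • ϖ) :=
  (MulEquiv.irreducible_iff (MulSemiringAction.toRingEquiv G S g)).2 hϖ

theorem exists_smul_eq_unit_mul {ϖ : S} (hϖ : Irreducible ϖ) (g : G) :
    ∃ u : Sˣ, g • ϖ = u * ϖ := by
  obtain ⟨u, hu⟩ := IsDiscreteValuationRing.associated_of_irreducible S hϖ (hϖ.smul_group g)
  exact ⟨u, by rw [← hu, mul_comm]⟩

/-- The residue class of `g(ϖ) / ϖ`. -/
noncomputable def tameChar {ϖ : S} (hϖ : Irreducible ϖ) (g : G) : (ResidueField S)ˣ :=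
  Units.map (residue S).toMonoidHom (exists_smul_eq_unit_mul hϖ g).choose

theorem tameChar_eq {ϖ : S} (hϖ : Irreducible ϖ) (g : G) (c : S) (h : g • ϖ = c * ϖ) :
    (tameChar hϖ g : ResidueField S) = residue S c := by
  have h1 := (exists_smul_eq_unit_mul hϖ g).choose_spec
  rw [mul_right_cancel₀ hϖ.ne_zero (h.symm.trans h1)]
  rfl

theorem tameChar_mul {ϖ : S} (hϖ : Irreducible ϖ) (g h : G) :
    tameChar hϖ (g * h) = tameChar hϖ g * g • tameChar hϖ h := by
  obtain ⟨u, hu⟩ := exists_smul_eq_unit_mul hϖ g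
  obtain ⟨v, hv⟩ := exists_smul_eq_unit_mul hϖ h
  refine Units.ext ?_
  rw [Units.val_mul, Units.coe_smul, tameChar_eq hϖ g u hu, tameChar_eq hϖ h v hv,
    tameChar_eq hϖ (g * h) (g • v * u) (by rw [mul_smul, hv, smul_mul', hu, mul_assoc]),
    map_mul, ResidueField.residue_smul, mul_comm]

theorem tameChar_one {ϖ : S} (hϖ : Irreducible ϖ) : tameChar hϖ (1 : G) = 1 :=
  Units.ext (by rw [tameChar_eq hϖ 1 1 (by rw [one_smul, one_mul]), map_one, Units.val_one])

theorem mem_inertia_iff_residue (g : G) :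
    g ∈ (maximalIdeal S).toAddSubgroup.inertia G ↔ ∀ s : S, residue S (g • s) = residue S s := by
  rw [AddSubgroup.mem_inertia]
  refine forall_congr' fun s => ?_
  rw [Submodule.mem_toAddSubgroup, ← residue_eq_zero_iff, map_sub, sub_eq_zero]

theorem smul_residueField_of_mem_inertia {g : G}
    (hg : g ∈ (maximalIdeal S).toAddSubgroup.inertia G) (x : ResidueField S) : g • x = x := by
  obtain ⟨s, rfl⟩ := residue_surjective x
  rw [← ResidueField.residue_smul]
  exact (mem_inertia_iff_residue g).1 hg s

theorem smul_units_of_mem_inertia {g : G}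
    (hg : g ∈ (maximalIdeal S).toAddSubgroup.inertia G) (x : (ResidueField S)ˣ) : g • x = x :=
  Units.ext (smul_residueField_of_mem_inertia hg _)

theorem mem_inertia_of_smul {g : G} (hg : ∀ x : ResidueField S, g • x = x) :
    g ∈ (maximalIdeal S).toAddSubgroup.inertia G :=
  (mem_inertia_iff_residue g).2 fun s => by rw [ResidueField.residue_smul, hg]

/-- The tame character is a homomorphism on the inertia group. -/
noncomputable def tameHom {ϖ : S} (hϖ : Irreducible ϖ) :
    (maximalIdeal S).toAddSubgroup.inertia G →* (ResidueField S)ˣ where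
  toFun g := tameChar hϖ (g : G)
  map_one' := tameChar_one hϖ
  map_mul' g h := by
    rw [Subgroup.coe_mul, tameChar_mul, smul_units_of_mem_inertia g.2]

/-- The wild inertia group: the elements acting trivially on the associated graded ring. -/
noncomputable def wildInertia {ϖ : S} (G : Type*) [Group G] [MulSemiringAction G S]
    (hϖ : Irreducible ϖ) : Subgroup G :=
  (tameHom (G := G) hϖ).ker.map (Subgroup.subtype _)

theorem mem_wildInertia {ϖ : S} (hϖ : Irreducible ϖ) {g : G} :
    g ∈ wildInertia G hϖ ↔
      g ∈ (maximalIdeal S).toAddSubgroup.inertia G ∧ tameChar hϖ g = 1 := by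
  constructor
  · rintro ⟨g, hg, rfl⟩
    exact ⟨g.2, hg⟩
  · rintro ⟨h1, h2⟩
    exact ⟨⟨g, h1⟩, h2, rfl⟩

variable [FaithfulSMul G S]

theorem eq_one_of_mem_wildInertia {ϖ : S} (hϖ : Irreducible ϖ) {g : G}
    (hg : g ∈ wildInertia G hϖ) {n : ℕ} (hn : (n : ResidueField S) ≠ 0) (hgn : g ^ n = 1) :
    g = 1 := by
  rw [mem_wildInertia] at hg
  refine eq_one_of_wild hϖ (fun s => ?_) ?_ hn hgn
  · rw [← residue_eq_iff_dvd hϖ]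
    exact (mem_inertia_iff_residue g).1 hg.1 s
  · obtain ⟨u, hu⟩ := exists_smul_eq_unit_mul hϖ g
    have h1 := tameChar_eq hϖ g u hu
    rw [hg.2, Units.val_one, ← map_one (residue S), residue_eq_iff_dvd hϖ] at h1
    obtain ⟨w, hw⟩ := h1
    exact ⟨-w, by rw [hu]; linear_combination -ϖ * hw⟩

/-- Write the order of g as p^a m with m nonzero in the residue field. Then g^(p^a) is wild and
killed by m, hence trivial. In characteristic zero a = 0. -/
theorem exists_pow_eq_one_of_mem_wildInertia [Finite G] {ϖ : S} (hϖ : Irreducible ϖ) (p : ℕ)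
    [ExpChar (ResidueField S) p] {g : G} (hg : g ∈ wildInertia G hϖ) :
    ∃ a : ℕ, g ^ p ^ a = 1 := by
  obtain ⟨a, m, hm, hn⟩ : ∃ a m : ℕ, (m : ResidueField S) ≠ 0 ∧ orderOf g = p ^ a * m := by
    have h0 : orderOf g ≠ 0 := (orderOf_pos g).ne'
    rcases ‹ExpChar (ResidueField S) p› with _ | hp
    · exact ⟨0, orderOf g, Nat.cast_ne_zero.2 h0, by simp⟩
    · obtain ⟨a, m, hm, h⟩ := Nat.exists_eq_pow_mul_and_not_dvd h0 p hp.ne_one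
      exact ⟨a, m, by rwa [Ne, CharP.cast_eq_zero_iff _ p], h⟩
  refine ⟨a, eq_one_of_mem_wildInertia hϖ (Subgroup.pow_mem _ hg _) hm ?_⟩
  rw [← pow_mul, ← hn, pow_orderOf_eq_one]

theorem card_wildInertia [Finite G] {ϖ : S} (hϖ : Irreducible ϖ) (p : ℕ)
    [ExpChar (ResidueField S) p] : ∃ a : ℕ, Nat.card (wildInertia G hϖ) = p ^ a := by
  have h := fun (g : wildInertia G hϖ) => exists_pow_eq_one_of_mem_wildInertia hϖ p g.2
  rcases ‹ExpChar (ResidueField S) p› with _ | hp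
  · refine ⟨0, ?_⟩
    rw [pow_zero, Nat.card_eq_one_iff_unique]
    refine ⟨⟨fun x y => ?_⟩, ⟨1⟩⟩
    have key : ∀ x : wildInertia G hϖ, x = 1 := fun x => Subtype.ext (by simpa using h x)
    rw [key x, key y]
  · have := Fact.mk hp
    exact IsPGroup.iff_card.1 fun g => (h g).imp fun a ha => Subtype.ext ha

end Tame

/-! ### Determinants of right multiplication. -/

namespace CrossedProduct

section MulMatrix

variable {G K : Type*} [Group G] [CommRing K] [MulSemiringAction G K] {f : UnitCocycle G K}

instance : IsScalarTower K (CrossedProduct f) (CrossedProduct f) :=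
  ⟨fun t x y => smul_mul t x y⟩

/-- The matrix of right multiplication by `x` in the basis `U_g`. -/
noncomputable def mulMatrix (x : CrossedProduct f) : Matrix G G K :=
  Matrix.of fun h j => coeff j (single f h 1 * x)

theorem mulMatrix_apply (x : CrossedProduct f) (h j : G) :
    mulMatrix x h j = coeff j (single f h 1 * x) := rfl

theorem mulMatrix_apply_mul (x : CrossedProduct f) (h i : G) :
    mulMatrix x h (h * i) = h • coeff i x * (f (h, i) : K) := by
  rw [mulMatrix_apply, coeff_single_mul, one_mul]

theorem mulMatrix_scalar [DecidableEq G] (t : K) :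
    mulMatrix (scalar f t) = Matrix.diagonal fun h : G => h • t := by
  ext h j
  rw [mulMatrix_apply, single_mul_scalar, one_mul, coeff_single, Matrix.diagonal_apply]

variable [Fintype G]

theorem coeff_mul_eq_vecMul (x y : CrossedProduct f) (j : G) :
    coeff j (y * x) = ∑ h, coeff h y * mulMatrix x h j := by
  conv_lhs => rw [← sum_single y, Finset.sum_mul, map_sum]
  refine Finset.sum_congr rfl fun h _ => ?_
  rw [mulMatrix_apply, ← mul_one (coeff h y), ← smul_single, smul_mul, map_smul, smul_eq_mul,
    mul_one]

theorem mulMatrix_mul (x y : CrossedProduct f) :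
    mulMatrix (x * y) = mulMatrix x * mulMatrix y := by
  ext h j
  rw [mulMatrix_apply, ← mul_assoc, coeff_mul_eq_vecMul, Matrix.mul_apply]
  rfl

variable [DecidableEq G]

theorem exists_mul_eq_one_of_isUnit_det {x : CrossedProduct f} (hx : IsUnit (mulMatrix x).det) :
    ∃ y, y * x = 1 := by
  let r : G → K := Matrix.vecMul (fun g => coeff g (1 : CrossedProduct f)) (mulMatrix x)⁻¹
  refine ⟨∑ g, single f g (r g), ?_⟩
  have hr : ∀ h, coeff h (∑ g, single f g (r g)) = r h := fun h => by
    rw [map_sum]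
    simp_rw [coeff_single]
    simp
  ext j
  rw [coeff_mul_eq_vecMul]
  simp_rw [hr]
  change Matrix.vecMul r (mulMatrix x) j = _
  rw [Matrix.vecMul_vecMul, Matrix.nonsing_inv_mul _ hx, Matrix.vecMul_one]

theorem det_mulMatrix_scalar (t : K) :
    (mulMatrix (scalar f t)).det = ∏ h : G, h • t := by
  rw [mulMatrix_scalar, Matrix.det_diagonal]

/-- The determinant of right multiplication is invariant. -/
theorem smul_det_mulMatrix (g : G) (x : CrossedProduct f) :
    g • (mulMatrix x).det = (mulMatrix x).det := by
  -- By the cocycle identity, translating the indices by g and applying g to the entries give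
  -- matrices conjugate under the invertible diagonal matrix with entries f(g, h).
  have h1 : Matrix.diagonal (fun h => (f (g, h) : K)) *
      (mulMatrix x).submatrix (Equiv.mulLeft g) (Equiv.mulLeft g) =
      (mulMatrix x).map (MulSemiringAction.toRingHom G K g) *
        Matrix.diagonal (fun h => (f (g, h) : K)) := by
    ext h j
    obtain ⟨i, rfl⟩ : ∃ i, h * i = j := ⟨h⁻¹ * j, mul_inv_cancel_left _ _⟩
    rw [Matrix.diagonal_mul, Matrix.mul_diagonal, Matrix.submatrix_apply, Matrix.map_apply]
    change _ * mulMatrix x (g * h) (g * (h * i)) = g • mulMatrix x h (h * i) * _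
    rw [← mul_assoc g h i, mulMatrix_apply_mul, mulMatrix_apply_mul, smul_mul', mul_smul]
    linear_combination (g • h • coeff i x) * f.val_isCocycle g h i
  have h2 := congrArg Matrix.det h1
  rw [Matrix.det_mul, Matrix.det_mul, Matrix.det_submatrix_equiv_self, Matrix.det_diagonal,
    ← RingHom.mapMatrix_apply, ← RingHom.map_det, MulSemiringAction.toRingHom_apply,
    mul_comm (g • _)] at h2
  have hu : IsUnit (∏ h, (f (g, h) : K)) := by
    rw [← Units.coe_prod]
    exact Units.isUnit _
  exact (hu.mul_left_cancel h2).symm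

end MulMatrix

/-! ### Trivializations over an extension field with trivial action. -/

section Character

variable {G K L : Type*} [Group G] [Fintype G] [Field K] [MulSemiringAction G K] [Field L]
  [Algebra K L] (f : UnitCocycle G K)

/-- A trivialization of `f` over an extension field, for the trivial action, gives a ring
homomorphism. -/
noncomputable def toField (htriv : ∀ (g : G) (s : K), g • s = s) (μ : G → Lˣ)
    (hμ : ∀ g h, (μ g * μ h : L) = algebraMap K L (f (g, h)) * μ (g * h)) :
    CrossedProduct f →+* L :=
  liftHom
    (∑ g, (AddMonoidHom.mulRight (μ g : L)).comp
      ((algebraMap K L).toAddMonoidHom.comp (coeff g).toAddMonoidHom))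
    (by
      classical
      have h1 : (μ 1 : L) = algebraMap K L (f (1, 1)) := by
        have := hμ 1 1
        rw [mul_one] at this
        exact mul_right_cancel₀ (μ 1).ne_zero this
      rw [AddMonoidHom.finsetSum_apply, Finset.sum_eq_single 1]
      · change algebraMap K L (coeff 1 (1 : CrossedProduct f)) * μ 1 = 1
        rw [one_def, coeff_single_self, h1, ← map_mul, Units.inv_mul, map_one]
      · intro g _ hg
        change algebraMap K L (coeff g (1 : CrossedProduct f)) * μ g = 0
        rw [one_def, coeff_single_of_ne hg, map_zero, zero_mul]
      · simp)
    (by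
      classical
      have hs : ∀ g s, (∑ g, (AddMonoidHom.mulRight (μ g : L)).comp
          ((algebraMap K L).toAddMonoidHom.comp (coeff g).toAddMonoidHom)) (single f g s) =
          algebraMap K L s * μ g := fun g s => by
        rw [AddMonoidHom.finsetSum_apply, Finset.sum_eq_single g]
        · change algebraMap K L (coeff g (single f g s)) * μ g = _
          rw [coeff_single_self]
        · intro h _ hh
          change algebraMap K L (coeff h (single f g s)) * μ h = 0
          rw [coeff_single_of_ne hh, map_zero, zero_mul]
        · simp
      intro g h s t
      rw [single_mul_single, hs, hs, hs, htriv, map_mul, map_mul]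
      linear_combination -(algebraMap K L s * algebraMap K L t) * hμ g h)

theorem toField_apply (htriv : ∀ (g : G) (s : K), g • s = s) (μ : G → Lˣ)
    (hμ : ∀ g h, (μ g * μ h : L) = algebraMap K L (f (g, h)) * μ (g * h)) (x : CrossedProduct f) :
    toField f htriv μ hμ x = ∑ g, algebraMap K L (coeff g x) * μ g := by
  change (∑ g, (AddMonoidHom.mulRight (μ g : L)).comp
    ((algebraMap K L).toAddMonoidHom.comp (coeff g).toAddMonoidHom)) x = _
  rw [AddMonoidHom.finsetSum_apply]
  rfl

/-- Conjugating by the diagonal matrix of μ turns right multiplication by x into a group matrix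
whose coefficients sum to the image of x under `toField`. -/
theorem det_mulMatrix_ne_zero [DecidableEq G] (p a : ℕ) [ExpChar L p] (hG : Nat.card G = p ^ a)
    (htriv : ∀ (g : G) (s : K), g • s = s) (μ : G → Lˣ)
    (hμ : ∀ g h, (μ g * μ h : L) = algebraMap K L (f (g, h)) * μ (g * h)) (x : CrossedProduct f)
    (hx : toField f htriv μ hμ x ≠ 0) : (mulMatrix x).det ≠ 0 := by
  rw [toField_apply] at hx
  have h1 := det_groupMatrix_ne_zero p a hG _ hx
  have h2 : (mulMatrix x).map (algebraMap K L) * Matrix.diagonal (fun h => (μ h : L)) =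
      Matrix.diagonal (fun h => (μ h : L)) *
        Matrix.of fun h j : G => algebraMap K L (coeff (h⁻¹ * j) x) * μ (h⁻¹ * j) := by
    ext h j
    obtain ⟨i, rfl⟩ : ∃ i, h * i = j := ⟨h⁻¹ * j, mul_inv_cancel_left _ _⟩
    rw [Matrix.diagonal_mul, Matrix.mul_diagonal, Matrix.map_apply, Matrix.of_apply,
      inv_mul_cancel_left, mulMatrix_apply_mul, htriv, map_mul]
    linear_combination -(algebraMap K L (coeff i x)) * hμ h i
  have h3 := congrArg Matrix.det h2
  rw [Matrix.det_mul, Matrix.det_mul, Matrix.det_diagonal, ← RingHom.mapMatrix_apply,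
    ← RingHom.map_det] at h3
  have hu : ∏ h, (μ h : L) ≠ 0 := Finset.prod_ne_zero_iff.2 fun h _ => (μ h).ne_zero
  intro h0
  rw [h0, map_zero, zero_mul, eq_comm, mul_eq_zero] at h3
  exact h3.elim hu h1

/-- For the trivial action of a `p`-group in characteristic `p`, 2-cocycles become trivial over an
algebraically closed extension. -/
theorem exists_trivialization [IsAlgClosed L] (p a : ℕ) [ExpChar L p] (hG : Nat.card G = p ^ a)
    (htriv : ∀ (g : G) (s : K), g • s = s) :
    ∃ μ : G → Lˣ, ∀ g h, (μ g * μ h : L) = algebraMap K L (f (g, h)) * μ (g * h) := by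
  have hq : 0 < p ^ a := hG ▸ Nat.card_pos
  have hcard : Fintype.card G = p ^ a := by rw [← hG, Nat.card_eq_fintype_card]
  -- The product of the cocycle identity over the third argument shows that the |G|-th power of f is
  -- the coboundary of F. Roots of order p^a exist in L and are unique, so the relation passes to
  -- them.
  let F : G → K := fun g => ∏ h, (f (g, h) : K)
  have hF0 : ∀ g, F g ≠ 0 := fun g => Finset.prod_ne_zero_iff.2 fun h _ => (f (g, h)).ne_zero
  have hF : ∀ g h, F g * F h = (f (g, h) : K) ^ p ^ a * F (g * h) := fun g h => by
    have h1 : ∏ i, ((f (g * h, i) : K) * f (g, h)) =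
        ∏ i, ((g • (f (h, i) : K)) * f (g, h * i)) :=
      Finset.prod_congr rfl fun i _ => f.val_isCocycle g h i
    have h2 : ∏ i, (f (g, h * i) : K) = F g :=
      Fintype.prod_equiv (Equiv.mulLeft h) _ _ fun i => rfl
    simp only [htriv, Finset.prod_mul_distrib, Finset.prod_const, Finset.card_univ, hcard, h2]
      at h1
    linear_combination -h1
  choose μ hμ using fun g => IsAlgClosed.exists_pow_nat_eq (algebraMap K L (F g)) hq
  have hμ0 : ∀ g, μ g ≠ 0 := fun g h0 => by
    have := hμ g
    rw [h0, zero_pow hq.ne', eq_comm, map_eq_zero] at this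
    exact hF0 g this
  refine ⟨fun g => Units.mk0 (μ g) (hμ0 g), fun g h => ?_⟩
  simp only [Units.val_mk0]
  refine iterateFrobenius_inj L p a ?_
  rw [iterateFrobenius_def, iterateFrobenius_def, mul_pow, mul_pow, hμ, hμ, hμ, ← map_pow,
    ← map_mul, ← map_mul, hF]

end Character

theorem residue_det_mulMatrix {G S : Type*} [Group G] [Fintype G] [DecidableEq G]
    [CommRing S] [IsLocalRing S] [MulSemiringAction G S] (f : UnitCocycle G S)
    (x : CrossedProduct f) :
    residue S (mulMatrix x).det = (mulMatrix (reduce f x)).det := by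
  rw [RingHom.map_det]
  congr 1
  ext h j
  rw [RingHom.mapMatrix_apply, Matrix.map_apply, mulMatrix_apply, mulMatrix_apply, ← coeff_reduce,
    map_mul, reduce_single, map_one]

/-! ### The wild part: a hereditary order whose reduction embeds in a field. -/

section Main

variable {G S : Type*} [Group G] [Finite G] [CommRing S] [IsDomain S] [IsDiscreteValuationRing S]
  [MulSemiringAction G S] [FaithfulSMul G S]

/-- If the crossed product of a totally ramified `p`-extension is left hereditary, then its
reduction embeds into a field. -/
theorem exists_injective_to_algebraicClosure (f : UnitCocycle G S)
    (hproj : ∀ J : Submodule (CrossedProduct f) (CrossedProduct f),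
      Module.Projective (CrossedProduct f) J)
    (htriv : ∀ (g : G) (s : ResidueField S), g • s = s)
    (hres : ∀ s : S, ∃ r : S, (∀ g : G, g • r = r) ∧ residue S r = residue S s)
    (p a : ℕ) [ExpChar (ResidueField S) p] (hG : Nat.card G = p ^ a) :
    ∃ Ψ : CrossedProduct f.reduction →+* AlgebraicClosure (ResidueField S),
      Function.Injective Ψ := by
  classical
  cases nonempty_fintype G
  obtain ⟨ϖ, hϖ⟩ := IsDiscreteValuationRing.exists_irreducible S
  have : ExpChar (AlgebraicClosure (ResidueField S)) p :=
    expChar_of_injective_algebraMap (algebraMap (ResidueField S) _).injective p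
  obtain ⟨μ, hμ⟩ := exists_trivialization (L := AlgebraicClosure (ResidueField S)) f.reduction
    p a hG htriv
  let Ψ := toField f.reduction htriv μ hμ
  let J : Submodule (CrossedProduct f) (CrossedProduct f) := RingHom.ker (Ψ.comp (reduce f))
  have hJ : ∀ x, x ∈ J ↔ Ψ (reduce f x) = 0 := fun x => RingHom.mem_ker
  -- The determinant is nonzero modulo the maximal ideal, hence a unit, whenever x lies outside J.
  have hinv : ∀ x, Ψ (reduce f x) ≠ 0 → ∃ y, y * x = 1 := fun x hx => by
    refine exists_mul_eq_one_of_isUnit_det ?_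
    have h1 := det_mulMatrix_ne_zero f.reduction p a hG htriv μ hμ _ hx
    rwa [← residue_det_mulMatrix, Ne, residue_eq_zero_iff, mem_maximalIdeal, mem_nonunits_iff,
      not_not] at h1
  have h1J : (1 : CrossedProduct f) ∉ J := fun h => by
    rw [hJ, map_one, map_one] at h
    exact one_ne_zero h
  have hredϖ : reduce f (scalar f ϖ) = 0 := by
    rw [scalar_eq_single, reduce_single, map_mul, (residue_eq_zero_iff_dvd hϖ ϖ).2 dvd_rfl,
      zero_mul, single_zero]
  have hϖJ : scalar f ϖ ∈ J := by rw [hJ, hredϖ, map_zero]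
  have hJjac : J ≤ Ring.jacobson (CrossedProduct f) := by
    rw [← Ideal.jacobson_bot]
    intro x hx
    rw [Ideal.mem_jacobson_iff]
    intro y
    obtain ⟨z, hz⟩ := hinv (y * x + 1) (by
      have : Ψ (reduce f (y * x)) = 0 := (hJ _).1 (J.smul_mem y hx)
      rw [map_add, map_add, this, map_one, map_one, zero_add]
      exact one_ne_zero)
    refine ⟨z, ?_⟩
    rw [Ideal.mem_bot, ← hz]
    noncomm_ring
  have : IsNoetherianRing (CrossedProduct f) := isNoetherian_of_tower S inferInstance
  obtain ⟨s, hs⟩ := (Module.projective_def).1 (hproj J)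
  -- If all coordinates of the section of the free cover of J lay in J, then J would equal its
  -- product with the radical, and Nakayama's lemma would give J = 0, contradicting ϖ ∈ J.
  obtain ⟨x₀, j, hxj⟩ : ∃ x j, s x j ∉ J := by
    by_contra! hall
    have hle : J ≤ Ring.jacobson (CrossedProduct f) • J := by
      intro x hx
      have h1 : x = (Finsupp.linearCombination (CrossedProduct f) id (s ⟨x, hx⟩) : J) :=
        congrArg Subtype.val (hs ⟨x, hx⟩).symm
      rw [h1, Finsupp.linearCombination_apply, Finsupp.sum, AddSubmonoidClass.coe_finsetSum]
      exact Submodule.sum_mem _ fun i _ => Submodule.smul_mem_smul (hJjac (hall _ i)) i.2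
    have hbot := (IsNoetherian.noetherian J).eq_bot_of_le_jacobson_smul hle
    rw [hbot, Submodule.mem_bot] at hϖJ
    exact hϖ.ne_zero (scalar_injective (hϖJ.trans (map_zero _).symm))
  let φ : J →ₗ[CrossedProduct f] CrossedProduct f := (Finsupp.lapply j).comp s
  obtain ⟨u, hu⟩ := hinv (φ x₀) fun h => hxj ((hJ _).2 h)
  have hφsurj : Function.Surjective φ := fun t =>
    ⟨(t * u) • x₀, by rw [map_smul, smul_eq_mul, mul_assoc, hu, mul_one]⟩
  -- A surjection from an S-submodule of a finite S-module onto that module is injective; so J is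
  -- free of rank one, generated by z.
  have hφinj : Function.Injective φ :=
    OrzechProperty.injective_of_surjective_of_submodule (R := S) (N := J.restrictScalars S)
      (φ.restrictScalars S) hφsurj
  obtain ⟨z, hz⟩ := hφsurj 1
  have hgen : ∀ x : J, (x : CrossedProduct f) = φ x * z := fun x => by
    have : x = φ x • z := hφinj (by rw [map_smul, hz, smul_eq_mul, mul_one])
    exact congrArg Subtype.val this
  set w := φ ⟨_, hϖJ⟩
  have hwz : scalar f ϖ = w * z := hgen ⟨_, hϖJ⟩
  have hzu : ¬ IsUnit (mulMatrix (z : CrossedProduct f)).det := fun h => by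
    obtain ⟨y, hy⟩ := exists_mul_eq_one_of_isUnit_det h
    exact h1J (hy ▸ J.smul_mem y z.2)
  obtain ⟨t, ht⟩ := uniformizer_pow_card_dvd_of_fixed (H := G) hϖ
    (fun s => by
      obtain ⟨r, hr, hrs⟩ := hres s
      exact ⟨r, hr, (residue_eq_iff_dvd hϖ _ _).1 hrs.symm⟩)
    (fun g => smul_det_mulMatrix g (z : CrossedProduct f)) hzu
  -- The determinant of ϖ has valuation exactly |G|, and that of z is divisible by ϖ^|G|, so no
  -- valuation is left for w.
  have hdet : ∏ g : G, g • ϖ = (mulMatrix w).det * (mulMatrix (z : CrossedProduct f)).det := by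
    rw [← Matrix.det_mul, ← mulMatrix_mul, ← hwz, det_mulMatrix_scalar]
  choose c hc using fun g : G => exists_smul_eq_unit_mul hϖ g
  rw [Finset.prod_congr rfl fun g _ => hc g, Finset.prod_mul_distrib, Finset.prod_const,
    Finset.card_univ, ← Nat.card_eq_fintype_card, ht, mul_left_comm, mul_comm] at hdet
  have hwu : IsUnit (mulMatrix w).det := by
    have h1 := mul_left_cancel₀ (pow_ne_zero _ hϖ.ne_zero) hdet
    refine isUnit_of_mul_isUnit_left (y := t) ?_
    rw [← h1, ← Units.coe_prod]
    exact Units.isUnit _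
  obtain ⟨y, hy⟩ := exists_mul_eq_one_of_isUnit_det hwu
  have hzy : (z : CrossedProduct f) = y * scalar f ϖ := by
    rw [hwz, ← mul_assoc, hy, one_mul]
  refine ⟨Ψ, (injective_iff_map_eq_zero Ψ).2 fun y' hy₀ => ?_⟩
  obtain ⟨x, rfl⟩ := reduce_surjective f y'
  have hx := hgen ⟨x, (hJ x).2 hy₀⟩
  rw [hzy, ← mul_assoc] at hx
  change x = _ at hx
  rw [hx, map_mul, hredϖ, mul_zero]

end Main

end CrossedProduct

/-! ### Tame data: commutativity, reducedness and semisimplicity. -/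

theorem sum_pow_expChar_pow_of_commute {R ι : Type*} [Ring R] (p : ℕ) [ExpChar R p] (n : ℕ)
    (s : Finset ι) (a : ι → R) (h : ∀ i ∈ s, ∀ j ∈ s, Commute (a i) (a j)) :
    (∑ i ∈ s, a i) ^ p ^ n = ∑ i ∈ s, a i ^ p ^ n := by
  classical
  induction s using Finset.induction_on with
  | empty => simp [(expChar_pos R p).ne']
  | insert i s hi ih =>
    rw [Finset.sum_insert hi, Finset.sum_insert hi, add_pow_expChar_pow_of_commute,
      ih fun i hi j hj => h i (Finset.mem_insert_of_mem hi) j (Finset.mem_insert_of_mem hj)]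
    exact Commute.sum_right _ _ _ fun j hj =>
      h i (Finset.mem_insert_self _ _) j (Finset.mem_insert_of_mem hj)

namespace CrossedProduct

section Supported

variable {G K : Type*} [Group G] [CommRing K] [MulSemiringAction G K] (F : UnitCocycle G K)

/-- The subring of elements supported on a subgroup. -/
noncomputable def supported (H : Subgroup G) : Subring (CrossedProduct F) :=
  (ofSubgroup F H).range

variable {F} {H : Subgroup G}

theorem mem_supported {x : CrossedProduct F} :
    x ∈ supported F H ↔ ∀ g ∉ H, coeff g x = 0 := by
  constructor
  · rintro ⟨y, rfl⟩ g hg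
    exact coeff_ofSubgroup_of_notMem F H hg y
  · intro h
    exact ⟨_, ofSubgroup_toSubgroup h⟩

theorem single_mem_supported {g : G} (hg : g ∈ H) (s : K) : single F g s ∈ supported F H :=
  ⟨single _ ⟨g, hg⟩ s, ofSubgroup_single F H _ _⟩

theorem scalar_mem_supported (t : K) : scalar F t ∈ supported F H := by
  rw [scalar_eq_single]
  exact single_mem_supported H.one_mem _

/-- The projection onto the elements supported on a subgroup. -/
noncomputable def proj (F : UnitCocycle G K) (H : Subgroup G) :
    CrossedProduct F →+ CrossedProduct F :=
  (ofSubgroup F H).toAddMonoidHom.comp (toSubgroup F H)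

theorem proj_mem (x : CrossedProduct F) : proj F H x ∈ supported F H := ⟨_, rfl⟩

theorem coeff_proj {g : G} (hg : g ∈ H) (x : CrossedProduct F) :
    coeff g (proj F H x) = coeff g x :=
  coeff_ofSubgroup F H ⟨g, hg⟩ _

theorem proj_eq_self {x : CrossedProduct F} (hx : x ∈ supported F H) : proj F H x = x :=
  ofSubgroup_toSubgroup (mem_supported.1 hx)

theorem exists_single_pow_eq (g : G) (s : Kˣ) (n : ℕ) :
    ∃ c : Kˣ, single F g (s : K) ^ n = single F (g ^ n) (c : K) := by
  induction n with
  | zero => exact ⟨(F (1, 1))⁻¹, by rw [pow_zero, pow_zero, one_def]⟩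
  | succ n ih =>
    obtain ⟨c, hc⟩ := ih
    refine ⟨c * (g ^ n • s) * F (g ^ n, g), ?_⟩
    rw [pow_succ, hc, single_mul_single, pow_succ]
    rfl

theorem single_eq_scalar_mul (g : G) (s : K) : single F g s = scalar F s * single F g 1 := by
  rw [scalar_mul_single, mul_one]

end Supported

end CrossedProduct

open CrossedProduct

/-- A finite group acting on a field of exponential characteristic `p` with kernel `I`, a 2-cocycle
`F`, and a crossed homomorphism `χ` whose kernel `Q` on `I` is a `p`-group such that `p`-power maps
are injective on the part of the crossed product supported on `Q`. -/
structure TameDatum {G K : Type*} [Group G] [Field K] [MulSemiringAction G K]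
    (F : UnitCocycle G K) (p : ℕ) where
  I : Subgroup G
  mem_I : ∀ g, g ∈ I ↔ ∀ x : K, g • x = x
  χ : G → Kˣ
  χ_mul : ∀ g h, χ (g * h) = χ g * g • χ h
  Q : Subgroup G
  mem_Q : ∀ g, g ∈ Q ↔ g ∈ I ∧ χ g = 1
  a : ℕ
  card_Q : Nat.card Q = p ^ a
  pow_inj : ∀ x ∈ supported F Q, ∀ y ∈ supported F Q, ∀ n : ℕ, x ^ p ^ n = y ^ p ^ n → x = y

namespace TameDatum

variable {G K : Type*} [Group G] [Field K] [MulSemiringAction G K] {F : UnitCocycle G K} {p : ℕ}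
  (D : TameDatum F p)
include D

theorem smul_eq {g : G} (hg : g ∈ D.I) (x : K) : g • x = x := (D.mem_I g).1 hg x

theorem smul_units_eq {g : G} (hg : g ∈ D.I) (x : Kˣ) : g • x = x := Units.ext (D.smul_eq hg _)

theorem conj_mem_I {h : G} (hh : h ∈ D.I) (g : G) : g * h * g⁻¹ ∈ D.I :=
  (D.mem_I _).2 fun x => by rw [mul_smul, mul_smul, D.smul_eq hh, smul_inv_smul]

theorem χ_mul_of_mem {g : G} (hg : g ∈ D.I) (h : G) : D.χ (g * h) = D.χ g * D.χ h := by
  rw [D.χ_mul, D.smul_units_eq hg]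

/-- Although χ is only a crossed homomorphism on G, this equivariance on I makes Q normal in G. -/
theorem χ_conj {h : G} (hh : h ∈ D.I) (g : G) : D.χ (g * h * g⁻¹) = g • D.χ h := by
  have h1 := D.χ_mul (g * h * g⁻¹) g
  rw [inv_mul_cancel_right, D.χ_mul, D.smul_units_eq (D.conj_mem_I hh g), mul_comm] at h1
  exact (mul_right_cancel h1).symm

theorem Q_le_I : D.Q ≤ D.I := fun g hg => ((D.mem_Q g).1 hg).1

theorem conj_mem_Q {h : G} (hh : h ∈ D.Q) (g : G) : g * h * g⁻¹ ∈ D.Q := by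
  have h1 := (D.mem_Q h).1 hh
  exact (D.mem_Q _).2 ⟨D.conj_mem_I h1.1 g, by rw [D.χ_conj h1.1, h1.2, smul_one]⟩

theorem pow_eq_one {q : G} (hq : q ∈ D.Q) : q ^ p ^ D.a = 1 := by
  have : (⟨q, hq⟩ : D.Q) ^ Nat.card D.Q = 1 := pow_card_eq_one'
  rw [D.card_Q] at this
  exact congrArg Subtype.val this

/-- The restriction of `χ` to `I`. -/
def χI : D.I →* Kˣ where
  toFun g := D.χ g
  map_one' := by
    have := D.χ_mul 1 1
    rw [mul_one, one_smul] at this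
    exact left_eq_mul.1 this
  map_mul' g h := D.χ_mul_of_mem g.2 h

theorem inv_mul_mem_Q {g h : G} (hg : g ∈ D.I) (hh : h ∈ D.I) (hχ : D.χ g = D.χ h) :
    g⁻¹ * h ∈ D.Q := by
  refine (D.mem_Q _).2 ⟨D.I.mul_mem (D.I.inv_mem hg) hh, ?_⟩
  change D.χI (⟨g, hg⟩⁻¹ * ⟨h, hh⟩) = 1
  rw [map_mul, map_inv, inv_mul_eq_one]
  exact hχ

theorem commute_scalar {x : CrossedProduct F} (hx : x ∈ supported F D.I) (t : K) :
    Commute (scalar F t) x := by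
  ext g
  rw [coeff_scalar_mul, coeff_mul_scalar]
  by_cases hg : g ∈ D.I
  · rw [D.smul_eq hg, mul_comm]
  · rw [mem_supported.1 hx g hg, mul_zero, zero_mul]

/-- The basis elements of `Q` are central in the part supported on `I`. -/
theorem commute_single_of_mem_Q {g q : G} (hg : g ∈ D.I) (hq : q ∈ D.Q) :
    Commute (single F g 1) (single F q 1) := by
  set q' := g * q * g⁻¹ with hq'
  have hq'Q : q' ∈ D.Q := D.conj_mem_Q hq g
  -- y is the conjugate of U_q by U_g. The p^a-th power of U_q is supported at 1, so it is a scalar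
  -- and commutes with U_g; y and U_q thus have the same p^a-th power, and both are supported on Q.
  let y : CrossedProduct F := single F q' ((F (g, q) * (F (q', g))⁻¹ : Kˣ) : K)
  have hy : single F g 1 * single F q 1 = y * single F g 1 := by
    rw [single_mul_single, single_mul_single, smul_one, smul_one, hq', inv_mul_cancel_right,
      ← hq', Units.val_mul, mul_one, mul_one, one_mul, mul_assoc, Units.inv_mul, mul_one]
  have hu : IsUnit (single F g (1 : K)) := isUnit_single g 1
  have hpow : ∀ n : ℕ, single F g 1 * single F q 1 ^ n = y ^ n * single F g 1 := fun n =>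
    (SemiconjBy.pow_right (show SemiconjBy _ _ _ from hy) n)
  obtain ⟨c, hc⟩ := exists_single_pow_eq (F := F) q 1 (p ^ D.a)
  rw [Units.val_one, D.pow_eq_one hq] at hc
  have hcs : single F 1 (c : K) = scalar F ((c * F (1, 1) : Kˣ) : K) := by
    rw [scalar_eq_single, ← Units.val_mul, mul_inv_cancel_right]
  have h1 : y ^ p ^ D.a = single F q 1 ^ p ^ D.a := by
    refine hu.mul_right_cancel ?_
    rw [← hpow, hc, hcs]
    exact (D.commute_scalar (single_mem_supported hg 1) _).symm
  have h2 := D.pow_inj _ (single_mem_supported hq'Q _) _ (single_mem_supported hq _) _ h1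
  exact hy.trans (congrArg (· * _) h2)

/-- I/Q embeds in Kˣ through χ, and finite subgroups of Kˣ are cyclic. -/
theorem exists_generator [Finite G] :
    ∃ g₀ ∈ D.I, ∀ g ∈ D.I, ∃ (i : ℕ), ∃ q ∈ D.Q, g = g₀ ^ i * q := by
  have : Finite D.χI.range := Finite.of_surjective _ D.χI.rangeRestrict_surjective
  have := isCyclic_of_injective_ringHom ((Units.coeHom K).comp D.χI.range.subtype)
    (Units.val_injective.comp Subtype.val_injective)
  obtain ⟨⟨_, g₀, rfl⟩, hgen⟩ := IsCyclic.exists_generator (α := D.χI.range)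
  refine ⟨g₀, g₀.2, fun g hg => ?_⟩
  have h1 := hgen ⟨D.χI ⟨g, hg⟩, ⟨g, hg⟩, rfl⟩
  rw [← mem_powers_iff_mem_zpowers] at h1
  obtain ⟨i, hi⟩ := h1
  have hi' : D.χI (g₀ ^ i) = D.χI ⟨g, hg⟩ := by
    rw [map_pow]
    exact congrArg Subtype.val hi
  exact ⟨i, ((g₀ : G) ^ i)⁻¹ * g, D.inv_mul_mem_Q (D.I.pow_mem g₀.2 i) hg hi',
    (mul_inv_cancel_left _ _).symm⟩

theorem χ_eq_of_pow_eq [ExpChar K p] {g h : G} (hg : g ∈ D.I) (hh : h ∈ D.I) {n : ℕ}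
    (hgh : g ^ p ^ n = h ^ p ^ n) : D.χ g = D.χ h := by
  have h1 : D.χI (⟨g, hg⟩ ^ p ^ n) = D.χI (⟨h, hh⟩ ^ p ^ n) :=
    congrArg D.χI (Subtype.ext hgh)
  rw [map_pow, map_pow] at h1
  refine Units.ext (iterateFrobenius_inj K p n ?_)
  rw [iterateFrobenius_def, iterateFrobenius_def]
  exact congrArg Units.val h1

variable [Finite G]

/-- The part supported on I is generated by scalars, the U_q with q ∈ Q, which commute with every
U_g for g ∈ I, and a single further element U_{g₀}. -/
theorem commute_single {g h : G} (hg : g ∈ D.I) (hh : h ∈ D.I) (s t : K) :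
    Commute (single F g s) (single F h t) := by
  suffices H : ∀ g ∈ D.I, ∀ h ∈ D.I, Commute (single F g (1 : K)) (single F h 1) by
    rw [single_eq_scalar_mul g, single_eq_scalar_mul h]
    have hs := fun t => D.commute_scalar (single_mem_supported hg (1 : K)) t
    have ht := fun t => D.commute_scalar (single_mem_supported hh (1 : K)) t
    have hst : Commute (scalar F s) (scalar F t) := D.commute_scalar (scalar_mem_supported t) s
    exact (hst.mul_right (ht s)).mul_left ((hs t).symm.mul_right (H g hg h hh))
  obtain ⟨g₀, hg₀, hgen⟩ := D.exists_generator
  have key : ∀ x : CrossedProduct F, Commute (single F g₀ 1) x →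
      (∀ q ∈ D.Q, Commute (single F q 1) x) → (∀ s, Commute (scalar F s) x) →
      ∀ g ∈ D.I, Commute (single F g (1 : K)) x := by
    intro x h1 h2 h3 g hg
    obtain ⟨i, q, hq, rfl⟩ := hgen g hg
    obtain ⟨c, hc⟩ := exists_single_pow_eq (F := F) g₀ 1 i
    rw [Units.val_one] at hc
    have h4 : single F (g₀ ^ i * q) (1 : K) =
        scalar F (((c * F (g₀ ^ i, q))⁻¹ : Kˣ) : K) * (single F g₀ 1 ^ i * single F q 1) := by
      rw [hc, single_mul_single, smul_one, mul_one, scalar_mul_single, ← Units.val_mul,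
        Units.inv_mul]
    rw [h4]
    exact (h3 _).mul_left ((h1.pow_left i).mul_left (h2 q hq))
  have h0 : ∀ h ∈ D.I, Commute (single F h (1 : K)) (single F g₀ 1) :=
    key _ (Commute.refl _) (fun q hq => (D.commute_single_of_mem_Q hg₀ hq).symm)
      fun s => D.commute_scalar (single_mem_supported hg₀ _) s
  intro g hg h hh
  exact key _ (h0 h hh).symm (fun q hq => (D.commute_single_of_mem_Q hh hq).symm)
    (fun s => D.commute_scalar (single_mem_supported hh _) s) g hg

theorem mul_comm_of_mem_I {g h : G} (hg : g ∈ D.I) (hh : h ∈ D.I) : g * h = h * g := by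
  have h1 := D.commute_single hg hh 1 1
  rw [commute_iff_eq, single_mul_single, single_mul_single] at h1
  refine eq_of_single_eq ?_ h1
  rw [smul_one, mul_one, one_mul]
  exact (F (g, h)).ne_zero

theorem commute_of_mem {x y : CrossedProduct F} (hx : x ∈ supported F D.I)
    (hy : y ∈ supported F D.I) : Commute x y := by
  cases nonempty_fintype G
  rw [← sum_single x, ← sum_single y]
  refine Commute.sum_left _ _ _ fun g _ => Commute.sum_right _ _ _ fun h _ => ?_
  by_cases hg : g ∈ D.I
  · by_cases hh : h ∈ D.I
    · exact D.commute_single hg hh _ _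
    · rw [mem_supported.1 hy h hh, single_zero]
      exact Commute.zero_right _
  · rw [mem_supported.1 hx g hg, single_zero]
    exact Commute.zero_left _

variable [ExpChar K p]

/-- The part of the crossed product supported on `I` is reduced. -/
theorem eq_zero_of_pow_expChar_pow_eq_zero {x : CrossedProduct F} (hx : x ∈ supported F D.I)
    {N : ℕ} (hN : D.a ≤ N) (hxN : x ^ p ^ N = 0) : x = 0 := by
  classical
  cases nonempty_fintype G
  have : ExpChar (CrossedProduct F) p := expChar_of_injective_ringHom scalar_injective p
  ext h
  rw [map_zero]
  by_cases hh : h ∈ D.I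
  swap
  · exact mem_supported.1 hx h hh
  let A : Finset G := Finset.univ.filter fun g => g ∈ D.I
  -- B is the coset h Q. As N ≥ a, raising to the power p^N collapses each coset of Q in I to one
  -- group element, and χ separates the results. So the part y of x on h Q is itself nilpotent;
  -- translating by h⁻¹ moves it into the part supported on Q, where p-powers are injective.
  let B : Finset G := A.filter fun g => D.χ g = D.χ h
  have hA : ∀ g, g ∈ A ↔ g ∈ D.I := fun g => by simp [A]
  have hB : ∀ g, g ∈ B ↔ g ∈ D.I ∧ D.χ g = D.χ h := fun g => by simp [B, A]
  have hcomm : ∀ g ∈ A, ∀ g' ∈ A, Commute (single F g (coeff g x)) (single F g' (coeff g' x)) :=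
    fun g hg g' hg' => D.commute_single ((hA g).1 hg) ((hA g').1 hg') _ _
  have hxA : x = ∑ g ∈ A, single F g (coeff g x) := by
    conv_lhs => rw [← sum_single x]
    refine (Finset.sum_subset (Finset.subset_univ A) fun g _ hg => ?_).symm
    rw [mem_supported.1 hx g fun h' => hg ((hA g).2 h'), single_zero]
  let y : CrossedProduct F := ∑ g ∈ B, single F g (coeff g x)
  have hpow : ∀ g s, ∃ c : K, single F g s ^ p ^ N = single F (g ^ p ^ N) c := fun g s => by
    by_cases hs : s = 0
    · refine ⟨0, ?_⟩
      rw [hs, single_zero, single_zero, zero_pow (pow_pos (expChar_pos K p) N).ne']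
    · obtain ⟨c, hc⟩ := exists_single_pow_eq (F := F) g (Units.mk0 s hs) (p ^ N)
      exact ⟨c, hc⟩
  have hgB : ∀ g ∈ B, g ^ p ^ N = h ^ p ^ N := fun g hg => by
    have h1 := (hB g).1 hg
    have h2 := D.pow_eq_one (D.inv_mul_mem_Q h1.1 hh h1.2)
    have h3 : (g⁻¹ * h) ^ p ^ N = 1 := by
      obtain ⟨k, rfl⟩ := Nat.exists_eq_add_of_le hN
      rw [pow_add, pow_mul, h2, one_pow]
    rw [(show Commute g⁻¹ h from D.mul_comm_of_mem_I (D.I.inv_mem h1.1) hh).mul_pow, inv_pow,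
      inv_mul_eq_one] at h3
    exact h3
  have hy0 : y ^ p ^ N = 0 := by
    have h1 := sum_pow_expChar_pow_of_commute p N A _ hcomm
    rw [← hxA, hxN, ← Finset.sum_filter_add_sum_filter_not A (fun g => D.χ g = D.χ h),
      ← sum_pow_expChar_pow_of_commute p N B _ fun g hg g' hg' =>
        hcomm g (Finset.mem_of_mem_filter g hg) g' (Finset.mem_of_mem_filter g' hg')] at h1
    ext j
    rw [map_zero]
    by_cases hj : j = h ^ p ^ N
    · have h2 : ∑ g ∈ A with ¬ D.χ g = D.χ h, coeff j (single F g (coeff g x) ^ p ^ N) = 0 := by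
        refine Finset.sum_eq_zero fun g hg => ?_
        rw [Finset.mem_filter] at hg
        obtain ⟨c, hc⟩ := hpow g (coeff g x)
        rw [hc, coeff_single_of_ne]
        rw [hj]
        exact fun h3 => hg.2 (D.χ_eq_of_pow_eq ((hA g).1 hg.1) hh h3.symm)
      have h3 := congrArg (coeff j) h1
      rw [map_add, map_sum, h2, add_zero, map_zero] at h3
      exact h3.symm
    · rw [sum_pow_expChar_pow_of_commute p N B _ fun g hg g' hg' =>
        hcomm g (Finset.mem_of_mem_filter g hg) g' (Finset.mem_of_mem_filter g' hg'), map_sum]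
      refine Finset.sum_eq_zero fun g hg => ?_
      obtain ⟨c, hc⟩ := hpow g (coeff g x)
      rw [hc, hgB g hg, coeff_single_of_ne hj]
  have hyI : y ∈ supported F D.I := Subring.sum_mem _ fun g hg =>
    single_mem_supported ((hB g).1 hg).1 _
  have hz : single F h⁻¹ 1 * y ∈ supported F D.Q := by
    rw [Finset.mul_sum]
    refine Subring.sum_mem _ fun g hg => ?_
    rw [single_mul_single]
    have h1 := (hB g).1 hg
    exact single_mem_supported (D.inv_mul_mem_Q hh h1.1 h1.2.symm) _
  have hz0 : single F h⁻¹ 1 * y = 0 := by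
    refine D.pow_inj _ hz _ (Subring.zero_mem _) N ?_
    rw [(D.commute_of_mem (single_mem_supported (D.I.inv_mem hh) 1) hyI).mul_pow, hy0, mul_zero,
      zero_pow (pow_pos (expChar_pos K p) N).ne']
  have hy' : y = 0 := (isUnit_single h⁻¹ (1 : Kˣ)).mul_left_cancel (hz0.trans (mul_zero _).symm)
  have h4 := congrArg (coeff h) hy'
  rw [map_zero, map_sum, Finset.sum_eq_single_of_mem h ((hB h).2 ⟨hh, rfl⟩), coeff_single_self] at h4
  · exact h4
  · intro g _ hg
    exact coeff_single_of_ne hg.symm _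

omit [ExpChar K p] in
theorem eq_zero_of_pow_eq_zero_of_charZero [CharZero K] {x : CrossedProduct F}
    (hx : x ∈ supported F D.I) {n : ℕ} (hn : x ^ n = 0) : x = 0 := by
  classical
  cases nonempty_fintype G
  by_contra hx0
  obtain ⟨g, hg⟩ : ∃ g, coeff g x ≠ 0 := by
    by_contra! h
    exact hx0 (ext fun g => (h g).trans (map_zero _).symm)
  have hgI : g ∈ D.I := by
    by_contra h
    exact hg (mem_supported.1 hx g h)
  -- Scaled so that every diagonal entry of the matrix of y is 1. A nilpotent y would have trace 0,
  -- while the trace is |G|, which is nonzero in characteristic zero.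
  let s : K := (coeff g x * F (g, g⁻¹) * F (1, 1))⁻¹
  let y : CrossedProduct F := x * (single F g⁻¹ 1 * scalar F s)
  have hy : y ^ n = 0 := by
    rw [(D.commute_of_mem hx (Subring.mul_mem _ (single_mem_supported (D.I.inv_mem hgI) _)
      (scalar_mem_supported s))).mul_pow, hn, zero_mul]
  have hy1 : coeff 1 y * F (1, 1) = 1 := by
    have h1 := coeff_mul_single g⁻¹ g s x
    rw [mul_inv_cancel] at h1
    change coeff 1 (x * (single F g⁻¹ 1 * scalar F s)) * _ = 1
    rw [single_mul_scalar, one_mul, D.smul_eq (D.I.inv_mem hgI), h1, D.smul_eq hgI]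
    have h2 : coeff g x * F (g, g⁻¹) * F (1, 1) ≠ 0 :=
      mul_ne_zero (mul_ne_zero hg (Units.ne_zero _)) (Units.ne_zero _)
    have h3 : coeff g x * F (g, g⁻¹) * F (1, 1) * s = 1 := mul_inv_cancel₀ h2
    linear_combination h3
  have hpow : ∀ m : ℕ, mulMatrix (y ^ (m + 1)) = mulMatrix y ^ (m + 1) := fun m => by
    induction m with
    | zero => rw [zero_add, pow_one, pow_one]
    | succ m ih => rw [pow_succ, mulMatrix_mul, ih, ← pow_succ]
  have hnil : IsNilpotent (mulMatrix y) := ⟨n + 1, by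
    rw [← hpow, pow_succ, hy, zero_mul]
    ext h j
    rw [mulMatrix_apply, mul_zero, map_zero]
    rfl⟩
  have htr := (Matrix.isNilpotent_trace_of_isNilpotent hnil).eq_zero
  rw [Matrix.trace] at htr
  have hdiag : ∀ h : G, (mulMatrix y).diag h = 1 := fun h => by
    have h1 := mulMatrix_apply_mul y h 1
    rw [mul_one] at h1
    have h2 : F (h, 1) = h • F (1, 1) := map_one_snd_of_isMulCocycle₂ F.isCocycle h
    rw [Matrix.diag_apply, h1, h2, Units.coe_smul, ← smul_mul', hy1, smul_one]
  rw [Finset.sum_congr rfl fun h _ => hdiag h, Finset.sum_const, nsmul_one, Nat.cast_eq_zero] at htr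
  exact Fintype.card_ne_zero htr

/-- The part of the crossed product supported on `I` is reduced. -/
theorem eq_zero_of_pow_eq_zero {x : CrossedProduct F} (hx : x ∈ supported F D.I) {n : ℕ}
    (hn : x ^ n = 0) : x = 0 := by
  rcases ‹ExpChar K p› with _ | hp
  · exact D.eq_zero_of_pow_eq_zero_of_charZero hx hn
  · refine D.eq_zero_of_pow_expChar_pow_eq_zero (N := D.a + n) hx (Nat.le_add_right _ _) ?_
    exact pow_eq_zero_of_le ((Nat.le_add_left n D.a).trans (Nat.lt_pow_self hp.one_lt).le) hn

omit [ExpChar K p] in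
/-- A two-sided ideal is stable under the projection to the part supported on `I`. -/
theorem proj_mem_ideal (N : TwoSidedIdeal (CrossedProduct F)) {x : CrossedProduct F} (hx : x ∈ N) :
    proj F D.I x ∈ N := by
  classical
  cases nonempty_fintype G
  suffices H : ∀ n : ℕ, ∀ x ∈ N, (Finset.univ.filter fun g => g ∉ D.I ∧ coeff g x ≠ 0).card = n →
      proj F D.I x ∈ N from H _ x hx rfl
  intro n
  induction n using Nat.strong_induction_on with
  | _ n ih =>
    intro x hx hn
    by_cases h0 : x ∈ supported F D.I
    · rwa [proj_eq_self h0]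
    rw [mem_supported] at h0
    push Not at h0
    obtain ⟨g, hgI, hg⟩ := h0
    obtain ⟨s, hs⟩ : ∃ s : K, g • s ≠ s := by
      by_contra! h
      exact hgI ((D.mem_I g).2 h)
    have hs' : g • s - s ≠ 0 := sub_ne_zero.2 hs
    -- The coefficient at h is multiplied by (g•s - h•s) / (g•s - s), which is 1 on I and 0 at g; so
    -- the support outside I shrinks while the projection to I is unchanged.
    let y : CrossedProduct F := scalar F (g • s - s)⁻¹ * (scalar F (g • s) * x - x * scalar F s)
    have hy : ∀ h, coeff h y = (g • s - s)⁻¹ * (g • s - h • s) * coeff h x := fun h => by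
      rw [coeff_scalar_mul, map_sub, coeff_scalar_mul, coeff_mul_scalar]
      ring
    have hyN : y ∈ N :=
      N.mul_mem_left _ _ (N.sub_mem (N.mul_mem_left _ _ hx) (N.mul_mem_right _ _ hx))
    have hproj : proj F D.I y = proj F D.I x := by
      ext h
      by_cases hh : h ∈ D.I
      · rw [coeff_proj hh, coeff_proj hh, hy, D.smul_eq hh, inv_mul_cancel₀ hs', one_mul]
      · rw [mem_supported.1 (proj_mem y) h hh, mem_supported.1 (proj_mem x) h hh]
    rw [← hproj]
    refine ih _ ?_ y hyN rfl
    rw [← hn]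
    refine Finset.card_lt_card (Finset.ssubset_iff_of_subset (fun h => ?_) |>.2 ⟨g, ?_, ?_⟩)
    · simp only [Finset.mem_filter, Finset.mem_univ, true_and, hy]
      exact fun h1 => ⟨h1.1, right_ne_zero_of_mul h1.2⟩
    · simpa using ⟨hgI, hg⟩
    · simp [hy]

omit [ExpChar K p] in
theorem exists_mem_supported_of_ne_bot (N : TwoSidedIdeal (CrossedProduct F)) (hN : N ≠ ⊥) :
    ∃ x ∈ N, x ∈ supported F D.I ∧ x ≠ 0 := by
  obtain ⟨x, hx, hx0⟩ : ∃ x ∈ N, x ≠ 0 := by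
    by_contra! h
    exact hN (le_bot_iff.1 fun x hx => by rw [h x hx]; exact TwoSidedIdeal.zero_mem _)
  obtain ⟨g, hg⟩ : ∃ g, coeff g x ≠ 0 := by
    by_contra! h
    exact hx0 (ext fun g => (h g).trans (map_zero _).symm)
  -- Translating by g⁻¹ moves a nonzero coefficient to 1 ∈ I, where the projection retains it.
  refine ⟨proj F D.I (x * single F g⁻¹ 1), D.proj_mem_ideal N (N.mul_mem_right _ _ hx),
    proj_mem _, fun h => ?_⟩
  have h1 := congrArg (coeff 1) h
  have h2 := coeff_mul_single g⁻¹ g 1 x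
  rw [mul_inv_cancel] at h2
  rw [coeff_proj D.I.one_mem, h2, map_zero, smul_one, mul_one] at h1
  exact mul_ne_zero hg (Units.ne_zero _) h1

/-- The Jacobson radical is nilpotent; if nonzero it would contain a nonzero element supported on I,
contradicting reducedness. -/
theorem isSemisimpleRing : IsSemisimpleRing (CrossedProduct F) := by
  have : IsArtinianRing (CrossedProduct F) := isArtinian_of_tower K inferInstance
  rw [IsArtinianRing.isSemisimpleRing_iff_jacobson]
  by_contra hne
  have htwo : (Ring.jacobson (CrossedProduct F)).IsTwoSided := inferInstance
  let N : TwoSidedIdeal (CrossedProduct F) := (Ring.jacobson (CrossedProduct F)).toTwoSided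
  have hmem : ∀ x, x ∈ N ↔ x ∈ Ring.jacobson (CrossedProduct F) := fun x =>
    Ideal.mem_toTwoSided
  obtain ⟨x, hxN, hxI, hx0⟩ := D.exists_mem_supported_of_ne_bot N fun h => hne <|
    (Submodule.eq_bot_iff _).2 fun x hx => by
      have := (hmem x).2 hx
      rwa [h, TwoSidedIdeal.mem_bot] at this
  obtain ⟨n, hn⟩ := IsArtinianRing.isNilpotent_jacobson_bot (R := CrossedProduct F)
  rw [Ideal.jacobson_bot] at hn
  refine hx0 (D.eq_zero_of_pow_eq_zero hxI (n := n) ?_)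
  have := Ideal.pow_mem_pow ((hmem x).1 hxN) n
  rwa [hn] at this

end TameDatum

/-! ### Cohomologous cocycles and rescaled bases. -/

namespace UnitCocycle

variable {G K : Type*} [Group G] [CommRing K] [MulSemiringAction G K]

/-- Multiply a 2-cocycle by the coboundary of a 1-cochain. -/
def twist (F : UnitCocycle G K) (ν : G → Kˣ) : UnitCocycle G K where
  toFun p := F p * (p.1 • ν p.2 / ν (p.1 * p.2) * ν p.1)
  isCocycle g h j := by
    have h1 := F.isCocycle g h j
    simp only [smul_mul', smul_div', mul_smul, mul_assoc g h j] at h1 ⊢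
    simp only [div_eq_mul_inv]
    calc _ = F.toFun (g * h, j) * F.toFun (g, h) * ((g • h • ν j) * (ν (g * (h * j)))⁻¹ *
          (g • ν h) * ν g * (ν (g * h) * (ν (g * h))⁻¹)) := by
          simp only [mul_comm, mul_left_comm, mul_assoc]
      _ = g • F.toFun (h, j) * F.toFun (g, h * j) * ((g • h • ν j) * (ν (g * (h * j)))⁻¹ *
          (g • ν h) * ν g * ((g • ν (h * j)) * (g • ν (h * j))⁻¹)) := by
          rw [h1, mul_inv_cancel, mul_inv_cancel]
      _ = _ := by simp only [mul_comm, mul_left_comm, mul_assoc]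

theorem cohomologous_twist (F : UnitCocycle G K) (ν : G → Kˣ) : F.Cohomologous (F.twist ν) :=
  ⟨ν, fun g h => (mul_div_cancel_left (F (g, h)) _).symm⟩

theorem Cohomologous.exists_cochain {F F' : UnitCocycle G K} (h : F.Cohomologous F') :
    ∃ ν : G → Kˣ, ∀ g h, F' (g, h) * ν (g * h) = ν g * g • ν h * F (g, h) := by
  obtain ⟨ν, hν⟩ := h
  refine ⟨ν, fun g h => ?_⟩
  have h1 : F' (g, h) = (g • ν h / ν (g * h) * ν g) * F (g, h) :=
    eq_mul_of_div_eq (hν g h).symm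
  rw [h1, div_eq_mul_inv]
  calc _ = g • ν h * ν g * F (g, h) * ((ν (g * h))⁻¹ * ν (g * h)) := by
        simp only [mul_comm, mul_left_comm, mul_assoc]
    _ = _ := by rw [inv_mul_cancel, mul_one, mul_comm (g • ν h)]

theorem twist_apply (F : UnitCocycle G K) (ν : G → Kˣ) (g h : G) :
    F.twist ν (g, h) * ν (g * h) = ν g * g • ν h * F (g, h) := by
  change F (g, h) * (g • ν h / ν (g * h) * ν g) * ν (g * h) = _
  rw [div_eq_mul_inv]
  calc _ = g • ν h * ν g * F (g, h) * ((ν (g * h))⁻¹ * ν (g * h)) := by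
        simp only [mul_comm, mul_left_comm, mul_assoc]
    _ = _ := by rw [inv_mul_cancel, mul_one, mul_comm (g • ν h)]

end UnitCocycle

namespace CrossedProduct

variable {G K : Type*} [Group G] [CommRing K] [MulSemiringAction G K] {F F' : UnitCocycle G K}

/-- A rescaled basis realizes a cohomologous cocycle. -/
theorem single_mul_single_of_cochain {ν : G → Kˣ} {c : Kˣ} {g h : G}
    (hν : c * ν (g * h) = ν g * g • ν h * F (g, h)) :
    single F g (ν g : K) * single F h (ν h : K) =
      scalar F (c : K) * single F (g * h) (ν (g * h) : K) := by
  rw [single_mul_single, scalar_mul_single, ← Units.val_mul, hν]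
  rfl

end CrossedProduct

/-! ### Subgroups of I on which the cocycle is trivial. -/

namespace TameDatum

variable {G K : Type*} [Group G] [Finite G] [Field K] [MulSemiringAction G K]
  {F : UnitCocycle G K} {p : ℕ} (D : TameDatum F p) {Γ : Subgroup G} (hΓI : Γ ≤ D.I)
include D hΓI

omit [Finite G] in
theorem exists_of_trivialOn (hΓ : F.TrivialOn Γ) :
    ∃ l : Γ → Kˣ, ∀ a b : Γ, l a * l b * F ((a : G), (b : G)) = l (a * b) := by
  obtain ⟨x, hx⟩ := hΓ
  refine ⟨fun a => (x a)⁻¹, fun a b => ?_⟩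
  have h1 : a • x b / x (a * b) * x a = F ((a : G), (b : G)) := hx a b
  have h2 : a • x b = x b := D.smul_units_eq (hΓI a.2) (x b)
  rw [h2] at h1
  change (x a)⁻¹ * (x b)⁻¹ * F ((a : G), (b : G)) = (x (a * b))⁻¹
  rw [← h1, div_eq_mul_inv]
  calc _ = (x a)⁻¹ * x a * ((x b)⁻¹ * x b) * (x (a * b))⁻¹ := by
        simp only [mul_comm, mul_left_comm, mul_assoc]
    _ = _ := by rw [inv_mul_cancel, inv_mul_cancel, one_mul, one_mul]

omit [Finite G] in
theorem trivialOn_of_exists (l : Γ → Kˣ)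
    (hl : ∀ a b : Γ, l a * l b * F ((a : G), (b : G)) = l (a * b)) : F.TrivialOn Γ := by
  refine ⟨fun a => (l a)⁻¹, fun a b => ?_⟩
  have h2 : a • (l b)⁻¹ = (l b)⁻¹ := D.smul_units_eq (hΓI a.2) _
  change a • (l b)⁻¹ / (l (a * b))⁻¹ * (l a)⁻¹ = F ((a : G), (b : G))
  rw [h2, ← hl, div_eq_mul_inv, inv_inv]
  calc _ = (l a)⁻¹ * l a * ((l b)⁻¹ * l b) * F ((a : G), (b : G)) := by
        simp only [mul_comm, mul_left_comm, mul_assoc]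
    _ = _ := by rw [inv_mul_cancel, inv_mul_cancel, one_mul, one_mul]

omit [Finite G] in
/-- A trivialization on a subgroup of `I` embeds its group algebra. -/
theorem exists_monoidHom (l : Γ → Kˣ)
    (hl : ∀ a b : Γ, l a * l b * F ((a : G), (b : G)) = l (a * b)) :
    ∃ v : Γ →* CrossedProduct F, ∀ a, v a = single F (a : G) (l a : K) :=
  ⟨{ toFun a := single F (a : G) (l a : K)
     map_one' := by
      have h1 := hl 1 1
      rw [mul_one, mul_assoc, mul_eq_left] at h1
      rw [one_def, eq_inv_of_mul_eq_one_left h1]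
      rfl
     map_mul' a b := by
      rw [single_mul_single, D.smul_eq (hΓI a.2), ← hl]
      rfl }, fun _ => rfl⟩

-- The rescaled basis element of q has p^a-th power 1, so it equals 1 by injectivity of p-powers.
-- Hence Γ meets Q trivially.
omit [Finite G] in
theorem eq_one_of_mem_Q (hΓ : F.TrivialOn Γ) {q : G} (hq : q ∈ Γ) (hqQ : q ∈ D.Q) : q = 1 := by
  obtain ⟨l, hl⟩ := D.exists_of_trivialOn hΓI hΓ
  obtain ⟨v, hv⟩ := D.exists_monoidHom hΓI l hl
  have h1 : v ⟨q, hq⟩ ^ p ^ D.a = 1 ^ p ^ D.a := by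
    rw [one_pow, ← map_pow, ← map_one v]
    exact congrArg v (Subtype.ext (D.pow_eq_one hqQ))
  have h2 := D.pow_inj _ (by rw [hv]; exact single_mem_supported hqQ _) _ (Subring.one_mem _) _ h1
  rw [hv, one_def] at h2
  exact eq_of_single_eq (Units.ne_zero _) h2

omit [Finite G] in
theorem χ_injOn (hΓ : F.TrivialOn Γ) {a b : G} (ha : a ∈ Γ) (hb : b ∈ Γ) (h : D.χ a = D.χ b) :
    a = b :=
  inv_mul_eq_one.1 (D.eq_one_of_mem_Q hΓI hΓ (Γ.mul_mem (Γ.inv_mem ha) hb)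
    (D.inv_mul_mem_Q (hΓI ha) (hΓI hb) h))

omit [Finite G] in
theorem χΓ_injective (hΓ : F.TrivialOn Γ) :
    Function.Injective (D.χI.comp (Subgroup.inclusion hΓI)) := fun a b h =>
  Subtype.ext (D.χ_injOn hΓI hΓ a.2 b.2 h)

theorem isCyclic (hΓ : F.TrivialOn Γ) : IsCyclic Γ :=
  isCyclic_of_injective_ringHom ((Units.coeHom K).comp (D.χI.comp (Subgroup.inclusion hΓI)))
    (Units.val_injective.comp (D.χΓ_injective hΓI hΓ))

/-- A generator of `Γ`, whose value under `χ` is a primitive root of unity. -/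
theorem exists_primitiveRoot (hΓ : F.TrivialOn Γ) :
    ∃ a₀ : Γ, (∀ a : Γ, ∃ i : ℕ, a = a₀ ^ i) ∧ IsPrimitiveRoot (D.χ a₀ : K) (Nat.card Γ) := by
  have := D.isCyclic hΓI hΓ
  obtain ⟨a₀, ha₀⟩ := IsCyclic.exists_generator (α := Γ)
  refine ⟨a₀, fun a => ?_, ?_⟩
  · obtain ⟨i, hi⟩ := (mem_powers_iff_mem_zpowers).2 (ha₀ a)
    exact ⟨i, hi.symm⟩
  · have h1 := orderOf_injective ((Units.coeHom K).comp (D.χI.comp (Subgroup.inclusion hΓI)))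
      (Units.val_injective.comp (D.χΓ_injective hΓI hΓ)) a₀
    rw [← orderOf_eq_card_of_forall_mem_zpowers ha₀, ← h1]
    exact IsPrimitiveRoot.orderOf _

theorem card_monoidHom (hΓ : F.TrivialOn Γ) : Nat.card (Γ →* Kˣ) = Nat.card Γ := by
  have := D.isCyclic hΓI hΓ
  let _ : CommGroup Γ := IsCyclic.commGroup
  obtain ⟨a₀, -, h⟩ := D.exists_primitiveRoot hΓI hΓ
  have : NeZero (Nat.card Γ) := ⟨Nat.card_pos.ne'⟩
  have : HasEnoughRootsOfUnity K (Nat.card Γ) := ⟨⟨_, h⟩, rootsOfUnity.isCyclic K _⟩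
  have : HasEnoughRootsOfUnity K (Monoid.exponent Γ) :=
    HasEnoughRootsOfUnity.of_dvd K Group.exponent_dvd_nat_card
  exact CommGroup.card_monoidHom_of_hasEnoughRootsOfUnity Γ K

/-- An element x of order p would satisfy x^p = 1^p, so χ(x) = 1 by injectivity of Frobenius, and x
= 1 since χ is injective on Γ. -/
theorem coprime_card [ExpChar K p] (hΓ : F.TrivialOn Γ) (n : ℕ) :
    (Nat.card Γ).Coprime (p ^ n) := by
  refine Nat.Coprime.pow_right n ?_
  rcases ‹ExpChar K p› with _ | hp
  · exact Nat.coprime_one_right _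
  · rw [Nat.coprime_comm, hp.coprime_iff_not_dvd]
    intro hdvd
    have := Fact.mk hp
    obtain ⟨x, hx⟩ := exists_prime_orderOf_dvd_card' p hdvd
    have h1 : (x : G) ^ p ^ 1 = 1 ^ p ^ 1 := by
      rw [pow_one, one_pow, ← hx]
      exact congrArg Subtype.val (pow_orderOf_eq_one x)
    have : ExpChar K p := ExpChar.prime hp
    have h2 := D.χ_injOn hΓI hΓ x.2 Γ.one_mem (D.χ_eq_of_pow_eq (hΓI x.2) D.I.one_mem h1)
    have h3 : x = 1 := Subtype.ext h2
    rw [h3, orderOf_one] at hx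
    exact hp.one_lt.ne hx

theorem card_ne_zero [ExpChar K p] (hΓ : F.TrivialOn Γ) : (Nat.card Γ : K) ≠ 0 := by
  have h := D.coprime_card hΓI hΓ 1
  rw [pow_one] at h
  rcases ‹ExpChar K p› with _ | hp
  · exact Nat.cast_ne_zero.2 Nat.card_pos.ne'
  · rw [Ne, CharP.cast_eq_zero_iff K p]
    exact (hp.coprime_iff_not_dvd).1 h.symm

/-- Subgroups of `I` on which `F` is trivial are normal in `G`. -/
theorem normal [ExpChar K p] (hΓ : F.TrivialOn Γ) : Γ.Normal := by
  refine ⟨fun a ha g => ?_⟩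
  have hτ := D.conj_mem_I (hΓI ha) g
  set τ := g * a * g⁻¹ with hτ_def
  have hτd : τ ^ Nat.card Γ = 1 := by
    have h1 : (⟨a, ha⟩ : Γ) ^ Nat.card Γ = 1 := pow_card_eq_one'
    rw [hτ_def, conj_pow, show a ^ Nat.card Γ = 1 from congrArg Subtype.val h1, mul_one,
      mul_inv_cancel]
  obtain ⟨a₀, -, hprim⟩ := D.exists_primitiveRoot hΓI hΓ
  have hχτ : (D.χ τ : K) ^ Nat.card Γ = 1 := by
    have h1 : D.χI (⟨τ, hτ⟩ ^ Nat.card Γ) = 1 := by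
      rw [← map_one D.χI]
      exact congrArg D.χI (Subtype.ext hτd)
    rw [map_pow] at h1
    exact congrArg Units.val h1
  have : NeZero (Nat.card Γ) := ⟨Nat.card_pos.ne'⟩
  -- The value χ(τ) is a d-th root of unity, d = |Γ|, so it is attained by some b in Γ. Then b⁻¹ τ
  -- lies in Q and has order dividing both d and a power of p, so τ = b.
  obtain ⟨i, -, hi⟩ := hprim.eq_pow_of_pow_eq_one hχτ
  have hb : (a₀ : G) ^ i ∈ Γ := Γ.pow_mem a₀.2 i
  have hχb : D.χ ((a₀ : G) ^ i) = D.χ τ := by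
    refine Units.ext (Eq.trans ?_ hi)
    have := map_pow D.χI ⟨a₀, hΓI a₀.2⟩ i
    exact congrArg Units.val this
  have hq := D.inv_mul_mem_Q (hΓI hb) hτ hχb
  have hqd : (((a₀ : G) ^ i)⁻¹ * τ) ^ Nat.card Γ = 1 := by
    have h1 : (⟨_, hb⟩ : Γ) ^ Nat.card Γ = 1 := pow_card_eq_one'
    rw [(show Commute ((a₀ : G) ^ i)⁻¹ τ from
      D.mul_comm_of_mem_I (D.I.inv_mem (hΓI hb)) hτ).mul_pow, hτd, mul_one, inv_pow,
      show ((a₀ : G) ^ i) ^ Nat.card Γ = 1 from congrArg Subtype.val h1, inv_one]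
  have hq1 : ((a₀ : G) ^ i)⁻¹ * τ = 1 := by
    have h1 := Nat.dvd_gcd (orderOf_dvd_of_pow_eq_one hqd)
      (orderOf_dvd_of_pow_eq_one (D.pow_eq_one hq))
    rw [(D.coprime_card hΓI hΓ D.a).gcd_eq_one, Nat.dvd_one, orderOf_eq_one_iff] at h1
    exact h1
  rw [inv_mul_eq_one] at hq1
  rwa [← hq1]

omit [Finite G] in
/-- A cocycle that is trivial on a subgroup `Γ` of `I` is cohomologous to one adapted to `Γ`. -/
theorem exists_adapted (hΓ : F.TrivialOn Γ) :
    ∃ F' : UnitCocycle G K, F.Cohomologous F' ∧ F'.Adapted Γ := by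
  classical
  obtain ⟨l, hl⟩ := D.exists_of_trivialOn hΓI hΓ
  obtain ⟨v, hv⟩ := D.exists_monoidHom hΓI l hl
  -- Representatives of the cosets g Γ, with 1 representing Γ so that the new cocycle is normalized
  -- at (1, 1). The new basis is w(r) v(a) on r a, hence multiplicative under right translation by
  -- Γ.
  let r : G → G := fun g => if g ∈ Γ then 1 else (g : G ⧸ Γ).out
  have hr : ∀ g, (r g)⁻¹ * g ∈ Γ := fun g => by
    by_cases hg : g ∈ Γ
    · simp [r, hg]
    · simp only [r, hg, if_false]
      exact QuotientGroup.eq.1 (QuotientGroup.out_eq' (g : G ⧸ Γ))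
  have hra : ∀ g, ∀ a ∈ Γ, r (g * a) = r g := fun g a ha => by
    have h1 : g * a ∈ Γ ↔ g ∈ Γ := Γ.mul_mem_cancel_right ha
    have h2 : ((g * a : G) : G ⧸ Γ) = g := QuotientGroup.mk_mul_of_mem g ha
    simp only [r, h1, h2]
  have hr1 : r 1 = 1 := if_pos Γ.one_mem
  let ν : G → Kˣ := fun g =>
    (F (r g, 1))⁻¹ * r g • l ⟨_, hr g⟩ * F (r g, (r g)⁻¹ * g)
  let w : G → CrossedProduct F := fun g => single F g (((F (g, 1))⁻¹ : Kˣ) : K)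
  have hνw : ∀ g, single F g (ν g : K) = w (r g) * v ⟨_, hr g⟩ := fun g => by
    rw [hv, single_mul_single, mul_inv_cancel_left]
    rfl
  have hνw' : ∀ g s (_ : r g = s) (hs : s⁻¹ * g ∈ Γ),
      single F g (ν g : K) = w s * v ⟨s⁻¹ * g, hs⟩ := fun g s h hs => by
    subst h
    exact hνw g
  have hva : ∀ g, ∀ a (ha : a ∈ Γ),
      single F (g * a) (ν (g * a) : K) = single F g (ν g : K) * v ⟨a, ha⟩ := fun g a ha => by
    rw [hνw' (g * a) (r g) (hra g a ha) (by rw [← mul_assoc]; exact Γ.mul_mem (hr g) ha), hνw,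
      mul_assoc (w (r g)), ← map_mul]
    congr 2
    exact Subtype.ext (mul_assoc _ _ _).symm
  have hν1 : ν 1 = (F (1, 1))⁻¹ := by
    have h0 : (1 : G)⁻¹ * 1 = 1 := by rw [inv_one, mul_one]
    have hm : (1 : G)⁻¹ * 1 ∈ Γ := h0.symm ▸ Γ.one_mem
    have h1 := hνw' 1 1 hr1 hm
    have h2 : (⟨(1 : G)⁻¹ * 1, hm⟩ : Γ) = 1 := Subtype.ext h0
    rw [h2, map_one, mul_one] at h1
    exact Units.ext (single_injective 1 h1)
  refine ⟨F.twist ν, F.cohomologous_twist ν, ?_, fun g₁ g₂ a ha => ?_⟩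
  · have h1 := F.twist_apply ν 1 1
    rw [mul_one, one_smul, hν1, inv_mul_cancel_right] at h1
    exact mul_eq_right.1 h1
  · have h1 := single_mul_single_of_cochain (F.twist_apply ν g₁ g₂)
    have h2 := single_mul_single_of_cochain (F.twist_apply ν g₁ (g₂ * a))
    rw [hva g₂ a ha, ← mul_assoc, h1, mul_assoc, ← mul_assoc g₁, ← hva _ a ha,
      scalar_mul_single, scalar_mul_single, ← Units.val_mul, ← Units.val_mul] at h2
    exact mul_right_cancel (Units.ext (single_injective _ h2))

end TameDatum

/-! ### Irreducibility of Kummer polynomials. -/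

/-- Over a field with enough roots of unity, `X^r - β` is irreducible as soon as `β` is not a
proper power of exponent dividing `r`. -/
theorem irreducible_X_pow_sub_C_of_isPrimitiveRoot {K : Type*} [Field K] {r : ℕ} (hr : 0 < r)
    {ζ : K} (hζ : IsPrimitiveRoot ζ r) {β : K} (hβ : β ≠ 0)
    (h : ∀ t s : ℕ, ∀ γ : K, r = t * s → γ ^ s = β → s = 1) :
    Irreducible (Polynomial.X ^ r - Polynomial.C β) := by
  have hmonic : (Polynomial.X ^ r - Polynomial.C β).Monic :=
    Polynomial.monic_X_pow_sub_C β hr.ne'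
  have hdeg : (Polynomial.X ^ r - Polynomial.C β).natDegree = r :=
    Polynomial.natDegree_X_pow_sub_C
  have hne : ¬ IsUnit (Polynomial.X ^ r - Polynomial.C β) := fun hu => by
    have := Polynomial.natDegree_eq_zero_of_isUnit hu
    omega
  obtain ⟨f, hfm, hfi, hfd⟩ := Polynomial.exists_monic_irreducible_factor _ hne
  let Ω := AlgebraicClosure K
  let i := algebraMap K Ω
  -- With r-th roots of unity in K, all roots of the factor f are K-multiples of one root y, so its
  -- constant term puts y^(deg f) in K. As y^r = β is also in K, so is the power of y with exponent
  -- gcd(deg f, r), and the hypothesis forces this gcd to be r.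
  have hpow : ∀ x : Ω, (f.map i).IsRoot x → x ^ r = i β := fun x hx => by
    have h1 := (hx.dvd (Polynomial.map_dvd i hfd))
    simpa [sub_eq_zero] using h1
  have hf0 : f.degree ≠ 0 := Polynomial.degree_ne_of_natDegree_ne fun h0 =>
    hfi.not_isUnit (hfm.natDegree_eq_zero.1 h0 ▸ isUnit_one)
  obtain ⟨y, hy⟩ := IsAlgClosed.exists_eval₂_eq_zero i f hf0
  have hyr : y ^ r = i β := hpow y (by rwa [Polynomial.IsRoot, Polynomial.eval_map])
  have hy0 : y ≠ 0 := fun h0 => by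
    rw [h0, zero_pow hr.ne', eq_comm, map_eq_zero] at hyr
    exact hβ hyr
  have : NeZero r := ⟨hr.ne'⟩
  have hroot : ∀ x ∈ (f.map i).roots, ∃ ω : K, x = i ω * y := fun x hx => by
    have h1 : (x / y) ^ r = 1 := by
      rw [div_pow, hpow x (Polynomial.isRoot_of_mem_roots hx), hyr,
        div_self ((map_ne_zero i).2 hβ)]
    obtain ⟨k, -, hk⟩ := (hζ.map_of_injective i.injective).eq_pow_of_pow_eq_one h1
    exact ⟨ζ ^ k, by rw [map_pow, hk, div_mul_cancel₀ _ hy0]⟩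
  have hprod : ∀ s : Multiset Ω, (∀ x ∈ s, ∃ ω : K, x = i ω * y) →
      ∃ ω : K, s.prod = i ω * y ^ s.card := fun s => by
    induction s using Multiset.induction_on with
    | empty => exact fun _ => ⟨1, by simp⟩
    | cons x s ih =>
      intro hs
      obtain ⟨ω, hω⟩ := ih fun z hz => hs z (Multiset.mem_cons_of_mem hz)
      obtain ⟨ω', hω'⟩ := hs x (Multiset.mem_cons_self x s)
      refine ⟨ω' * ω, ?_⟩
      rw [Multiset.prod_cons, hω, Multiset.card_cons, map_mul, pow_succ]
      conv_lhs => rw [hω']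
      ring
  obtain ⟨ω, hω⟩ := hprod _ hroot
  have hsplit : (f.map i).Splits := IsAlgClosed.splits _
  have hcard : (f.map i).roots.card = f.natDegree := by
    rw [← hsplit.natDegree_eq_card_roots, Polynomial.natDegree_map]
  have hcoeff := hsplit.coeff_zero_eq_prod_roots_of_monic (hfm.map i)
  rw [hω, hcard, Polynomial.coeff_map] at hcoeff
  have hfc : f.coeff 0 ≠ 0 := fun h0 => by
    have h1 : (f.map i).IsRoot 0 := by
      rw [Polynomial.IsRoot, ← Polynomial.coeff_zero_eq_eval_zero, Polynomial.coeff_map, h0,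
        map_zero]
    have h2 := hpow 0 h1
    rw [zero_pow hr.ne', eq_comm, map_eq_zero] at h2
    exact hβ h2
  have hω0 : i ω ≠ 0 := fun h0 => by
    rw [h0, zero_mul, mul_zero, map_eq_zero] at hcoeff
    exact hfc hcoeff
  have hyj : y ^ f.natDegree ∈ i.fieldRange := by
    refine ⟨(-1) ^ f.natDegree * f.coeff 0 * ω⁻¹, ?_⟩
    have h1 : ((-1 : Ω) ^ f.natDegree) * (-1) ^ (f.map i).natDegree = 1 := by
      rw [Polynomial.natDegree_map, ← mul_pow, neg_mul_neg, one_mul, one_pow]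
    rw [map_mul, map_mul, hcoeff, map_inv₀, map_pow, map_neg, map_one]
    calc _ = ((-1 : Ω) ^ f.natDegree * (-1) ^ (f.map i).natDegree) * (i ω * (i ω)⁻¹) *
          y ^ f.natDegree := by ring
      _ = _ := by rw [h1, mul_inv_cancel₀ hω0, one_mul, one_mul]
  have hyg : y ^ (f.natDegree.gcd r) ∈ i.fieldRange := by
    have h1 : y ^ (f.natDegree.gcd r) = (y ^ f.natDegree) ^ (f.natDegree.gcdA r) *
        (y ^ r) ^ (f.natDegree.gcdB r) := by
      rw [← zpow_natCast, ← zpow_natCast, ← zpow_natCast, ← zpow_mul, ← zpow_mul,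
        ← zpow_add₀ hy0, Nat.gcd_eq_gcd_ab]
    rw [h1, hyr]
    exact mul_mem (zpow_mem hyj _) (zpow_mem (show i β ∈ i.fieldRange from ⟨β, rfl⟩) _)
  obtain ⟨γ, hγ⟩ := hyg
  have hgr := Nat.gcd_dvd_right f.natDegree r
  have hs := h (f.natDegree.gcd r) (r / f.natDegree.gcd r) γ (Nat.mul_div_cancel' hgr).symm <| by
    refine i.injective ?_
    change i γ = _ at hγ
    rw [map_pow, hγ, ← pow_mul, Nat.mul_div_cancel' hgr, hyr]
  have hgeq : f.natDegree.gcd r = r := by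
    have := Nat.mul_div_cancel' hgr
    rwa [hs, mul_one] at this
  have hle : r ≤ f.natDegree := by
    refine Nat.le_of_dvd (Nat.pos_of_ne_zero fun h0 => hf0 ?_) (hgeq ▸ Nat.gcd_dvd_left _ _)
    rw [hfm.natDegree_eq_zero.1 h0, Polynomial.degree_one]
  have heq : Polynomial.X ^ r - Polynomial.C β = f :=
    Polynomial.eq_of_monic_of_dvd_of_natDegree_le hfm hmonic hfd (by rw [hdeg]; exact hle)
  rwa [heq]

/-! ### Adapted cocycles, the pairing π and the idempotents of Γ. -/

/-- A maximal subgroup `Γ` of `I` on which `F` is trivial, a cocycle `F'` adapted to `Γ`, and a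
cochain `ν` whose coboundary is `F' / F`. -/
structure AdaptedDatum {G K : Type*} [Group G] [Field K] [MulSemiringAction G K]
    {F : UnitCocycle G K} {p : ℕ} (D : TameDatum F p) (Γ : Subgroup G) where
  le_I : Γ ≤ D.I
  trivialOn : F.TrivialOn Γ
  maximal : ∀ H : Subgroup G, H ≤ D.I → F.TrivialOn H → Γ ≤ H → H ≤ Γ
  F' : UnitCocycle G K
  adapted : F'.Adapted Γ
  ν : G → Kˣ
  coboundary : ∀ g h, F' (g, h) * ν (g * h) = ν g * g • ν h * F (g, h)

namespace AdaptedDatum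

variable {G K : Type*} [Group G] [Finite G] [Field K] [MulSemiringAction G K]
  {F : UnitCocycle G K} {p : ℕ} [ExpChar K p] {D : TameDatum F p} {Γ : Subgroup G}
  (B : AdaptedDatum D Γ)
include B

theorem normal : Γ.Normal := D.normal B.le_I B.trivialOn

omit [Finite G] [ExpChar K p] in
theorem F'_one_left (g : G) : B.F' (1, g) = 1 :=
  (map_one_fst_of_isMulCocycle₂ B.F'.isCocycle g).trans B.adapted.1

omit [Finite G] [ExpChar K p] in
theorem F'_of_mem (g : G) {a : G} (ha : a ∈ Γ) : B.F' (g, a) = 1 := by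
  have h1 := B.adapted.2 g 1 a ha
  rw [one_mul] at h1
  have h2 : B.F' (g, 1) = g • B.F' (1, 1) := map_one_snd_of_isMulCocycle₂ B.F'.isCocycle g
  rw [← h1, h2, B.adapted.1, smul_one]

/-- Normality of Γ turns a h into h (h⁻¹ a h), so right invariance becomes left invariance. -/
theorem F'_mul_left (g h : G) {a : G} (ha : a ∈ Γ) : B.F' (g, a * h) = B.F' (g, h) := by
  have h1 := B.adapted.2 g h (h⁻¹ * a * h) (by simpa using B.normal.conj_mem a ha h⁻¹)
  rw [h1]
  congr 2
  group

/-- The character `a ↦ F'(a, g)` of `Γ`. -/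
def character (g : G) : Γ →* Kˣ where
  toFun a := B.F' ((a : G), g)
  map_one' := B.F'_one_left g
  map_mul' a b := by
    have h1 : B.F' ((a : G) * b, g) * B.F' ((a : G), (b : G)) =
      (a : G) • B.F' ((b : G), g) * B.F' ((a : G), b * g) := B.F'.isCocycle a b g
    rw [B.F'_of_mem _ b.2, mul_one, D.smul_units_eq (B.le_I a.2), B.F'_mul_left _ _ b.2,
      mul_comm] at h1
    exact h1

theorem character_apply (g : G) (a : Γ) : B.character g a = B.F' ((a : G), g) := rfl

-- The value of χ at a generator of Γ is a primitive |Γ|-th root of unity. Characters of Γ thereby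
-- inherit the equivariance of χ under conjugation by G.
omit [ExpChar K p] in
theorem exists_eq_pow (ψ : Γ →* Kˣ) : ∃ j : ℕ, ∀ a : Γ, ψ a = D.χ a ^ j := by
  obtain ⟨a₀, ha₀, hprim⟩ := D.exists_primitiveRoot B.le_I B.trivialOn
  have : NeZero (Nat.card Γ) := ⟨Nat.card_pos.ne'⟩
  obtain ⟨j, -, hj⟩ := hprim.eq_pow_of_pow_eq_one (ξ := (ψ a₀ : K)) (by
    rw [← Units.val_pow_eq_pow_val, ← map_pow, pow_card_eq_one', map_one, Units.val_one])
  have hj' : D.χ a₀ ^ j = ψ a₀ := Units.ext (by rw [Units.val_pow_eq_pow_val, hj])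
  refine ⟨j, fun a => ?_⟩
  obtain ⟨i, rfl⟩ := ha₀ a
  have h1 : D.χ ((a₀ ^ i : Γ) : G) = D.χ a₀ ^ i :=
    map_pow (D.χI.comp (Subgroup.inclusion B.le_I)) a₀ i
  rw [map_pow, ← hj', h1, ← pow_mul, ← pow_mul, mul_comm]

omit [ExpChar K p] in
theorem smul_apply_eq (ψ : Γ →* Kˣ) (g : G) {a b : Γ} (hab : (b : G) = g * a * g⁻¹) :
    g • ψ a = ψ b := by
  obtain ⟨j, hj⟩ := B.exists_eq_pow ψ
  rw [hj, hj, hab, D.χ_conj (B.le_I a.2), smul_pow']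

/-- The cocycle identity for (g, g⁻¹ a g, h) reduces, by adaptedness and equivariance, to F'(a g, h)
= F'(a, h) F'(g, h); the identity for (a, g, h) then gives the claim. -/
theorem character_mul (g h : G) : B.character (g * h) = B.character g * B.character h := by
  ext1 a
  have hb : g⁻¹ * a * g ∈ Γ := by simpa using B.normal.conj_mem a a.2 g⁻¹
  have h1 : B.F' ((a : G) * g, h) * B.F' ((a : G), g) =
    (a : G) • B.F' (g, h) * B.F' ((a : G), g * h) := B.F'.isCocycle a g h
  have h2 : B.F' (g * (g⁻¹ * a * g), h) * B.F' (g, g⁻¹ * a * g) =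
    g • B.F' (g⁻¹ * a * g, h) * B.F' (g, g⁻¹ * a * g * h) := B.F'.isCocycle g (g⁻¹ * a * g) h
  have h3 : g • B.F' (g⁻¹ * a * g, h) = B.F' ((a : G), h) :=
    B.smul_apply_eq (B.character h) g (a := ⟨_, hb⟩) (b := a) (by group)
  rw [B.F'_of_mem _ hb, mul_one, h3, B.F'_mul_left _ _ hb,
    show g * (g⁻¹ * a * g) = a * g by group] at h2
  rw [h2, D.smul_units_eq (B.le_I a.2), mul_comm (B.F' ((a : G), h)), mul_assoc] at h1
  rw [MonoidHom.mul_apply, character_apply, character_apply, character_apply,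
    ← mul_left_cancel h1, mul_comm]

theorem character_of_mem {a : G} (ha : a ∈ Γ) : B.character a = 1 := by
  ext1 b
  exact B.F'_of_mem b ha

/-- The homomorphism `g Γ ↦ F'(·, g)`. -/
def pairing (hn : Γ.Normal) : G ⧸ Γ →* (Γ →* Kˣ) :=
  QuotientGroup.lift Γ
    { toFun := B.character
      map_one' := B.character_of_mem Γ.one_mem
      map_mul' := B.character_mul } fun _ ha => B.character_of_mem ha

theorem mem_range_pairing (hn : Γ.Normal) (ψ : Γ →* Kˣ) :
    ψ ∈ (B.pairing hn).range ↔ ∃ g, B.character g = ψ := by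
  constructor
  · rintro ⟨x, rfl⟩
    obtain ⟨g, rfl⟩ := QuotientGroup.mk_surjective x
    exact ⟨g, rfl⟩
  · rintro ⟨g, rfl⟩
    exact ⟨(g : G ⧸ Γ), rfl⟩

/-- The rescaled basis, which multiplies according to `F'`. -/
noncomputable def basis (g : G) : CrossedProduct F := single F g (B.ν g : K)

omit [Finite G] [ExpChar K p] in
theorem basis_mul (g h : G) :
    B.basis g * B.basis h = scalar F (B.F' (g, h) : K) * B.basis (g * h) :=
  single_mul_single_of_cochain (B.coboundary g h)

omit [Finite G] [ExpChar K p] in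
theorem basis_mul_of_mem (g : G) {a : G} (ha : a ∈ Γ) :
    B.basis g * B.basis a = B.basis (g * a) := by
  rw [B.basis_mul, B.F'_of_mem _ ha, Units.val_one, map_one, one_mul]

omit [Finite G] [ExpChar K p] in
theorem isUnit_basis (g : G) : IsUnit (B.basis g) := isUnit_single g (B.ν g)

omit [Finite G] [ExpChar K p] in
theorem basis_one : B.basis 1 = 1 := by
  have h1 := B.basis_mul_of_mem 1 Γ.one_mem
  rw [mul_one] at h1
  exact (B.isUnit_basis 1).mul_eq_left.1 h1

omit [Finite G] [ExpChar K p] in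
theorem basis_mem {a : G} (ha : a ∈ Γ) : B.basis a ∈ supported F Γ := single_mem_supported ha _

omit [Finite G] [ExpChar K p] B in
theorem supported_mono {H H' : Subgroup G} (h : H ≤ H') : supported F H ≤ supported F H' :=
  fun _ hx => mem_supported.2 fun g hg => mem_supported.1 hx g fun h1 => hg (h h1)

variable [Fintype Γ]

/-- The idempotent of the character `ψ` of `Γ`. -/
noncomputable def idem (ψ : Γ →* Kˣ) : CrossedProduct F :=
  scalar F (Nat.card Γ : K)⁻¹ * ∑ a : Γ, scalar F ((ψ a)⁻¹ : Kˣ) * B.basis a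

omit [Finite G] [ExpChar K p] in
theorem idem_mem (ψ : Γ →* Kˣ) : B.idem ψ ∈ supported F Γ :=
  mul_mem (scalar_mem_supported _) <| sum_mem fun a _ =>
    mul_mem (scalar_mem_supported _) (B.basis_mem a.2)

omit [Finite G] [ExpChar K p] in
theorem idem_mem_I (ψ : Γ →* Kˣ) : B.idem ψ ∈ supported F D.I :=
  supported_mono B.le_I (B.idem_mem ψ)

omit [ExpChar K p] in
theorem commute_idem (ψ : Γ →* Kˣ) {x : CrossedProduct F} (hx : x ∈ supported F D.I) :
    Commute x (B.idem ψ) := D.commute_of_mem hx (B.idem_mem_I ψ)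

omit [Finite G] [ExpChar K p] in
theorem basis_mul_idem (ψ : Γ →* Kˣ) (b : Γ) :
    B.basis b * B.idem ψ = scalar F (ψ b : K) * B.idem ψ := by
  have hc : ∀ t, Commute (B.basis b) (scalar F t) := fun t =>
    (D.commute_scalar (supported_mono B.le_I (B.basis_mem b.2)) t).symm
  have hs : ∀ s t : K, Commute (scalar F s) (scalar F t) := fun s t => by
    rw [commute_iff_eq, ← map_mul, mul_comm, map_mul]
  rw [idem, (hc _).left_comm, (hs _ _).left_comm, Finset.mul_sum _ _ (B.basis b),
    Finset.mul_sum _ _ (scalar F (ψ b : K))]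
  refine congrArg (scalar F (Nat.card Γ : K)⁻¹ * ·)
    (Fintype.sum_equiv (Equiv.mulLeft b) _ _ fun a => ?_)
  rw [(hc _).left_comm, B.basis_mul_of_mem _ a.2, ← mul_assoc, ← map_mul, Equiv.coe_mulLeft,
    ← Units.val_mul, map_mul ψ, mul_inv, mul_inv_cancel_left]
  rfl

theorem idem_mul_self (ψ : Γ →* Kˣ) : B.idem ψ * B.idem ψ = B.idem ψ := by
  have h1 : ∀ a : Γ, scalar F (((ψ a)⁻¹ : Kˣ) : K) * B.basis a * B.idem ψ = B.idem ψ := fun a => by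
    rw [mul_assoc, B.basis_mul_idem, ← mul_assoc, ← map_mul, Units.inv_mul, map_one, one_mul]
  have h0 : (Nat.card Γ : K) ≠ 0 := D.card_ne_zero B.le_I B.trivialOn
  have h2 : B.idem ψ * B.idem ψ = scalar F (Nat.card Γ : K)⁻¹ *
      ∑ a : Γ, scalar F (((ψ a)⁻¹ : Kˣ) : K) * B.basis a * B.idem ψ := by
    rw [← Finset.sum_mul, ← mul_assoc]
    rfl
  rw [h2, Finset.sum_congr rfl fun a _ => h1 a, Finset.sum_const, Finset.card_univ,
    ← Nat.card_eq_fintype_card, ← Nat.cast_smul_eq_nsmul K,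
    scalar_mul, smul_smul, inv_mul_cancel₀ h0, one_smul]

omit [ExpChar K p] in
theorem idem_mul_of_ne {ψ ψ' : Γ →* Kˣ} (h : ψ ≠ ψ') : B.idem ψ * B.idem ψ' = 0 := by
  obtain ⟨b, hb⟩ : ∃ b, ψ b ≠ ψ' b := by
    by_contra! h1
    exact h (MonoidHom.ext h1)
  have h1 : scalar F (ψ b : K) * (B.idem ψ * B.idem ψ') =
      scalar F (ψ' b : K) * (B.idem ψ * B.idem ψ') := by
    have h2 := supported_mono B.le_I (B.basis_mem b.2)
    rw [← mul_assoc, ← B.basis_mul_idem, mul_assoc, (B.commute_idem ψ h2).left_comm,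
      B.basis_mul_idem, (B.commute_idem ψ (scalar_mem_supported _)).left_comm]
  rw [scalar_mul, scalar_mul] at h1
  by_contra h0
  exact hb (Units.ext (smul_left_injective K h0 h1))

omit [Finite G] [ExpChar K p] in
theorem coeff_one_idem (ψ : Γ →* Kˣ) :
    coeff 1 (B.idem ψ) = (Nat.card Γ : K)⁻¹ * (B.ν 1 : K) := by
  rw [idem, coeff_scalar_mul, map_sum, Finset.sum_eq_single (1 : Γ)]
  · rw [coeff_scalar_mul, map_one, inv_one, Units.val_one, one_mul, OneMemClass.coe_one, basis,
      coeff_single_self]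
  · intro a _ ha
    rw [coeff_scalar_mul, basis, coeff_single_of_ne, mul_zero]
    simpa [eq_comm] using ha
  · simp

theorem coeff_one_idem_ne_zero (ψ : Γ →* Kˣ) : coeff 1 (B.idem ψ) ≠ 0 := by
  rw [B.coeff_one_idem]
  exact mul_ne_zero (inv_ne_zero (D.card_ne_zero B.le_I B.trivialOn)) (Units.ne_zero _)

theorem idem_ne_zero (ψ : Γ →* Kˣ) : B.idem ψ ≠ 0 := fun h =>
  B.coeff_one_idem_ne_zero ψ (by rw [h, map_zero])

omit [ExpChar K p] [Fintype Γ] in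
theorem finite_characters : Finite (Γ →* Kˣ) := by
  refine Nat.finite_of_card_ne_zero ?_
  rw [D.card_monoidHom B.le_I B.trivialOn]
  exact Nat.card_pos.ne'

theorem sum_idem [Fintype (Γ →* Kˣ)] : ∑ ψ : Γ →* Kˣ, B.idem ψ = 1 := by
  have hcomm : ∀ a : Γ, a ≠ 1 → ∑ ψ : Γ →* Kˣ, (((ψ a)⁻¹ : Kˣ) : K) = 0 := fun a ha => by
    -- Translation by a character that is nontrivial at a shows that the sum vanishes; the inverse
    -- of χ serves, as χ is injective on Γ.
    let χ₀ : Γ →* Kˣ := (D.χI.comp (Subgroup.inclusion B.le_I))⁻¹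
    have h1 : χ₀ a ≠ 1 := fun h1 => ha <|
      D.χΓ_injective B.le_I B.trivialOn ((inv_eq_one.1 h1).trans (map_one _).symm)
    have h2 : ∑ ψ : Γ →* Kˣ, (((ψ a)⁻¹ : Kˣ) : K) =
        (((χ₀ a)⁻¹ : Kˣ) : K) * ∑ ψ : Γ →* Kˣ, (((ψ a)⁻¹ : Kˣ) : K) := by
      rw [Finset.mul_sum]
      refine (Fintype.sum_equiv (Equiv.mulLeft χ₀) _ _ fun ψ => ?_).symm
      rw [Equiv.coe_mulLeft, MonoidHom.mul_apply, mul_inv, Units.val_mul]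
    by_contra h3
    exact h1 (inv_eq_one.1 (Units.ext (mul_right_cancel₀ h3 (h2.symm.trans (one_mul _).symm))))
  have h0 : (Nat.card Γ : K) ≠ 0 := D.card_ne_zero B.le_I B.trivialOn
  simp only [idem]
  rw [← Finset.mul_sum, Finset.sum_comm, Finset.sum_eq_single (1 : Γ)]
  · have h1 : Fintype.card (Γ →* Kˣ) = Nat.card Γ := by
      rw [← Nat.card_eq_fintype_card, D.card_monoidHom B.le_I B.trivialOn]
    simp only [map_one, inv_one, Units.val_one, one_mul, OneMemClass.coe_one, B.basis_one,
      Finset.sum_const, Finset.card_univ, h1]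
    rw [nsmul_one, ← map_natCast (scalar F), ← map_mul, inv_mul_cancel₀ h0, map_one]
  · intro a _ ha
    rw [← Finset.sum_mul, ← map_sum, hcomm a ha, map_zero, zero_mul]
  · simp

omit [Finite G] [ExpChar K p] [Fintype Γ] in
theorem basis_mul_scalar (g : G) (t : K) :
    B.basis g * scalar F t = scalar F (g • t) * B.basis g := by
  rw [basis, single_mul_scalar, scalar_mul_single, mul_comm]

/-- Conjugation by U_g permutes the basis elements of Γ up to the scalars F'(b, g), while
equivariance absorbs the action of g on the values of ψ. This is how π acts on the idempotents. -/
theorem basis_mul_idem_eq (ψ : Γ →* Kˣ) (g : G) :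
    B.basis g * B.idem ψ = B.idem (ψ * B.character g) * B.basis g := by
  have hn := B.normal
  have h0 : g • (Nat.card Γ : K)⁻¹ = (Nat.card Γ : K)⁻¹ := by
    change MulSemiringAction.toRingHom G K g _ = _
    rw [map_inv₀, map_natCast]
  rw [idem, idem, ← mul_assoc, B.basis_mul_scalar, h0, mul_assoc, mul_assoc, Finset.mul_sum,
    Finset.sum_mul]
  refine congrArg _ (Fintype.sum_equiv (MulAut.conjNormal g).toEquiv _ _ fun a => ?_)
  let b : Γ := MulAut.conjNormal g a
  have hb : (b : G) = g * a * g⁻¹ := MulAut.conjNormal_apply g a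
  change _ = scalar F (((ψ * B.character g) b)⁻¹ : Kˣ) * B.basis b * B.basis g
  rw [← mul_assoc, B.basis_mul_scalar, mul_assoc, B.basis_mul_of_mem _ a.2, mul_assoc,
    B.basis_mul, ← mul_assoc, ← map_mul, hb, inv_mul_cancel_right, ← hb, ← Units.coe_smul,
    smul_inv', B.smul_apply_eq ψ g hb, MonoidHom.mul_apply, mul_inv, ← Units.val_mul,
    character_apply, inv_mul_cancel_right]

end AdaptedDatum

/-! ### Consequences of the maximality of Γ. -/

namespace AdaptedDatum

variable {G K : Type*} [Group G] [Finite G] [Field K] [MulSemiringAction G K]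
  {F : UnitCocycle G K} {p : ℕ} [ExpChar K p] {D : TameDatum F p} {Γ : Subgroup G}
  (B : AdaptedDatum D Γ)
include B

omit [Finite G] [ExpChar K p] in
/-- By maximality of `Γ`, no further basis element becomes a scalar on a module on which the basis
elements of `Γ` are scalars. -/
theorem mem_of_single_mul_eq {e : CrossedProduct F} (he : e ≠ 0)
    (hΓe : ∀ b ∈ Γ, ∃ l : Kˣ, single F b (l : K) * e = e) {x : G} (hx : x ∈ D.I) {l : Kˣ}
    (hl : single F x (l : K) * e = e) : x ∈ Γ := by
  have hmul : ∀ {x y : G} {l m : Kˣ}, x ∈ D.I → single F x (l : K) * e = e →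
      single F y (m : K) * e = e → single F (x * y) ((l * m * F (x, y) : Kˣ) : K) * e = e := by
    intro x y l m hx h1 h2
    have h3 := single_mul_single (f := F) x y (l : K) (m : K)
    rw [D.smul_eq hx] at h3
    rw [Units.val_mul, Units.val_mul, ← h3, mul_assoc, h2, h1]
  -- Nonzero homogeneous elements are units, so the scaling fixing e is unique. The scalings thus
  -- trivialize F on the subgroup H of all elements of I admitting one, and H contains Γ.
  have huniq : ∀ {x : G} {l m : Kˣ}, single F x (l : K) * e = e → single F x (m : K) * e = e →
      l = m := by
    intro x l m h1 h2
    by_contra hlm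
    have h3 : (l : K) - m ≠ 0 := sub_ne_zero.2 fun h => hlm (Units.ext h)
    have h4 : single F x ((Units.mk0 _ h3 : Kˣ) : K) * e = 0 := by
      rw [Units.val_mk0, sub_eq_add_neg, single_add, add_mul, h1]
      have h5 : single F x (-(m : K)) = - single F x (m : K) := by
        rw [eq_neg_iff_add_eq_zero, ← single_add, neg_add_cancel, single_zero]
      rw [h5, neg_mul, h2, add_neg_cancel]
    exact he ((isUnit_single x _).mul_right_eq_zero.1 h4)
  let H : Subgroup G :=
    { carrier := {x | x ∈ D.I ∧ ∃ l : Kˣ, single F x (l : K) * e = e}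
      one_mem' := ⟨D.I.one_mem, (F (1, 1))⁻¹, by
        rw [← one_def, one_mul]⟩
      mul_mem' := fun ⟨hx, l, h1⟩ ⟨hy, m, h2⟩ => ⟨D.I.mul_mem hx hy, _, hmul hx h1 h2⟩
      inv_mem' := by
        rintro x ⟨hx, l, h1⟩
        refine ⟨D.I.inv_mem hx, (F (1, 1))⁻¹ * (F (x⁻¹, x))⁻¹ * l⁻¹, ?_⟩
        have h2 : single F x⁻¹ (((F (1, 1))⁻¹ * (F (x⁻¹, x))⁻¹ * l⁻¹ : Kˣ) : K) *
            single F x (l : K) = 1 := by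
          rw [single_mul_single, D.smul_eq (D.I.inv_mem hx), ← Units.val_mul, ← Units.val_mul,
            inv_mul_cancel_right, inv_mul_cancel_right, inv_mul_cancel, one_def]
        conv_lhs => rw [← h1]
        rw [← mul_assoc, h2, one_mul] }
  have hHI : H ≤ D.I := fun x hx => hx.1
  choose m hm using fun x : H => x.2.2
  refine B.maximal H hHI (D.trivialOn_of_exists hHI m fun x y => ?_)
    (fun b hb => ⟨B.le_I hb, hΓe b hb⟩) ⟨hx, l, hl⟩
  exact huniq (hmul (hHI x.2) (hm x) (hm y)) (hm (x * y))

variable [Fintype Γ]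

/-- The p^a-th power of e_ψ y is h(u) e_ψ for a polynomial h, and it is nonzero by reducedness. On
e_ψ the element u satisfies X^r = β, which is irreducible, so h(u) e_ψ has an inverse in K[u] e_ψ
and the ideal contains e_ψ. -/
theorem idem_mem_of_mul_ne_zero (N : TwoSidedIdeal (CrossedProduct F)) {y : CrossedProduct F}
    (hyI : y ∈ supported F D.I) (hyN : y ∈ N) (ψ : Γ →* Kˣ) (hy0 : B.idem ψ * y ≠ 0) :
    B.idem ψ ∈ N := by
  classical
  cases nonempty_fintype G
  have hnorm := B.normal
  have hexp : ExpChar (CrossedProduct F) p := expChar_of_injective_ringHom scalar_injective p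
  set e := B.idem ψ with he_def
  have heI : e ∈ supported F D.I := B.idem_mem_I ψ
  have hee : e * e = e := B.idem_mul_self ψ
  have hpos : 0 < p ^ D.a := pow_pos (expChar_pos K p) _
  obtain ⟨g₀, hg₀, hgen⟩ := D.exists_generator
  set c := g₀ ^ p ^ D.a with hc_def
  have hcI : c ∈ D.I := D.I.pow_mem hg₀ _
  let u : CrossedProduct F := single F c ((1 : Kˣ) : K)
  have huI : u ∈ supported F D.I := single_mem_supported hcI _
  let ε : Polynomial K →+* supported F D.I := Polynomial.eval₂RingHom'
    ((scalar F).codRestrict (supported F D.I) fun t => scalar_mem_supported t) ⟨u, huI⟩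
    fun t => Subtype.ext (D.commute_of_mem (scalar_mem_supported t) huI)
  have hεC : ∀ t, (ε (Polynomial.C t) : CrossedProduct F) = scalar F t := fun t => by
    simp [ε, Polynomial.eval₂RingHom']
  have hεX : ∀ n, (ε (Polynomial.X ^ n) : CrossedProduct F) = u ^ n := fun n => by
    simp [ε, Polynomial.eval₂RingHom']
  -- the power of `e * y` is a polynomial in `u`
  obtain ⟨h, hh⟩ : ∃ h : Polynomial K, y ^ p ^ D.a = ε h := by
    have hpow : ∀ g, ∃ h : Polynomial K, single F g (coeff g y) ^ p ^ D.a = ε h := fun g => by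
      by_cases h0 : coeff g y = 0
      · exact ⟨0, by rw [h0, single_zero, zero_pow hpos.ne', map_zero]; rfl⟩
      have hgI : g ∈ D.I := by
        by_contra h1
        exact h0 (mem_supported.1 hyI g h1)
      obtain ⟨i, q, hq, rfl⟩ := hgen g hgI
      obtain ⟨t, ht⟩ := exists_single_pow_eq (F := F) (g₀ ^ i * q) (Units.mk0 _ h0) (p ^ D.a)
      obtain ⟨t', ht'⟩ := exists_single_pow_eq (F := F) c 1 i
      refine ⟨Polynomial.C ((t * t'⁻¹ : Kˣ) : K) * Polynomial.X ^ i, ?_⟩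
      have hgc : (g₀ ^ i * q) ^ p ^ D.a = c ^ i := by
        rw [(show Commute (g₀ ^ i) q from D.mul_comm_of_mem_I (D.I.pow_mem hg₀ i)
          (D.Q_le_I hq)).mul_pow, D.pow_eq_one hq, mul_one, hc_def, ← pow_mul, ← pow_mul, mul_comm]
      rw [Units.val_mk0] at ht
      rw [ht, map_mul, Subring.coe_mul, hεC, hεX, ht', scalar_mul_single, hgc, ← Units.val_mul,
        inv_mul_cancel_right]
    choose h hh using hpow
    refine ⟨∑ g, h g, ?_⟩
    rw [map_sum, AddSubmonoidClass.coe_finsetSum, ← Finset.sum_congr rfl fun g _ => hh g,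
      ← sum_pow_expChar_pow_of_commute p D.a, sum_single]
    have hyg : ∀ g, single F g (coeff g y) ∈ supported F D.I := fun g => by
      by_cases hg : g ∈ D.I
      · exact single_mem_supported hg _
      · rw [mem_supported.1 hyI g hg, single_zero]
        exact zero_mem _
    exact fun g _ g' _ => D.commute_of_mem (hyg g) (hyg g')
  have hz : (e * y) ^ p ^ D.a = ε h * e := by
    rw [(D.commute_of_mem heI hyI).mul_pow, hh,
      IsIdempotentElem.pow_eq hee hpos.ne']
    exact D.commute_of_mem heI (ε h).2
  have hz0 : (ε h : CrossedProduct F) * e ≠ 0 := fun h0 =>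
    hy0 (D.eq_zero_of_pow_eq_zero (mul_mem heI hyI) (hz.trans h0))
  have hzN : (ε h : CrossedProduct F) * e ∈ N := by
    rw [← hz, ← Nat.succ_pred_eq_of_pos hpos, pow_succ]
    exact N.mul_mem_left _ _ (N.mul_mem_left _ _ hyN)
  -- `c ^ r` is the first power of `c` in `Γ`
  set r := orderOf (c : G ⧸ Γ) with hr_def
  have hr : 0 < r := orderOf_pos _
  have hmem : ∀ n, c ^ n ∈ Γ ↔ r ∣ n := fun n => by
    rw [← QuotientGroup.eq_one_iff, QuotientGroup.mk_pow, orderOf_dvd_iff_pow_eq_one]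
  obtain ⟨β, hβ⟩ : ∃ β : Kˣ, u ^ r * e = scalar F (β : K) * e := by
    obtain ⟨t, ht⟩ := exists_single_pow_eq (F := F) c 1 r
    have hcr := (hmem r).2 dvd_rfl
    refine ⟨t * (B.ν (c ^ r))⁻¹ * ψ ⟨_, hcr⟩, ?_⟩
    have h1 := B.basis_mul_idem ψ ⟨_, hcr⟩
    have h2 : u ^ r = scalar F ((t * (B.ν (c ^ r))⁻¹ : Kˣ) : K) * B.basis (c ^ r) := by
      rw [basis, scalar_mul_single, ← Units.val_mul, inv_mul_cancel_right, ht]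
    rw [h2, mul_assoc, h1, ← mul_assoc, ← map_mul, ← Units.val_mul]
  have hann : (ε (Polynomial.X ^ r - Polynomial.C (β : K)) : CrossedProduct F) * e = 0 := by
    rw [map_sub, AddSubgroupClass.coe_sub, hεC, hεX, sub_mul, hβ, sub_self]
  -- a primitive `r`-th root of unity
  obtain ⟨ζ, hζ⟩ : ∃ ζ : K, IsPrimitiveRoot ζ r := by
    set n := orderOf (D.χI ⟨c, hcI⟩) with hn_def
    have hn : 0 < n := (D.χI.isOfFinOrder (isOfFinOrder_of_finite _)).orderOf_pos
    -- As χ(g₀^n) has p^a-th power χ(c)^n = 1, it is 1; so g₀^n lies in Q, and its p^a-th power c^n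
    -- is trivial. Hence r divides n, and χ(c) yields the root of unity.
    have hcn : c ^ n = 1 := by
      have h1 : D.χI (⟨g₀, hg₀⟩ ^ n) = 1 := by
        have h2 : D.χI (⟨g₀, hg₀⟩ ^ n) ^ p ^ D.a = 1 := by
          rw [map_pow, ← pow_mul, mul_comm, pow_mul, ← map_pow]
          exact pow_orderOf_eq_one _
        refine Units.ext (iterateFrobenius_inj K p D.a ?_)
        rw [iterateFrobenius_def, iterateFrobenius_def, ← Units.val_pow_eq_pow_val, h2,
          Units.val_one, one_pow]
      have h2 : g₀ ^ n ∈ D.Q := (D.mem_Q _).2 ⟨D.I.pow_mem hg₀ n, h1⟩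
      rw [hc_def, ← pow_mul, mul_comm, pow_mul, D.pow_eq_one h2]
    obtain ⟨k, hk⟩ := (hmem n).1 (hcn ▸ Γ.one_mem)
    have h1 : IsPrimitiveRoot ((D.χI ⟨c, hcI⟩ : Kˣ) : K) n :=
      (IsPrimitiveRoot.orderOf _).map_of_injective (f := Units.coeHom K) Units.val_injective
    exact ⟨_, h1.pow hn (hk.trans (mul_comm _ _))⟩
  have hirr : Irreducible (Polynomial.X ^ r - Polynomial.C (β : K)) := by
    refine irreducible_X_pow_sub_C_of_isPrimitiveRoot hr hζ β.ne_zero fun t s γ hts hγ => ?_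
    have hs : 0 < s := Nat.pos_of_ne_zero fun h => by simp [h] at hts; omega
    have ht : 0 < t := Nat.pos_of_ne_zero fun h => by simp [h] at hts; omega
    have hγ0 : γ ≠ 0 := fun h => β.ne_zero (by rw [← hγ, h, zero_pow hs.ne'])
    -- If γ^s = β, then w = γ⁻¹ u^t satisfies w^s e = e, and w fixes the sum e' of the w^i e for i <
    -- s. Maximality puts c^t in Γ, so r = t s divides t and s = 1.
    obtain ⟨l, hl⟩ : ∃ l : Kˣ, scalar F γ⁻¹ * u ^ t = single F (c ^ t) (l : K) := by
      obtain ⟨m, hm⟩ := exists_single_pow_eq (F := F) c 1 t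
      exact ⟨(Units.mk0 γ hγ0)⁻¹ * m, by rw [hm, scalar_mul_single]; simp⟩
    set w := single F (c ^ t) (l : K) with hw_def
    have hwI : w ∈ supported F D.I := single_mem_supported (D.I.pow_mem hcI t) _
    have hws : w ^ s * e = e := by
      rw [← hl, (D.commute_of_mem (scalar_mem_supported _) (pow_mem huI t)).mul_pow, ← map_pow,
        ← pow_mul, ← hts, mul_assoc, hβ, ← mul_assoc, ← map_mul, inv_pow, hγ,
        inv_mul_cancel₀ β.ne_zero, map_one, one_mul]
    let e' := (∑ i ∈ Finset.range s, w ^ i) * e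
    have he'I : ∑ i ∈ Finset.range s, w ^ i ∈ supported F D.I := sum_mem fun i _ => pow_mem hwI i
    have hwe' : w * e' = e' := by
      have h1 : w * (∑ i ∈ Finset.range s, w ^ i) + 1 = (∑ i ∈ Finset.range s, w ^ i) + w ^ s := by
        rw [← Finset.sum_range_succ, Finset.sum_range_succ', pow_zero, Finset.mul_sum]
        simp only [pow_succ']
      have h2 := congrArg (· * e) h1
      simp only [add_mul, one_mul, hws] at h2
      rw [← mul_assoc]
      exact add_right_cancel h2
    -- For 0 < i < s the element c^(t i) is outside Γ, so only i = 0 contributes to the coefficient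
    -- of e' at 1, and e' ≠ 0.
    have hsupp : ∀ i, c ^ (t * i) ∉ Γ → coeff 1 (w ^ i * e) = 0 := fun i hi => by
      obtain ⟨m, hm⟩ := exists_single_pow_eq (F := F) (c ^ t) l i
      have h1 := coeff_single_mul (f := F) (c ^ (t * i)) (c ^ (t * i))⁻¹ (m : K) e
      rw [mul_inv_cancel, mem_supported.1 (B.idem_mem ψ) _ fun h => hi (Γ.inv_mem_iff.1 h),
        smul_zero, mul_zero, zero_mul] at h1
      rw [hw_def, hm, ← pow_mul, h1]
    have he'0 : e' ≠ 0 := fun h => by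
      have h1 := congrArg (coeff 1) h
      change coeff 1 ((∑ i ∈ Finset.range s, w ^ i) * e) = _ at h1
      rw [map_zero, Finset.sum_mul, map_sum, Finset.sum_eq_single_of_mem 0 (by simpa using hs),
        pow_zero, one_mul] at h1
      · exact B.coeff_one_idem_ne_zero ψ h1
      · intro i hi hi0
        refine hsupp i fun h2 => ?_
        have h3 := (hmem _).1 h2
        rw [hts] at h3
        exact absurd (Nat.le_of_dvd (Nat.pos_of_ne_zero hi0) (Nat.dvd_of_mul_dvd_mul_left ht h3))
          (not_le.2 (Finset.mem_range.1 hi))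
    have hct : c ^ t ∈ Γ := by
      refine B.mem_of_single_mul_eq he'0 (fun b hb => ⟨(ψ ⟨b, hb⟩)⁻¹ * B.ν b, ?_⟩)
        (D.I.pow_mem hcI t) hwe'
      have h1 : single F b (((ψ ⟨b, hb⟩)⁻¹ * B.ν b : Kˣ) : K) =
          scalar F (((ψ ⟨b, hb⟩)⁻¹ : Kˣ) : K) * B.basis b := by
        rw [basis, scalar_mul_single, Units.val_mul]
      have h2 := D.commute_of_mem (supported_mono B.le_I (B.basis_mem hb)) he'I
      have h3 := D.commute_of_mem (scalar_mem_supported (ψ ⟨b, hb⟩ : K)) he'I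
      rw [h1, mul_assoc, h2.left_comm, B.basis_mul_idem ψ ⟨b, hb⟩, ← h3.left_comm, ← mul_assoc,
        ← map_mul, Units.inv_mul, map_one, one_mul]
    have h1 := Nat.le_of_dvd ht ((hmem t).1 hct)
    rw [hts] at h1
    exact le_antisymm (by nlinarith) hs
  obtain ⟨b, a, hab⟩ := (hirr.coprime_iff_not_dvd (n := h)).2 fun ⟨k, hk⟩ => hz0 (by
    rw [hk, mul_comm, map_mul, Subring.coe_mul, mul_assoc, hann, mul_zero])
  have hfin : e = (ε a : CrossedProduct F) * (ε h * e) := by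
    have h1 := congrArg (fun P => (ε P : CrossedProduct F) * e) hab
    simp only [map_add, map_mul, map_one, Subring.coe_add, Subring.coe_mul, Subring.coe_one,
      add_mul, one_mul, mul_assoc] at h1
    rw [hann, mul_zero, zero_add] at h1
    exact h1.symm
  rw [hfin]
  exact N.mul_mem_left _ _ hzN

end AdaptedDatum

/-! ### Simple components and cosets of the image of π. -/

namespace AdaptedDatum

variable {G K : Type*} [Group G] [Finite G] [Field K] [MulSemiringAction G K]
  {F : UnitCocycle G K} {p : ℕ} [ExpChar K p] {D : TameDatum F p} {Γ : Subgroup G}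
  (B : AdaptedDatum D Γ) [Fintype Γ]
include B

/-- A nonzero x of N supported on I has e_ψ x ≠ 0 for some ψ, because the idempotents sum to 1. -/
theorem exists_idem_mem (N : TwoSidedIdeal (CrossedProduct F)) (hN : N ≠ ⊥) :
    ∃ ψ, B.idem ψ ∈ N := by
  have := B.finite_characters
  cases nonempty_fintype (Γ →* Kˣ)
  obtain ⟨x, hxN, hxI, hx0⟩ := D.exists_mem_supported_of_ne_bot N hN
  by_contra! h
  refine hx0 ?_
  rw [← one_mul x, ← B.sum_idem, Finset.sum_mul]
  refine Finset.sum_eq_zero fun ψ _ => ?_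
  by_contra h0
  exact h ψ (B.idem_mem_of_mul_ne_zero N hxI hxN ψ h0)

theorem idem_mul_character_mem (N : TwoSidedIdeal (CrossedProduct F)) {ψ : Γ →* Kˣ} (g : G)
    (h : B.idem ψ ∈ N) : B.idem (ψ * B.character g) ∈ N := by
  obtain ⟨u, hu⟩ := B.isUnit_basis g
  have h1 := N.mul_mem_right _ (↑u⁻¹ : CrossedProduct F) (N.mul_mem_left (B.basis g) _ h)
  rwa [B.basis_mul_idem_eq, ← hu, mul_assoc, Units.mul_inv, mul_one] at h1

/-- The two-sided ideal generated by the idempotent of `ψ`. -/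
noncomputable def component (ψ : Γ →* Kˣ) : TwoSidedIdeal (CrossedProduct F) :=
  TwoSidedIdeal.span {B.idem ψ}

omit [Finite G] [ExpChar K p] in
theorem idem_mem_component (ψ : Γ →* Kˣ) : B.idem ψ ∈ B.component ψ :=
  TwoSidedIdeal.subset_span rfl

omit [Finite G] [ExpChar K p] in
theorem component_le {ψ : Γ →* Kˣ} {N : TwoSidedIdeal (CrossedProduct F)} :
    B.component ψ ≤ N ↔ B.idem ψ ∈ N := by
  rw [component, TwoSidedIdeal.span_le, Set.singleton_subset_iff, SetLike.mem_coe]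

theorem component_ne_bot (ψ : Γ →* Kˣ) : B.component ψ ≠ ⊥ := fun h => by
  have h1 := B.idem_mem_component ψ
  rw [h, TwoSidedIdeal.mem_bot] at h1
  exact B.idem_ne_zero ψ h1

theorem idem_mem_component_iff {ψ ψ' : Γ →* Kˣ} :
    B.idem ψ' ∈ B.component ψ ↔ ∃ g, B.character g = ψ⁻¹ * ψ' := by
  constructor
  · intro h
    by_contra! hne
    -- The annihilator of e_ψ' T. If no g carries ψ to ψ', it contains e_ψ by orthogonality, hence
    -- the whole component of ψ; were e_ψ' in that component, it would kill itself.
    let N : TwoSidedIdeal (CrossedProduct F) := TwoSidedIdeal.mk'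
      {x | ∀ t, B.idem ψ' * t * x = 0} (fun t => mul_zero _)
      (fun hx hy t => by rw [mul_add, hx t, hy t, add_zero])
      (fun hx t => by rw [mul_neg, hx t, neg_zero])
      (fun {x y} hy t => by rw [← mul_assoc, mul_assoc _ t x]; exact hy _)
      (fun hx t => by rw [← mul_assoc, hx t, zero_mul])
    have hN : ∀ x, x ∈ N ↔ ∀ t, B.idem ψ' * t * x = 0 := fun x => TwoSidedIdeal.mem_mk' ..
    have hψ : B.idem ψ ∈ N := (hN _).2 fun t => by
      induction t using CrossedProduct.induction with
      | h0 => rw [mul_zero, zero_mul]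
      | ha x y hx hy => rw [mul_add, add_mul, hx, hy, add_zero]
      | hs g s =>
        have h1 : single F g s = scalar F (s * ((B.ν g)⁻¹ : Kˣ)) * B.basis g := by
          rw [basis, scalar_mul_single, mul_assoc, Units.inv_mul, mul_one]
        have h2 : ψ' ≠ ψ * B.character g := fun h2 => hne g <| by
          rw [h2]
          exact (inv_mul_cancel_left ψ _).symm
        rw [h1, mul_assoc, mul_assoc, B.basis_mul_idem_eq,
          (B.commute_idem ψ' (scalar_mem_supported _)).symm.left_comm, ← mul_assoc (B.idem ψ'),
          B.idem_mul_of_ne h2, zero_mul, mul_zero]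
    have h3 := (hN _).1 (B.component_le.2 hψ h) 1
    rw [mul_one, B.idem_mul_self] at h3
    exact B.idem_ne_zero ψ' h3
  · rintro ⟨g, hg⟩
    have h1 := B.idem_mul_character_mem _ g (B.idem_mem_component ψ)
    rwa [hg, show ψ * (ψ⁻¹ * ψ') = ψ' from mul_inv_cancel_left ψ ψ'] at h1

/-- The relation between ψ and ψ' is symmetric because g⁻¹ reverses the passage from ψ to ψ'. This
makes each component minimal. -/
theorem component_le_component {ψ ψ' : Γ →* Kˣ} (h : B.component ψ' ≤ B.component ψ) :
    B.component ψ ≤ B.component ψ' := by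
  obtain ⟨g, hg⟩ := B.idem_mem_component_iff.1 (B.component_le.1 h)
  refine B.component_le.2 (B.idem_mem_component_iff.2 ⟨g⁻¹, ?_⟩)
  have h1 := B.character_mul g⁻¹ g
  rw [inv_mul_cancel, B.character_of_mem Γ.one_mem] at h1
  rw [hg] at h1
  exact (eq_inv_of_mul_eq_one_left h1.symm).trans
    ((mul_inv_rev ψ⁻¹ ψ').trans (congrArg (ψ'⁻¹ * ·) (inv_inv ψ)))

theorem component_isAtom (ψ : Γ →* Kˣ) : IsAtom (B.component ψ) := by
  refine ⟨B.component_ne_bot ψ, fun N hN => ?_⟩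
  by_contra h0
  obtain ⟨ψ', hψ'⟩ := B.exists_idem_mem N h0
  have h1 := B.component_le.2 hψ'
  exact hN.not_ge ((B.component_le_component (h1.trans hN.le)).trans h1)

theorem simpleComponents_eq : simpleComponents (CrossedProduct F) = Set.range B.component := by
  ext N
  constructor
  · intro hN
    obtain ⟨ψ, hψ⟩ := B.exists_idem_mem N hN.1
    exact ⟨ψ, (hN.le_iff.1 (B.component_le.2 hψ)).resolve_left (B.component_ne_bot ψ)⟩
  · rintro ⟨ψ, rfl⟩
    exact B.component_isAtom ψ

theorem component_eq_iff (hn : Γ.Normal) {ψ ψ' : Γ →* Kˣ} :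
    B.component ψ = B.component ψ' ↔ ψ⁻¹ * ψ' ∈ (B.pairing hn).range := by
  rw [B.mem_range_pairing, ← B.idem_mem_component_iff, ← B.component_le]
  exact ⟨fun h => h.ge, fun h => le_antisymm (B.component_le_component h) h⟩

theorem ncard_simpleComponents (hn : Γ.Normal) :
    (simpleComponents (CrossedProduct F)).ncard = (B.pairing hn).range.index := by
  let j : (Γ →* Kˣ) ⧸ (B.pairing hn).range → TwoSidedIdeal (CrossedProduct F) :=
    Quotient.lift B.component fun ψ ψ' h =>
      (B.component_eq_iff hn).2 (QuotientGroup.leftRel_apply.1 h)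
  have hj : Function.Injective j := by
    intro x y
    induction x using QuotientGroup.induction_on
    induction y using QuotientGroup.induction_on
    exact fun h => QuotientGroup.eq.2 ((B.component_eq_iff hn).1 h)
  have hr : Set.range B.component = Set.range j := by
    ext N
    constructor
    · rintro ⟨ψ, rfl⟩
      exact ⟨QuotientGroup.mk ψ, rfl⟩
    · rintro ⟨x, rfl⟩
      obtain ⟨ψ, rfl⟩ := QuotientGroup.mk_surjective x
      exact ⟨ψ, rfl⟩
  rw [B.simpleComponents_eq, hr, ← Set.image_univ, Set.ncard_image_of_injective _ hj,
    Set.ncard_univ]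
  rfl

/-- Since Γ has exactly |Γ| characters, the numerical condition says that π is surjective, that is,
all idempotents lie in one component. -/
theorem isSimpleRing_iff (hn : Γ.Normal) :
    IsSimpleRing (CrossedProduct F) ↔ Nat.card (B.pairing hn).range = Nat.card Γ := by
  have hfin := B.finite_characters
  rw [← D.card_monoidHom B.le_I B.trivialOn, Subgroup.card_eq_iff_eq_top]
  constructor
  · intro h
    rw [eq_top_iff]
    intro ψ _
    have h1 : ∀ ψ, B.component ψ = ⊤ := fun ψ =>
      (eq_bot_or_eq_top _).resolve_left (B.component_ne_bot ψ)
    have h2 := (B.component_eq_iff hn (ψ := 1) (ψ' := ψ)).1 ((h1 1).trans (h1 ψ).symm)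
    rwa [show (1 : Γ →* Kˣ)⁻¹ * ψ = ψ from (congrArg (· * ψ) inv_one).trans (one_mul ψ)] at h2
  · intro h
    refine ⟨⟨fun N => or_iff_not_imp_left.2 fun hN => ?_⟩⟩
    cases nonempty_fintype (Γ →* Kˣ)
    obtain ⟨ψ, hψ⟩ := B.exists_idem_mem N hN
    have h1 : ∀ ψ', B.idem ψ' ∈ N := fun ψ' => B.component_le.1
      (((B.component_eq_iff hn (ψ := ψ) (ψ' := ψ')).2 (h ▸ Subgroup.mem_top _)).ge.trans
        (B.component_le.2 hψ))
    rw [← TwoSidedIdeal.one_mem_iff, ← B.sum_idem]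
    exact sum_mem fun ψ' _ => h1 ψ'

end AdaptedDatum

/-! ### Assembly of the tame datum and the main theorem. -/

/-- The inertia group, the wild inertia group and the action on a uniformizer. -/
theorem exists_tameDatum {S G : Type*} [CommRing S] [IsDomain S] [IsDiscreteValuationRing S]
    [Group G] [Finite G] [MulSemiringAction G S] [FaithfulSMul G S]
    (hsep : ResiduallySeparable G S) (f : UnitCocycle G S)
    (hproj : ∀ J : Submodule (CrossedProduct f) (CrossedProduct f),
      Module.Projective (CrossedProduct f) J)
    (p : ℕ) [ExpChar (ResidueField S) p] :
    ∃ D : TameDatum f.reduction p, D.I = (maximalIdeal S).toAddSubgroup.inertia G := by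
  obtain ⟨ϖ, hϖ⟩ := IsDiscreteValuationRing.exists_irreducible S
  obtain ⟨a, ha⟩ := card_wildInertia (G := G) hϖ p
  have hres : ∀ q : wildInertia G hϖ, ∀ s : S, residue S (q • s) = residue S s := fun q =>
    (mem_inertia_iff_residue (q : G)).1 ((mem_wildInertia hϖ).1 q.2).1
  obtain ⟨Ψ, hΨ⟩ : ∃ Ψ : CrossedProduct (f.reduction.restrict (wildInertia G hϖ)) →+*
      AlgebraicClosure (ResidueField S), Function.Injective Ψ := exists_injective_to_algebraicClosure (f.restrict (wildInertia G hϖ))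
    (projective_restrict f _ hproj)
    (fun q s => smul_residueField_of_mem_inertia ((mem_wildInertia hϖ).1 q.2).1 s)
    (exists_fixed_residue_eq hsep _ hres p a ha) p a ha
  have hK : ExpChar (AlgebraicClosure (ResidueField S)) p :=
    expChar_of_injective_algebraMap (algebraMap (ResidueField S) _).injective p
  refine ⟨
    { I := (maximalIdeal S).toAddSubgroup.inertia G
      mem_I := fun g => ⟨smul_residueField_of_mem_inertia, mem_inertia_of_smul⟩
      χ := tameChar hϖ
      χ_mul := tameChar_mul hϖ
      Q := wildInertia G hϖ
      mem_Q := fun g => mem_wildInertia hϖ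
      a := a
      card_Q := ha
      pow_inj := ?_ }, rfl⟩
  rintro _ ⟨x, rfl⟩ _ ⟨y, rfl⟩ n h
  rw [← map_pow, ← map_pow] at h
  have h1 := congrArg Ψ (ofSubgroup_injective _ _ h)
  rw [map_pow, map_pow] at h1
  -- Injectivity of p-powers is pulled back along Ψ from the algebraic closure, where the iterated
  -- Frobenius is injective.
  refine congrArg _ (hΨ (iterateFrobenius_inj _ p n ?_))
  rwa [iterateFrobenius_def, iterateFrobenius_def]

theorem mainTheorem4 {S G : Type*} [CommRing S] [IsDomain S] [IsDiscreteValuationRing S]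
    [Group G] [Finite G] [MulSemiringAction G S] [FaithfulSMul G S]
    (hsep : ResiduallySeparable G S)
    (f : UnitCocycle G S) (hher : IsHereditaryRing (CrossedProduct f))
    (Γ : Subgroup G) (hΓ : IsMaximalTrivial f Γ) :
    (∃ e : (CrossedProduct.maximalIdealMul f).ringCon.Quotient ≃+* CrossedProduct f.reduction,
      ∀ (g : G) (s : S), e (CrossedProduct.single f g s : CrossedProduct f) =
        CrossedProduct.single f.reduction g (residue S s)) ∧
    IsSemisimpleRing (CrossedProduct f.reduction) ∧
    Nat.card (Γ →* (ResidueField S)ˣ) = Nat.card Γ ∧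
    ∃ _ : Γ.Normal,
      (∃ f' : UnitCocycle G (ResidueField S), f.reduction.Cohomologous f' ∧ f'.Adapted Γ) ∧
      ∀ f' : UnitCocycle G (ResidueField S), f.reduction.Cohomologous f' → f'.Adapted Γ →
        ∃ π : G ⧸ Γ →* (Γ →* (ResidueField S)ˣ),
          (∀ (g : G) (a : Γ), π (g : G ⧸ Γ) a = f' ((a : G), g)) ∧
          (simpleComponents (CrossedProduct f.reduction)).ncard = π.range.index ∧
          (IsSimpleRing (CrossedProduct f.reduction) ↔ Nat.card π.range = Nat.card Γ) := by
  cases nonempty_fintype Γ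
  obtain ⟨p, hp⟩ := ExpChar.exists (ResidueField S)
  obtain ⟨D, hD⟩ := exists_tameDatum hsep f hher.1 p
  have hΓI : Γ ≤ D.I := hΓ.prop.1.trans hD.ge
  have hΓt := hΓ.prop.2
  have hn := D.normal hΓI hΓt
  refine ⟨exists_quotient_equiv f, D.isSemisimpleRing, D.card_monoidHom hΓI hΓt, hn,
    D.exists_adapted hΓI hΓt, fun f' hf' had => ?_⟩
  obtain ⟨ν, hν⟩ := hf'.exists_cochain
  let B : AdaptedDatum D Γ :=
    { le_I := hΓI
      trivialOn := hΓt
      maximal := fun H hH hHt hΓH => hΓ.le_of_ge ⟨hH.trans hD.le, hHt⟩ hΓH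
      F' := f'
      adapted := had
      ν := ν
      coboundary := hν }
  exact ⟨B.pairing hn, fun _ _ => rfl, B.ncard_simpleComponents hn, B.isSimpleRing_iff hn⟩
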